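/- Fix a field $\mathbb k$ and a real number $\omega>2$ such that $n\times n$ matrices over $\mathbb k$ can be multiplied in time $O(n^{\omega})$. Time is measured on a random access machine which stores machine words (natural numbers of $O(\log N)$ bits, $N$ being the size of the input), elements of $\mathbb k$, and elements of a poset $Q$, and on which each arithmetic operation on words, each field operation or equality test in $\mathbb k$, each (indirectly addressed) memory access and each comparison $p\le q$ of two elements of $Q$ takes constant time; poset elements can only be copied and compared. For a poset $Q$, a $Q$-module is a functor from $Q$ to $\mathbb k$-vector spaces. It is free of rank $n$ if it is a direct sum of $n$ interval modules $\mathbb k^{\{q\,:\,q\ge q_j\}}$; equivalently, if it has an ordered basis, i.e. elements $b_1,\dots,b_n$ of grades $q_1,\dots,q_n\in Q$ such that for each $q\in Q$ the images at $q$ of the $b_j$ with $q_j\le q$ form a basis of the vector space at $q$. A morphism $\gamma$ between free modules with ordered bases $(b_j)$, $(b'_i)$ is represented by the matrix $[\gamma]$ whose $j$-th column consists of the coefficients of $\gamma(b_j)$ with respect to the images of the $b'_i$ with $\mathrm{gr}(b'_i)\le \mathrm{gr}(b_j)$, the other entries being $0$; its rows and columns are labeled by the grades of the $b'_i$ and $b_j$.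 A $(Q,r)$-complex is a chain complex $X\xrightarrow{f}Y\xrightarrow{g}Z$ of free $Q$-modules of total rank $r$, represented by labeled matrices $[f],[g]$; its homology is $H=\ker g/\operatorname{im} f$. A subposet $i\colon P\hookrightarrow Q$ (not necessarily full) is a subset of $Q$ with a partial order contained in that of $Q$, and $|P|$ is the number of its relations $p\le q$, including the identities $p\le p$. A matrix representation of a $P$-module $G$ consists of an ordered basis of each vector space $G_p$, $p\in P$, and the matrices of all structure maps $G_{pq}$, $p\le q$ in $P$, with respect to these bases. **Proposition.** There is an algorithm (a single program, depending only on $\mathbb k$ and $\omega$) which does the following. Given 1. a poset $Q$, represented in such a way that pairs of elements can be compared in constant time, 2. a $(Q,r)$-complex $X\to Y\to Z$ with homology $H$, and 3. the set of relations of a subposet $i\colon P\hookrightarrow Q$ with finitely many relations, it computes a matrix representation of $H\circ i$ in time $O(|P|\,r^{\omega})$. Here the implied constant depends only on $\mathbb k$ and $\omega$, the basis elements of $H_p$ are given by representing cycles in coordinates with respect to the basis of $Y_p$ induced by that of $Y$, and $|P|$ and $r$ are to be replaced by $1$ in the bound where they are $0$. -/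

import Mathlib

open CategoryTheory

universe u v w

namespace PosetComplex

/-! ## The machine model

A random access machine with three kinds of data: natural numbers (machine words, used as indices
and counters), scalars of a fixed field `k`, and elements of a poset `Q`.  Poset elements are opaque
to the machine: it can only copy them and compare them.  Every machine operation, in particular a
field operation, a test `x = y` in `k`, an arithmetic operation on words, a memory access (with
indirect addressing) and a comparison `p ≤ q` in `Q`, takes one unit of time.  Words are bounded:
an instruction can only be executed if all the numbers it computes are at most the bound `W`. -/

/-- A memory: a family of arrays `0, 1, 2, …`, each of them with three indices. -/
abbrev Mem (V : Type*) : Type _ := ℕ → ℕ → ℕ → ℕ → V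

/-- The memory after writing `x` in the cell `(i, j, l)` of array `a`. -/
def Mem.write {V : Type*} (m : Mem V) (a i j l : ℕ) (x : V) : Mem V :=
  fun a' i' j' l' => if a' = a ∧ i' = i ∧ j' = j ∧ l' = l then x else m a' i' j' l'

/-- A state of the machine. A cell of the third memory holds an element of `Q` or nothing. -/
structure State (k : Type u) (Q : Type v) where
  nat : Mem ℕ
  scal : Mem k
  elt : Mem (Option Q)

/-- Arithmetic operations on words. -/
inductive NOp
  | add | sub | mul | div

/-- Subtraction is truncated and division is rounded down. -/
def NOp.eval : NOp → ℕ → ℕ → ℕ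
  | add, x, y => x + y
  | sub, x, y => x - y
  | mul, x, y => x * y
  | div, x, y => x / y

/-- Expressions for words: literals, array reads, and operations. -/
inductive NExp
  | lit (n : ℕ)
  | get (a : ℕ) (i j l : NExp)
  | op (o : NOp) (e f : NExp)

namespace NExp

def eval (m : Mem ℕ) : NExp → ℕ
  | lit n => n
  | get a i j l => m a (i.eval m) (j.eval m) (l.eval m)
  | op o e f => o.eval (e.eval m) (f.eval m)

/-- All the numbers computed during the evaluation are at most `W`. -/
def Fits (W : ℕ) (m : Mem ℕ) : NExp → Prop
  | lit n => n ≤ W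
  | get _ i j l => i.Fits W m ∧ j.Fits W m ∧ l.Fits W m
  | op o e f => e.Fits W m ∧ f.Fits W m ∧ o.eval (e.eval m) (f.eval m) ≤ W

/-- Time to evaluate. -/
def cost : NExp → ℕ
  | lit _ => 1
  | get _ i j l => 1 + i.cost + j.cost + l.cost
  | op _ e f => 1 + e.cost + f.cost

end NExp

/-- Field operations. -/
inductive KOp
  | add | sub | mul | div

def KOp.eval {k : Type u} [Field k] : KOp → k → k → k
  | add, x, y => x + y
  | sub, x, y => x - y
  | mul, x, y => x * y
  | div, x, y => x / y

/-- Expressions for scalars. -/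
inductive KExp (k : Type u)
  | lit (x : k)
  | get (a : ℕ) (i j l : NExp)
  | op (o : KOp) (e f : KExp k)

namespace KExp

variable {k : Type u}

def eval [Field k] {Q : Type v} (s : State k Q) : KExp k → k
  | lit x => x
  | get a i j l => s.scal a (i.eval s.nat) (j.eval s.nat) (l.eval s.nat)
  | op o e f => o.eval (e.eval s) (f.eval s)

def Fits (W : ℕ) (m : Mem ℕ) : KExp k → Prop
  | lit _ => True
  | get _ i j l => i.Fits W m ∧ j.Fits W m ∧ l.Fits W m
  | op _ e f => e.Fits W m ∧ f.Fits W m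

def cost : KExp k → ℕ
  | lit _ => 1
  | get _ i j l => 1 + i.cost + j.cost + l.cost
  | op _ e f => 1 + e.cost + f.cost

end KExp

/-- Expressions for poset elements: these can only be read from memory. -/
structure QExp where
  a : ℕ
  i : NExp
  j : NExp
  l : NExp

namespace QExp

def eval {k : Type u} {Q : Type v} (s : State k Q) (e : QExp) : Option Q :=
  s.elt e.a (e.i.eval s.nat) (e.j.eval s.nat) (e.l.eval s.nat)

def Fits (W : ℕ) (m : Mem ℕ) (e : QExp) : Prop :=
  e.i.Fits W m ∧ e.j.Fits W m ∧ e.l.Fits W m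

def cost (e : QExp) : ℕ := 1 + e.i.cost + e.j.cost + e.l.cost

end QExp

/-- Tests. -/
inductive BExp (k : Type u)
  | nlt (e f : NExp)
  | neq (e f : NExp)
  | keq (e f : KExp k)
  | qle (e f : QExp)
  | not (b : BExp k)
  | and (b c : BExp k)

namespace BExp

variable {k : Type u}

/-- The test succeeds. The test `qle` compares two elements of `Q`. -/
def Holds [Field k] {Q : Type v} [PartialOrder Q] (s : State k Q) : BExp k → Prop
  | nlt e f => e.eval s.nat < f.eval s.nat
  | neq e f => e.eval s.nat = f.eval s.nat
  | keq e f => e.eval s = f.eval s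
  | qle e f => ∃ p q : Q, e.eval s = some p ∧ f.eval s = some q ∧ p ≤ q
  | not b => ¬ b.Holds s
  | and b c => b.Holds s ∧ c.Holds s

def Fits (W : ℕ) (m : Mem ℕ) : BExp k → Prop
  | nlt e f => e.Fits W m ∧ f.Fits W m
  | neq e f => e.Fits W m ∧ f.Fits W m
  | keq e f => e.Fits W m ∧ f.Fits W m
  | qle e f => e.Fits W m ∧ f.Fits W m
  | not b => b.Fits W m
  | and b c => b.Fits W m ∧ c.Fits W m

def cost : BExp k → ℕ
  | nlt e f => 1 + e.cost + f.cost
  | neq e f => 1 + e.cost + f.cost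
  | keq e f => 1 + e.cost + f.cost
  | qle e f => 1 + e.cost + f.cost
  | not b => 1 + b.cost
  | and b c => 1 + b.cost + c.cost

end BExp

/-- Statements of the programming language: assignments to an array cell, sequencing, branching,
`while` loops, and calls of (possibly recursive) procedures acting on the common memory. -/
inductive Stmt (k : Type u)
  | skip
  | setN (a : ℕ) (i j l : NExp) (e : NExp)
  | setK (a : ℕ) (i j l : NExp) (e : KExp k)
  | setQ (a : ℕ) (i j l : NExp) (e : QExp)
  | seq (p q : Stmt k)
  | cond (b : BExp k) (p q : Stmt k)
  | loop (b : BExp k) (p : Stmt k)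
  | call (n : ℕ)

/-- `Exec procs W p s t s'`: with procedures `procs` and word bound `W`, the statement `p` started
in state `s` terminates after `t` time units in state `s'`. -/
inductive Exec {k : Type u} [Field k] {Q : Type v} [PartialOrder Q]
    (procs : List (Stmt k)) (W : ℕ) : Stmt k → State k Q → ℕ → State k Q → Prop
  | skip (s : State k Q) : Exec procs W .skip s 1 s
  | setN (s : State k Q) (a : ℕ) (i j l e : NExp)
      (hi : i.Fits W s.nat) (hj : j.Fits W s.nat) (hl : l.Fits W s.nat) (he : e.Fits W s.nat) :
      Exec procs W (.setN a i j l e) s (1 + i.cost + j.cost + l.cost + e.cost)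
        { s with
          nat := s.nat.write a (i.eval s.nat) (j.eval s.nat) (l.eval s.nat) (e.eval s.nat) }
  | setK (s : State k Q) (a : ℕ) (i j l : NExp) (e : KExp k)
      (hi : i.Fits W s.nat) (hj : j.Fits W s.nat) (hl : l.Fits W s.nat) (he : e.Fits W s.nat) :
      Exec procs W (.setK a i j l e) s (1 + i.cost + j.cost + l.cost + e.cost)
        { s with
          scal := s.scal.write a (i.eval s.nat) (j.eval s.nat) (l.eval s.nat) (e.eval s) }
  | setQ (s : State k Q) (a : ℕ) (i j l : NExp) (e : QExp)
      (hi : i.Fits W s.nat) (hj : j.Fits W s.nat) (hl : l.Fits W s.nat) (he : e.Fits W s.nat) :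
      Exec procs W (.setQ a i j l e) s (1 + i.cost + j.cost + l.cost + e.cost)
        { s with
          elt := s.elt.write a (i.eval s.nat) (j.eval s.nat) (l.eval s.nat) (e.eval s) }
  | seq {p q : Stmt k} {s₁ s₂ s₃ : State k Q} {t₁ t₂ : ℕ}
      (hp : Exec procs W p s₁ t₁ s₂) (hq : Exec procs W q s₂ t₂ s₃) :
      Exec procs W (.seq p q) s₁ (t₁ + t₂) s₃
  | condTrue {b : BExp k} {p q : Stmt k} {s s' : State k Q} {t : ℕ}
      (hf : b.Fits W s.nat) (hb : b.Holds s) (hp : Exec procs W p s t s') :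
      Exec procs W (.cond b p q) s (1 + b.cost + t) s'
  | condFalse {b : BExp k} {p q : Stmt k} {s s' : State k Q} {t : ℕ}
      (hf : b.Fits W s.nat) (hb : ¬ b.Holds s) (hq : Exec procs W q s t s') :
      Exec procs W (.cond b p q) s (1 + b.cost + t) s'
  | loopStop {b : BExp k} {p : Stmt k} {s : State k Q}
      (hf : b.Fits W s.nat) (hb : ¬ b.Holds s) :
      Exec procs W (.loop b p) s (1 + b.cost) s
  | loopStep {b : BExp k} {p : Stmt k} {s₁ s₂ s₃ : State k Q} {t₁ t₂ : ℕ}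
      (hf : b.Fits W s₁.nat) (hb : b.Holds s₁)
      (hp : Exec procs W p s₁ t₁ s₂) (hl : Exec procs W (.loop b p) s₂ t₂ s₃) :
      Exec procs W (.loop b p) s₁ (1 + b.cost + t₁ + t₂) s₃
  | call {n : ℕ} {p : Stmt k} {s s' : State k Q} {t : ℕ}
      (hn : procs[n]? = some p) (hp : Exec procs W p s t s') :
      Exec procs W (.call n) s (1 + t) s'

/-- A program over the field `k`: finitely many procedures and a main statement. It mentions no
poset, and finitely many scalar constants. -/
structure Program (k : Type u) where
  procs : List (Stmt k)
  main : Stmt k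

/-- With word bound `W`, the program started in state `s` halts after `t` time units in state
`s'`. -/
def Program.Runs {k : Type u} [Field k] {Q : Type v} [PartialOrder Q]
    (π : Program k) (W : ℕ) (s : State k Q) (t : ℕ) (s' : State k Q) : Prop :=
  Exec π.procs W π.main s t s'

/-! ## The exponent of matrix multiplication -/

/-- `ω` is a feasible exponent of matrix multiplication over `k`: some program multiplies
`n × n` matrices over `k` in time `O(n ^ ω)`, with words of `O(log n)` bits.  Initially,
`n` is in cell `(0,0,0)` of the word array `0`, the entry `A i j` in cell `(0,i,j)` of the scalar
array `0`, the entry `B i j` in cell `(1,i,j)` of that array, and all other cells have arbitrary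
contents (in particular the third memory, which plays no role here). At the end `(A * B) i j` is
in cell `(0,i,j)` of the scalar array `1`. -/
def IsMatMulExponent (k : Type u) [Field k] (ω : ℝ) : Prop :=
  ∃ (π : Program k) (c : ℕ) (C : ℝ), ∀ (Q : Type v) [PartialOrder Q] (n : ℕ)
    (A B : Matrix (Fin n) (Fin n) k) (s : State k Q), 0 < n →
    s.nat 0 0 0 0 = n →
    (∀ i j : Fin n, s.scal 0 0 i j = A i j) →
    (∀ i j : Fin n, s.scal 0 1 i j = B i j) →
    ∃ (t : ℕ) (s' : State k Q), π.Runs ((n + 2) ^ c) s t s' ∧ (t : ℝ) ≤ C * (n : ℝ) ^ ω ∧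
      ∀ i j : Fin n, s'.scal 1 0 i j = (A * B) i j

/-! ## Modules over posets -/

section Modules

variable {k : Type u} [Field k] {Q : Type v} [PartialOrder Q]

/-- An ordered basis with `n` elements of a `Q`-module `X`: homogeneous elements
`elt j ∈ X (gr j)` such that for each `q` the images in `X q` of the elements of grade `≤ q` form
a basis of the vector space `X q`.  In other words, `X` is free of rank `n`, being the direct sum
over `j` of the interval modules of the up-sets `{q | gr j ≤ q}` generated by the `elt j`. -/
structure GradedBasis (X : Q ⥤ ModuleCat.{w} k) (n : ℕ) where
  gr : Fin n → Q
  elt : ∀ j, X.obj (gr j)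
  linearIndependent : ∀ q : Q, LinearIndependent k
    (fun j : {j : Fin n // gr j ≤ q} => (X.map (homOfLE j.2)).hom (elt j.1))
  span_eq_top : ∀ q : Q, Submodule.span k
    (Set.range fun j : {j : Fin n // gr j ≤ q} => (X.map (homOfLE j.2)).hom (elt j.1)) = ⊤

open Classical in
/-- The linear combination in `X q`, with coefficients `x`, of the images of the basis elements of
grade `≤ q`. -/
noncomputable def GradedBasis.comb {X : Q ⥤ ModuleCat.{w} k} {n : ℕ} (B : GradedBasis X n)
    (q : Q) (x : Fin n → k) : X.obj q :=
  ∑ j : Fin n, if h : B.gr j ≤ q then x j • (X.map (homOfLE h)).hom (B.elt j) else 0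

/-- `F` is the matrix of the morphism `f` of free modules with respect to ordered bases; its
columns are labeled by the grades `B.gr j`, its rows by the grades `B'.gr i`. -/
structure IsMatrixOf {X Y : Q ⥤ ModuleCat.{w} k} {n m : ℕ} (B : GradedBasis X n)
    (B' : GradedBasis Y m) (f : X ⟶ Y) (F : Matrix (Fin m) (Fin n) k) : Prop where
  apply_elt : ∀ j, (f.app (B.gr j)).hom (B.elt j) = B'.comb (B.gr j) (fun i => F i j)
  eq_zero : ∀ i j, ¬ B'.gr i ≤ B.gr j → F i j = 0

variable (k Q) in
/-- A chain complex `X ⟶ Y ⟶ Z` of free `Q`-modules of total rank `r`, with its representation by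
labeled matrices with respect to ordered bases. -/
structure QrComplex (r : ℕ) where
  cx : ShortComplex (Q ⥤ ModuleCat.{w} k)
  rankX : ℕ
  rankY : ℕ
  rankZ : ℕ
  rank_eq : rankX + rankY + rankZ = r
  basisX : GradedBasis cx.X₁ rankX
  basisY : GradedBasis cx.X₂ rankY
  basisZ : GradedBasis cx.X₃ rankZ
  matF : Matrix (Fin rankY) (Fin rankX) k
  matG : Matrix (Fin rankZ) (Fin rankY) k
  isMatrixOf_f : IsMatrixOf basisX basisY cx.f matF
  isMatrixOf_g : IsMatrixOf basisY basisZ cx.g matG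

/-- The homology `ker g / im f`, a `Q`-module. -/
noncomputable abbrev QrComplex.homology {r : ℕ} (D : QrComplex.{u, v, w} k Q r) :
    Q ⥤ ModuleCat.{w} k :=
  D.cx.homology

/-- A matrix representation of a `Q`-module: an ordered basis of each of its vector spaces;
the matrices are then those of `MatrixRep.matrix`. -/
structure MatrixRep (G : Q ⥤ ModuleCat.{w} k) where
  dim : Q → ℕ
  basis : ∀ q, Module.Basis (Fin (dim q)) k (G.obj q)

/-- The matrix of the structure map `G p ⟶ G q` with respect to the chosen bases. -/
noncomputable def MatrixRep.matrix {G : Q ⥤ ModuleCat.{w} k} (M : MatrixRep G) {p q : Q}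
    (h : p ≤ q) : Matrix (Fin (M.dim q)) (Fin (M.dim p)) k :=
  LinearMap.toMatrix (M.basis p) (M.basis q) (G.map (homOfLE h)).hom

end Modules

/-! ## Subposets -/

/-- A subposet of `Q`, not necessarily full: a set of elements of `Q` and a partial order on it
contained in that of `Q` (antisymmetry is automatic). -/
structure Subposet (Q : Type v) [PartialOrder Q] where
  carrier : Set Q
  rel : carrier → carrier → Prop
  le_of_rel : ∀ {p q : carrier}, rel p q → (p : Q) ≤ q
  refl : ∀ p, rel p p
  trans : ∀ {p q r}, rel p q → rel q r → rel p r

namespace Subposet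

variable {Q : Type v} [PartialOrder Q]

/-- The elements of a subposet. -/
structure Elem (P : Subposet Q) where
  val : Q
  mem : val ∈ P.carrier

instance (P : Subposet Q) : PartialOrder P.Elem where
  le p q := P.rel ⟨p.val, p.mem⟩ ⟨q.val, q.mem⟩
  le_refl p := P.refl _
  le_trans _ _ _ h h' := P.trans h h'
  le_antisymm p q h h' := by
    cases p; cases q
    congr
    exact le_antisymm (P.le_of_rel h) (P.le_of_rel h')

/-- The inclusion functor of a subposet. -/
def incl (P : Subposet Q) : P.Elem ⥤ Q :=
  Monotone.functor (f := Elem.val) fun _ _ h => P.le_of_rel h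

/-- The relations `p ≤ q` of a subposet, including the identities `p ≤ p`. -/
abbrev Relations (P : Subposet Q) : Type v := {x : P.Elem × P.Elem // x.1 ≤ x.2}

end Subposet

/-! ## Input and output -/

section InputOutput

variable {k : Type u} [Field k] {Q : Type v} [PartialOrder Q] {r : ℕ}

/-- The state `s` contains the input: the labeled matrices of the complex `D`, and the list `e` of
all relations of `P` as pairs of elements of `Q`. Other cells have arbitrary contents. -/
structure IsInput (D : QrComplex.{u, v, w} k Q r) (P : Subposet Q) {m : ℕ}
    (e : Fin m ≃ P.Relations) (s : State k Q) : Prop where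
  rankX : s.nat 0 0 0 0 = D.rankX
  rankY : s.nat 0 1 0 0 = D.rankY
  rankZ : s.nat 0 2 0 0 = D.rankZ
  num : s.nat 0 3 0 0 = m
  grX : ∀ j : Fin D.rankX, s.elt 0 0 j 0 = some (D.basisX.gr j)
  grY : ∀ j : Fin D.rankY, s.elt 0 1 j 0 = some (D.basisY.gr j)
  grZ : ∀ j : Fin D.rankZ, s.elt 0 2 j 0 = some (D.basisZ.gr j)
  matF : ∀ (i : Fin D.rankY) (j : Fin D.rankX), s.scal 0 0 i j = D.matF i j
  matG : ∀ (i : Fin D.rankZ) (j : Fin D.rankY), s.scal 0 1 i j = D.matG i j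
  source : ∀ t : Fin m, s.elt 1 0 t 0 = some (e t).1.1.val
  target : ∀ t : Fin m, s.elt 1 1 t 0 = some (e t).1.2.val

/-- The vector `y ∈ Y q` is a cycle and `x` is its class in the homology of the complex at `q`. -/
def IsClassOf (S : ShortComplex (Q ⥤ ModuleCat.{w} k)) (q : Q) (y : S.X₂.obj q)
    (x : S.homology.obj q) : Prop :=
  ∃ z : S.cycles.obj q, (S.iCycles.app q).hom z = y ∧ (S.homologyπ.app q).hom z = x

/-- The state `s` contains the matrix representation `M` of the restriction to `P` of the homology
of `D`.  For the relation `p ≤ q` with number `t` in the list `e`, the state contains `dim p`,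
`dim q` and the matrix of `p ≤ q`.  For each `p` it contains the ordered basis at `p`, stored at the
number `t` of the identity relation of `p`: the basis elements are given by representing cycles in
`Y p`, and these by their coordinates with respect to the elements of the basis of `Y` of grade
`≤ p` (the coordinates at the other elements being set to zero). -/
structure IsOutput (D : QrComplex.{u, v, w} k Q r) (P : Subposet Q) {m : ℕ}
    (e : Fin m ≃ P.Relations) (M : MatrixRep (P.incl ⋙ D.homology)) (s : State k Q) : Prop where
  dim_source : ∀ t : Fin m, s.nat 1 0 t 0 = M.dim (e t).1.1
  dim_target : ∀ t : Fin m, s.nat 1 1 t 0 = M.dim (e t).1.2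
  matrix : ∀ (t : Fin m) (i : Fin (M.dim (e t).1.2)) (j : Fin (M.dim (e t).1.1)),
    s.scal 1 t i j = M.matrix (e t).2 i j
  basis : ∀ (p : P.Elem) (j : Fin (M.dim p)),
    IsClassOf D.cx p.val
      (D.basisY.comb p.val fun y => s.scal 2 (e.symm ⟨(p, p), le_refl p⟩) j y) (M.basis p j)
  basis_eq_zero : ∀ (p : P.Elem) (j : Fin (M.dim p)) (y : Fin D.rankY),
    ¬ D.basisY.gr y ≤ p.val → s.scal 2 (e.symm ⟨(p, p), le_refl p⟩) j y = 0

end InputOutput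

end PosetComplex

/-! Fix `p`. Every basis element `y` of `Y` of grade at most `p` gives a row `(g y, y)` with the
coordinates in `Z` first; these rows span the graph of `g` at `p` (`cycMat`). In the reduced row
echelon form `R₁` of this matrix, the rows whose pivots lie in the `Y` part form a basis of the
cycles at `p`. In the same way the rows `(0, f x)` have an echelon form `R₂` whose nonzero rows form
a basis of the boundaries (`bdMat`). Boundaries are cycles, so the pivots of `R₂` are pivots of `R₁`
(`pivot_of_pivot`), and the rows of `R₁` at the remaining pivots in the `Y` part represent a basis
of the homology at `p`. A cycle `z` is homologous to `z - z R₂`, and the entries of this vector at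
the remaining pivots are the coordinates of its class (`exists_basis`).

For `p ≤ q` a cycle at `p` has the same coordinate vector when regarded as a cycle at `q`. Hence the
matrix of the structure map consists of entries of `R₁(p) - R₁(p) R₂(q)`, transposed
(`exists_isOutput`). Each relation is treated on its own, and the bases at `p` are recomputed every
time; they agree because the reduced echelon form is unique (`IsHermInv.unique`).

It remains to find echelon forms in time `O(n ^ ω)`. The form of `A` is written `T * A` with `A * T
* A = A`, each row being kept at the position of its pivot, so that neither row exchanges nor a
search for pivots are needed. Stacking and juxtaposing matrices (`IsHermInv.fromRows`,
`IsHermInv.fromCols`) give a recursion with four inversions of half size and twenty products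
(`IsHermInv.blocks`). As `2 ^ ω > 4`, its running time is `O(n ^ ω)` (`invTime_le`).

On the machine, the multiplication program is a black box that may use any array, so it is moved to
the arrays from `64` on (`Exec.shift`). The recursion stores its matrices under the number of the
current level, so that a recursive call, working on lower levels, leaves those of its caller intact
(`Frame`). -/

namespace PosetComplex

/-! ## Renaming of arrays and enlarging of the word bound -/

section Shift

variable {k : Type u} {Q : Type v}

/-- Replace array `a` by array `a + K`. -/
def NExp.shift (K : ℕ) : NExp → NExp
  | lit n => lit n
  | get a i j l => get (a + K) (i.shift K) (j.shift K) (l.shift K)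
  | op o e f => op o (e.shift K) (f.shift K)

def KExp.shift (K : ℕ) : KExp k → KExp k
  | lit x => lit x
  | get a i j l => get (a + K) (i.shift K) (j.shift K) (l.shift K)
  | op o e f => op o (e.shift K) (f.shift K)

def QExp.shift (K : ℕ) (e : QExp) : QExp :=
  ⟨e.a + K, e.i.shift K, e.j.shift K, e.l.shift K⟩

def BExp.shift (K : ℕ) : BExp k → BExp k
  | nlt e f => nlt (e.shift K) (f.shift K)
  | neq e f => neq (e.shift K) (f.shift K)
  | keq e f => keq (e.shift K) (f.shift K)
  | qle e f => qle (e.shift K) (f.shift K)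
  | not b => not (b.shift K)
  | and b c => and (b.shift K) (c.shift K)

def Stmt.shift (K : ℕ) : Stmt k → Stmt k
  | skip => skip
  | setN a i j l e => setN (a + K) (i.shift K) (j.shift K) (l.shift K) (e.shift K)
  | setK a i j l e => setK (a + K) (i.shift K) (j.shift K) (l.shift K) (e.shift K)
  | setQ a i j l e => setQ (a + K) (i.shift K) (j.shift K) (l.shift K) (e.shift K)
  | seq p q => seq (p.shift K) (q.shift K)
  | cond b p q => cond (b.shift K) (p.shift K) (q.shift K)
  | loop b p => loop (b.shift K) (p.shift K)
  | call n => call n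

/-- The arrays with number at least `K`, renumbered from `0`. -/
def State.view (K : ℕ) (s : State k Q) : State k Q :=
  ⟨fun a => s.nat (a + K), fun a => s.scal (a + K), fun a => s.elt (a + K)⟩

/-- The states have the same arrays with numbers less than `K`. -/
structure LowEq (K : ℕ) (s s' : State k Q) : Prop where
  nat : ∀ a < K, s'.nat a = s.nat a
  scal : ∀ a < K, s'.scal a = s.scal a
  elt : ∀ a < K, s'.elt a = s.elt a

theorem LowEq.refl (K : ℕ) (s : State k Q) : LowEq K s s :=
  ⟨fun _ _ => rfl, fun _ _ => rfl, fun _ _ => rfl⟩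

theorem LowEq.trans {K : ℕ} {s s' s'' : State k Q} (h : LowEq K s s') (h' : LowEq K s' s'') :
    LowEq K s s'' :=
  ⟨fun a ha => (h'.nat a ha).trans (h.nat a ha), fun a ha => (h'.scal a ha).trans (h.scal a ha),
    fun a ha => (h'.elt a ha).trans (h.elt a ha)⟩

theorem Mem.write_view {V : Type*} (m : Mem V) (K a i j l : ℕ) (x : V) :
    (fun a' => m.write (a + K) i j l x (a' + K)) = Mem.write (fun a' => m (a' + K)) a i j l x := by
  funext a' i' j' l'
  simp [Mem.write]

theorem Mem.write_of_ne {V : Type*} (m : Mem V) {a i j l b : ℕ} (x : V) (h : b ≠ a) :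
    m.write a i j l x b = m b := by
  funext i' j' l'
  simp [Mem.write, h]

theorem NExp.eval_shift (K : ℕ) (m : Mem ℕ) (e : NExp) :
    (e.shift K).eval m = e.eval (fun a => m (a + K)) := by
  induction e with
  | lit n => rfl
  | get a i j l hi hj hl => simp [shift, eval, hi, hj, hl]
  | op o e f he hf => simp [shift, eval, he, hf]

theorem NExp.cost_shift (K : ℕ) (e : NExp) : (e.shift K).cost = e.cost := by
  induction e with
  | lit n => rfl
  | get a i j l hi hj hl => simp [shift, cost, hi, hj, hl]
  | op o e f he hf => simp [shift, cost, he, hf]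

theorem NExp.Fits.shift {W W' : ℕ} (hW : W ≤ W') {K : ℕ} {m : Mem ℕ} {e : NExp}
    (h : e.Fits W (fun a => m (a + K))) : (e.shift K).Fits W' m := by
  induction e with
  | lit n => exact le_trans h hW
  | get a i j l hi hj hl => exact ⟨hi h.1, hj h.2.1, hl h.2.2⟩
  | op o e f he hf =>
    refine ⟨he h.1, hf h.2.1, ?_⟩
    rw [NExp.eval_shift, NExp.eval_shift]
    exact h.2.2.trans hW

theorem KExp.eval_shift [Field k] (K : ℕ) (s : State k Q) (e : KExp k) :
    (e.shift K).eval s = e.eval (s.view K) := by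
  induction e with
  | lit n => rfl
  | get a i j l => simp [shift, eval, NExp.eval_shift, State.view]
  | op o e f he hf => simp [shift, eval, he, hf]

theorem KExp.cost_shift (K : ℕ) (e : KExp k) : (e.shift K).cost = e.cost := by
  induction e with
  | lit n => rfl
  | get a i j l => simp [shift, cost, NExp.cost_shift]
  | op o e f he hf => simp [shift, cost, he, hf]

theorem KExp.Fits.shift {W W' : ℕ} (hW : W ≤ W') {K : ℕ} {m : Mem ℕ} {e : KExp k}
    (h : e.Fits W (fun a => m (a + K))) : (e.shift K).Fits W' m := by
  induction e with
  | lit n => trivial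
  | get a i j l => exact ⟨h.1.shift hW, h.2.1.shift hW, h.2.2.shift hW⟩
  | op o e f he hf => exact ⟨he h.1, hf h.2⟩

theorem QExp.eval_shift (K : ℕ) (s : State k Q) (e : QExp) :
    (e.shift K).eval s = e.eval (s.view K) := by
  simp [shift, eval, NExp.eval_shift, State.view]

theorem QExp.cost_shift (K : ℕ) (e : QExp) : (e.shift K).cost = e.cost := by
  simp [shift, cost, NExp.cost_shift]

theorem QExp.Fits.shift {W W' : ℕ} (hW : W ≤ W') {K : ℕ} {m : Mem ℕ} {e : QExp}
    (h : e.Fits W (fun a => m (a + K))) : (e.shift K).Fits W' m :=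
  ⟨h.1.shift hW, h.2.1.shift hW, h.2.2.shift hW⟩

theorem BExp.holds_shift [Field k] [PartialOrder Q] (K : ℕ) (s : State k Q) (b : BExp k) :
    (b.shift K).Holds s ↔ b.Holds (s.view K) := by
  induction b with
  | nlt e f => simp [shift, Holds, NExp.eval_shift, State.view]
  | neq e f => simp [shift, Holds, NExp.eval_shift, State.view]
  | keq e f => simp [shift, Holds, KExp.eval_shift]
  | qle e f => simp [shift, Holds, QExp.eval_shift]
  | not b hb => simp [shift, Holds, hb]
  | and b c hb hc => simp [shift, Holds, hb, hc]

theorem BExp.cost_shift (K : ℕ) (b : BExp k) : (b.shift K).cost = b.cost := by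
  induction b with
  | nlt e f => simp [shift, cost, NExp.cost_shift]
  | neq e f => simp [shift, cost, NExp.cost_shift]
  | keq e f => simp [shift, cost, KExp.cost_shift]
  | qle e f => simp [shift, cost, QExp.cost_shift]
  | not b hb => simp [shift, cost, hb]
  | and b c hb hc => simp [shift, cost, hb, hc]

theorem BExp.Fits.shift {W W' : ℕ} (hW : W ≤ W') {K : ℕ} {m : Mem ℕ} {b : BExp k}
    (h : b.Fits W (fun a => m (a + K))) : (b.shift K).Fits W' m := by
  induction b with
  | nlt e f => exact ⟨h.1.shift hW, h.2.shift hW⟩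
  | neq e f => exact ⟨h.1.shift hW, h.2.shift hW⟩
  | keq e f => exact ⟨h.1.shift hW, h.2.shift hW⟩
  | qle e f => exact ⟨h.1.shift hW, h.2.shift hW⟩
  | not b hb => exact hb h
  | and b c hb hc => exact ⟨hb h.1, hc h.2⟩

/-- A program with renamed arrays does on the renamed arrays what the program does, and it leaves
the other arrays alone. -/
theorem Exec.shift [Field k] [PartialOrder Q] {procs procs' : List (Stmt k)} {W W' : ℕ} (K : ℕ)
    (hprocs : ∀ (n : ℕ) (p : Stmt k), procs[n]? = some p → procs'[n]? = some (p.shift K)) (hW : W ≤ W')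
    {p : Stmt k} {u u' : State k Q} {t : ℕ} (h : Exec procs W p u t u') :
    ∀ s : State k Q, s.view K = u →
      ∃ s', Exec procs' W' (p.shift K) s t s' ∧ s'.view K = u' ∧ LowEq K s s' := by
  induction h with
  | skip u => exact fun s hs => ⟨s, .skip s, hs, .refl K s⟩
  | setN u a i j l e hi hj hl he =>
    rintro s rfl
    refine ⟨_, by
      simpa only [Stmt.shift, NExp.cost_shift] using Exec.setN s (a + K) (i.shift K) (j.shift K) (l.shift K)
        (e.shift K) (hi.shift hW) (hj.shift hW) (hl.shift hW) (he.shift hW), ?_, ?_⟩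
    · simp only [State.view, Mem.write_view, NExp.eval_shift]
    · exact ⟨fun b hb => Mem.write_of_ne _ _ (by omega), fun _ _ => rfl, fun _ _ => rfl⟩
  | setK u a i j l e hi hj hl he =>
    rintro s rfl
    refine ⟨_, by
      simpa only [Stmt.shift, NExp.cost_shift, KExp.cost_shift] using Exec.setK s (a + K) (i.shift K)
        (j.shift K) (l.shift K) (e.shift K) (hi.shift hW) (hj.shift hW) (hl.shift hW)
        (he.shift hW), ?_, ?_⟩
    · simp only [State.view, Mem.write_view, NExp.eval_shift, KExp.eval_shift]
    · exact ⟨fun _ _ => rfl, fun b hb => Mem.write_of_ne _ _ (by omega), fun _ _ => rfl⟩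
  | setQ u a i j l e hi hj hl he =>
    rintro s rfl
    refine ⟨_, by
      simpa only [Stmt.shift, NExp.cost_shift, QExp.cost_shift] using Exec.setQ s (a + K) (i.shift K)
        (j.shift K) (l.shift K) (e.shift K) (hi.shift hW) (hj.shift hW) (hl.shift hW)
        (he.shift hW), ?_, ?_⟩
    · simp only [State.view, Mem.write_view, NExp.eval_shift, QExp.eval_shift]
    · exact ⟨fun _ _ => rfl, fun _ _ => rfl, fun b hb => Mem.write_of_ne _ _ (by omega)⟩
  | seq _ _ ihp ihq =>
    intro s hs
    obtain ⟨s₁, h₁, hv₁, hl₁⟩ := ihp s hs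
    obtain ⟨s₂, h₂, hv₂, hl₂⟩ := ihq s₁ hv₁
    exact ⟨s₂, .seq h₁ h₂, hv₂, hl₁.trans hl₂⟩
  | condTrue hf hb _ ih =>
    rintro s rfl
    obtain ⟨s₁, h₁, hv₁, hl₁⟩ := ih s rfl
    refine ⟨s₁, ?_, hv₁, hl₁⟩
    rw [← BExp.cost_shift K]
    exact .condTrue (hf.shift hW) ((BExp.holds_shift _ _ _).2 hb) h₁
  | condFalse hf hb _ ih =>
    rintro s rfl
    obtain ⟨s₁, h₁, hv₁, hl₁⟩ := ih s rfl
    refine ⟨s₁, ?_, hv₁, hl₁⟩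
    rw [← BExp.cost_shift K]
    exact .condFalse (hf.shift hW) (mt (BExp.holds_shift _ _ _).1 hb) h₁
  | loopStop hf hb =>
    rintro s rfl
    refine ⟨s, ?_, rfl, .refl K s⟩
    rw [← BExp.cost_shift K]
    exact .loopStop (hf.shift hW) (mt (BExp.holds_shift _ _ _).1 hb)
  | loopStep hf hb _ _ ihp ihl =>
    rintro s rfl
    obtain ⟨s₁, h₁, hv₁, hl₁⟩ := ihp s rfl
    obtain ⟨s₂, h₂, hv₂, hl₂⟩ := ihl s₁ hv₁
    refine ⟨s₂, ?_, hv₂, hl₁.trans hl₂⟩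
    rw [← BExp.cost_shift K]
    exact .loopStep (hf.shift hW) ((BExp.holds_shift _ _ _).2 hb) h₁ h₂
  -- Renaming affects arrays, not procedure numbers. It is enough that the renamed procedures keep
  -- their positions; `procs'` may contain more of them.
  | call hn _ ih =>
    intro s hs
    obtain ⟨s₁, h₁, hv₁, hl₁⟩ := ih s hs
    exact ⟨s₁, .call (hprocs _ _ hn) h₁, hv₁, hl₁⟩

end Shift

/-! ## Total correctness with time bounds -/

section Does

variable {k : Type u} [Field k] {Q : Type v} [PartialOrder Q]

/-- The statement `p`, started in state `s`, terminates within time `T` in a state satisfying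
`Φ`. -/
def Does (procs : List (Stmt k)) (W : ℕ) (p : Stmt k) (s : State k Q) (T : ℕ)
    (Φ : State k Q → Prop) : Prop :=
  ∃ t s', Exec procs W p s t s' ∧ t ≤ T ∧ Φ s'

variable {procs : List (Stmt k)} {W : ℕ}

theorem Does.mono {p : Stmt k} {s : State k Q} {T T' : ℕ} {Φ Ψ : State k Q → Prop}
    (h : Does procs W p s T Φ) (hT : T ≤ T') (hΦ : ∀ s', Φ s' → Ψ s') : Does procs W p s T' Ψ := by
  obtain ⟨t, s', he, ht, hs⟩ := h
  exact ⟨t, s', he, ht.trans hT, hΦ s' hs⟩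

/-- The postcondition of the first statement is the specification of the second one, so a program is
verified from left to right by nesting, with the times adding up. -/
theorem Does.seq {p q : Stmt k} {s : State k Q} {T₁ T₂ : ℕ} {Φ : State k Q → Prop}
    (h : Does procs W p s T₁ fun s' => Does procs W q s' T₂ Φ) :
    Does procs W (.seq p q) s (T₁ + T₂) Φ := by
  obtain ⟨t, s', he, ht, t', s'', he', ht', hs⟩ := h
  exact ⟨t + t', s'', .seq he he', add_le_add ht ht', hs⟩

theorem Does.skip {s : State k Q} {T : ℕ} {Φ : State k Q → Prop} (hT : 1 ≤ T) (h : Φ s) :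
    Does procs W .skip s T Φ :=
  ⟨1, s, .skip s, hT, h⟩

theorem Does.setN {s : State k Q} {T : ℕ} {Φ : State k Q → Prop} {a : ℕ} {i j l e : NExp}
    (hf : i.Fits W s.nat ∧ j.Fits W s.nat ∧ l.Fits W s.nat ∧ e.Fits W s.nat)
    (hT : 1 + i.cost + j.cost + l.cost + e.cost ≤ T)
    (h : Φ { s with
      nat := s.nat.write a (i.eval s.nat) (j.eval s.nat) (l.eval s.nat) (e.eval s.nat) }) :
    Does procs W (.setN a i j l e) s T Φ :=
  ⟨_, _, .setN s a i j l e hf.1 hf.2.1 hf.2.2.1 hf.2.2.2, hT, h⟩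

theorem Does.setK {s : State k Q} {T : ℕ} {Φ : State k Q → Prop} {a : ℕ} {i j l : NExp}
    {e : KExp k}
    (hf : i.Fits W s.nat ∧ j.Fits W s.nat ∧ l.Fits W s.nat ∧ e.Fits W s.nat)
    (hT : 1 + i.cost + j.cost + l.cost + e.cost ≤ T)
    (h : Φ { s with
      scal := s.scal.write a (i.eval s.nat) (j.eval s.nat) (l.eval s.nat) (e.eval s) }) :
    Does procs W (.setK a i j l e) s T Φ :=
  ⟨_, _, .setK s a i j l e hf.1 hf.2.1 hf.2.2.1 hf.2.2.2, hT, h⟩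

theorem Does.cond {b : BExp k} {p q : Stmt k} {s : State k Q} {T T' : ℕ} {Φ : State k Q → Prop}
    (hf : b.Fits W s.nat) (hT : 1 + b.cost + T ≤ T') (hp : b.Holds s → Does procs W p s T Φ)
    (hq : ¬ b.Holds s → Does procs W q s T Φ) : Does procs W (.cond b p q) s T' Φ := by
  by_cases hb : b.Holds s
  · obtain ⟨t, s', he, ht, hs⟩ := hp hb
    exact ⟨_, s', .condTrue hf hb he, by omega, hs⟩
  · obtain ⟨t, s', he, ht, hs⟩ := hq hb
    exact ⟨_, s', .condFalse hf hb he, by omega, hs⟩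

theorem Does.call {n : ℕ} {p : Stmt k} {s : State k Q} {T : ℕ} {Φ : State k Q → Prop}
    (hn : procs[n]? = some p) (h : Does procs W p s T Φ) :
    Does procs W (.call n) s (1 + T) Φ := by
  obtain ⟨t, s', he, ht, hs⟩ := h
  exact ⟨1 + t, s', .call hn he, by omega, hs⟩

/-! ### Counted loops -/

/-- The word in cell `(v, 0, 0)` of array `c`. -/
abbrev cell (c v : ℕ) : NExp := .get c (.lit v) (.lit 0) (.lit 0)

/-- Assignment to the cell `(v, 0, 0)` of array `c`. -/
abbrev setCell (c v : ℕ) (e : NExp) : Stmt k := .setN c (.lit v) (.lit 0) (.lit 0) e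

/-- The state after an assignment to the cell `(v, 0, 0)` of array `c`. -/
abbrev State.put (s : State k Q) (c v x : ℕ) : State k Q :=
  { s with nat := s.nat.write c v 0 0 x }

omit [Field k] [PartialOrder Q] in
theorem State.put_nat_of_ne (s : State k Q) {c b : ℕ} (v x : ℕ) (h : b ≠ c) :
    (s.put c v x).nat b = s.nat b :=
  Mem.write_of_ne _ _ h

/-- Execute `body` with the counter in cell `(v, 0, 0)` of array `c` running from `0` to the
value of `bound`. -/
def forN (c v : ℕ) (bound : NExp) (body : Stmt k) : Stmt k :=
  .seq (setCell c v (.lit 0)) (.loop (.nlt (cell c v) bound)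
    (.seq body (setCell c v (.op .add (cell c v) (.lit 1)))))

/-- The expression `bound` is evaluated again before every iteration, hence the requirement that the
invariant fixes its value. Test and increment cost at most `bound.cost + 20` per iteration. The
hypothesis `n < W` lets the counter reach `n` and the literal `1` fit. -/
theorem Does.forN {c v : ℕ} {bound : NExp} {body : Stmt k} {s : State k Q} {n T : ℕ}
    (P : ℕ → State k Q → Prop) (hv : v ≤ W) (hn : n < W)
    (hb : ∀ i ≤ n, ∀ s', P i s' → s'.nat c v 0 0 = i →
      bound.Fits W s'.nat ∧ bound.eval s'.nat = n)
    (h0 : P 0 (s.put c v 0))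
    (hstep : ∀ i < n, ∀ s', P i s' → s'.nat c v 0 0 = i →
      Does procs W body s' T fun s'' => s''.nat c v 0 0 = i ∧ P (i + 1) (s''.put c v (i + 1))) :
    Does procs W (forN c v bound body) s (n * (T + bound.cost + 20) + (bound.cost + 20)) (P n) := by
  -- Induction on the number `d` of iterations that are left.
  have key : ∀ d i, i + d = n → ∀ s', P i s' → s'.nat c v 0 0 = i →
      Does procs W (.loop (.nlt (cell c v) bound)
        (.seq body (setCell c v (.op .add (cell c v) (.lit 1))))) s'
        (d * (T + bound.cost + 20) + (bound.cost + 10)) (P n) := by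
    intro d
    induction d with
    | zero =>
      intro i hi s' hP hc
      obtain rfl : i = n := by omega
      obtain ⟨hf, he⟩ := hb i le_rfl s' hP hc
      refine ⟨_, s', .loopStop ?_ ?_, ?_, hP⟩
      · simp only [BExp.Fits, NExp.Fits]; exact ⟨⟨hv, by omega, by omega⟩, hf⟩
      · simp [BExp.Holds, NExp.eval, he, hc]
      · simp only [BExp.cost, NExp.cost]; omega
    | succ d ih =>
      intro i hi s' hP hc
      obtain ⟨hf, he⟩ := hb i (by omega) s' hP hc
      obtain ⟨t, s'', hx, ht, hc', hP'⟩ := hstep i (by omega) s' hP hc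
      have hset : Exec procs W (setCell c v (.op .add (cell c v) (.lit 1))) s''
          10 (s''.put c v (i + 1)) := by
        have := Exec.setN (procs := procs) (W := W) s'' c (.lit v) (.lit 0) (.lit 0)
          (.op .add (cell c v) (.lit 1)) hv (Nat.zero_le _) (Nat.zero_le _)
          ⟨⟨hv, Nat.zero_le _, Nat.zero_le _⟩, by simp only [NExp.Fits]; omega, by
            simp only [NExp.eval, NOp.eval, hc']; omega⟩
        simpa only [NExp.eval, NOp.eval, hc', NExp.cost] using this
      obtain ⟨t', s₃, hx', ht', hP₃⟩ := ih (i + 1) (by omega) _ hP' (by simp [Mem.write])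
      refine ⟨_, s₃, .loopStep ?_ ?_ (.seq hx hset) hx', ?_, hP₃⟩
      · simp only [BExp.Fits, NExp.Fits]; exact ⟨⟨hv, by omega, by omega⟩, hf⟩
      · simp only [BExp.Holds, NExp.eval, he, hc]; omega
      · simp only [BExp.cost, NExp.cost]
        rw [add_mul, one_mul]
        omega
  have := Does.seq (procs := procs) (W := W) (p := setCell c v (.lit 0)) (s := s) (T₁ := 10)
    (Does.setN (by simp [NExp.Fits, hv]) (by simp [NExp.cost])
      (key n 0 (by omega) _ h0 (by simp [Mem.write, NExp.eval])))
  exact this.mono (by omega) fun _ h => h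

end Does

/-! ## Inner inverses in echelon form -/

section HermInv

variable {k : Type u} [Field k] {m m' n n' : Type*} [Fintype m] [Fintype m'] [Fintype n]
  [Fintype n'] [DecidableEq n] [DecidableEq n']

open Matrix

/-- `T` is an inner inverse of `A` such that `T * A` is the reduced row echelon form of `A`, the
row with pivot `l` being stored at position `l`, and the rows without pivot being zero. The columns
are ordered by `b`, and `L` is the set of pivots. -/
structure IsHermInv (b : n → ℕ) (L : n → Prop) (A : Matrix m n k) (T : Matrix n m k) : Prop where
  inner : A * (T * A) = A
  tri : (T * A).BlockTriangular b
  col : ∀ l, L l → ∀ i, (T * A) i l = (1 : Matrix n n k) i l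
  row : ∀ l, ¬ L l → ∀ i, T l i = 0

omit [Fintype m] in
theorem mul_apply_of_col {R : Matrix n n k} {l : n} (h : ∀ i, R i l = (1 : Matrix n n k) i l)
    (X : Matrix m n k) (i : m) : (X * R) i l = X i l := by
  have : (X * R) i l = (X * (1 : Matrix n n k)) i l := by simp only [mul_apply, h]
  rw [this, Matrix.mul_one]

omit [Fintype m'] [Fintype n] [DecidableEq n] in
theorem mul_apply_of_row {T : Matrix n m k} {l : n} (h : ∀ i, T l i = 0)
    (X : Matrix m m' k) (j : m') : (T * X) l j = 0 := by
  simp [mul_apply, h]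

variable {b : n → ℕ} {L L₁ L₂ : n → Prop}

omit [Fintype m'] in
theorem IsHermInv.row_mul {A : Matrix m n k} {T : Matrix n m k} (h : IsHermInv b L A T)
    {l : n} (hl : ¬ L l) (X : Matrix m m' k) (j : m') : (T * X) l j = 0 :=
  mul_apply_of_row (h.row l hl) X j

/-- The pivots can be read off the diagonal of the echelon form; this is the test that the program
performs. -/
theorem IsHermInv.mem_iff {A : Matrix m n k} {T : Matrix n m k} (h : IsHermInv b L A T) {l : n} :
    L l ↔ (T * A) l l ≠ 0 := by
  constructor
  · intro hl
    simp [h.col l hl]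
  · intro hl
    by_contra hn
    exact hl (h.row_mul hn A l)

/-- Write `R₁ = T₁ * A`. Eliminating with its rows replaces `C` by `C - C * R₁`, whose columns at
the pivots of `R₁` vanish; let `R₂` be its echelon form. Conversely `R₁ - R₁ * R₂` has zeros in the
pivot columns of `R₂`. So the echelon form of the stacked matrix is `R₁ + R₂ - R₁ * R₂`, and no row
has to be moved, as each one already sits at its pivot. -/
theorem IsHermInv.fromRows {A : Matrix m n k} {C : Matrix m' n k} {T₁ : Matrix n m k}
    {T₂ : Matrix n m' k} (h₁ : IsHermInv b L₁ A T₁)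
    (h₂ : IsHermInv b L₂ (C - C * (T₁ * A)) T₂) :
    IsHermInv b (fun l => L₁ l ∨ L₂ l) (fromRows A C)
      (fromCols (T₁ - (T₂ - (T₁ * A) * T₂) * (C * T₁)) (T₂ - (T₁ * A) * T₂)) := by
  have hin₁ := h₁.inner
  have hin₂ := h₂.inner
  have tri₁ := h₁.tri
  have tri₂ := h₂.tri
  have col₁ := h₁.col
  have col₂ := h₂.col
  have row₁ : ∀ l, ¬ L₁ l → ∀ X : Matrix n m' k, ∀ j, ((T₁ * A) * X) l j = 0 := by
    intro l hl X j
    rw [Matrix.mul_assoc, h₁.row_mul hl]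
  have hC₁ : C * T₁ * A = C * (T₁ * A) := Matrix.mul_assoc _ _ _
  have hRdef : T₂ * (C - C * (T₁ * A)) = T₂ * C - T₂ * (C * (T₁ * A)) := Matrix.mul_sub _ _ _
  have hR : Matrix.fromCols (T₁ - (T₂ - (T₁ * A) * T₂) * (C * T₁)) (T₂ - (T₁ * A) * T₂) *
        Matrix.fromRows A C
      = T₁ * A + T₂ * (C - C * (T₁ * A)) - (T₁ * A) * (T₂ * (C - C * (T₁ * A))) := by
    rw [fromCols_mul_fromRows, Matrix.sub_mul, Matrix.mul_assoc _ (C * T₁), hC₁]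
    have : T₁ * A + T₂ * (C - C * (T₁ * A)) - (T₁ * A) * (T₂ * (C - C * (T₁ * A)))
        = T₁ * A + (T₂ - (T₁ * A) * T₂) * (C - C * (T₁ * A)) := by
      rw [Matrix.sub_mul T₂, Matrix.mul_assoc (T₁ * A) T₂]; abel
    rw [this, Matrix.mul_sub (T₂ - (T₁ * A) * T₂)]
    abel
  generalize T₁ * A = R₁ at *
  have hz : ∀ l, L₁ l → ∀ i, (T₂ * (C - C * R₁)) i l = 0 := by
    intro l hl i
    have hc : ∀ i, (C - C * R₁) i l = 0 := fun i => by
      rw [Matrix.sub_apply, mul_apply_of_col (col₁ l hl), sub_self]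
    rw [mul_apply]
    simp [hc]
  generalize hR₂ : T₂ * (C - C * R₁) = R₂ at *
  refine ⟨?_, ?_, ?_, ?_⟩
  · rw [hR, fromRows_mul]
    congr 1
    · rw [Matrix.mul_sub, Matrix.mul_add, ← Matrix.mul_assoc A R₁, hin₁]
      abel
    · have : C * (R₁ + R₂ - R₁ * R₂) = C * R₁ + (C - C * R₁) * R₂ := by
        rw [Matrix.mul_sub, Matrix.mul_add, Matrix.sub_mul, Matrix.mul_assoc]; abel
      rw [this, hin₂]
      abel
  · rw [hR]
    exact (tri₁.add tri₂).sub (tri₁.mul tri₂)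
  · intro l hl i
    rw [hR]
    by_cases hl₂ : L₂ l
    · rw [Matrix.sub_apply, Matrix.add_apply, mul_apply_of_col (col₂ l hl₂), col₂ l hl₂]
      ring
    · have hl₁ := hl.resolve_right hl₂
      have : (R₁ * R₂) i l = 0 := by
        rw [mul_apply]; simp [hz l hl₁]
      rw [Matrix.sub_apply, Matrix.add_apply, this, hz l hl₁, col₁ l hl₁]
      ring
  · intro l hl i
    rw [not_or] at hl
    have hq : ∀ i, (T₂ - R₁ * T₂) l i = 0 := fun i => by
      rw [Matrix.sub_apply, h₂.row l hl.2, row₁ l hl.1, sub_zero]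
    rcases i with i | i
    · simp only [fromCols_apply_inl]
      rw [Matrix.sub_apply, h₁.row l hl.1, mul_apply_of_row hq, sub_zero]
    · exact hq i

/-- Since `A * T₁` is a projection onto the column space of `A`, the matrix `E = B - A * T₁ * B` is
what remains of `B` modulo that space. The lower block `M = T₂ * (1 - A * T₁)` annihilates `A` and
satisfies `M * B = T₂ * E`, so the product is block triangular. Adding `N` places the columns of `B`
after those of `A`. -/
theorem IsHermInv.fromCols {b' : n' → ℕ} {L' : n' → Prop} {A : Matrix m n k} {B : Matrix m n' k}
    {T₁ : Matrix n m k} {T₂ : Matrix n' m k} (h₁ : IsHermInv b L A T₁)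
    (h₂ : IsHermInv b' L' (B - A * (T₁ * B)) T₂) {N : ℕ} (hN : ∀ i, b i < N) :
    IsHermInv (Sum.elim b fun i => N + b' i) (Sum.elim L L') (Matrix.fromCols A B)
      (Matrix.fromRows (T₁ - (T₁ * B) * (T₂ - (T₂ * A) * T₁)) (T₂ - (T₂ * A) * T₁)) := by
  set M := T₂ - (T₂ * A) * T₁ with hM
  set E := B - A * (T₁ * B) with hE
  have hMA : M * A = 0 := by
    rw [hM, Matrix.sub_mul, Matrix.mul_assoc, Matrix.mul_assoc, h₁.inner, sub_self]
  have hMB : M * B = T₂ * E := by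
    rw [hM, Matrix.sub_mul, hE, Matrix.mul_sub, Matrix.mul_assoc, Matrix.mul_assoc]
  have hR : Matrix.fromRows (T₁ - (T₁ * B) * M) M * Matrix.fromCols A B
      = fromBlocks (T₁ * A) (T₁ * B - T₁ * B * (T₂ * E)) 0 (T₂ * E) := by
    rw [fromRows_mul, Matrix.mul_fromCols, Matrix.mul_fromCols, ← fromRows_fromCols_eq_fromBlocks,
      hMA, hMB, Matrix.sub_mul, Matrix.sub_mul, Matrix.mul_assoc _ M, Matrix.mul_assoc _ M, hMA,
      hMB, Matrix.mul_zero, sub_zero]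
  refine ⟨?_, ?_, ?_, ?_⟩
  · rw [hR, fromCols_mul_fromBlocks]
    congr 1
    · rw [h₁.inner, Matrix.mul_zero, add_zero]
    · have : A * (T₁ * B - T₁ * B * (T₂ * E)) + B * (T₂ * E)
          = A * (T₁ * B) + E * (T₂ * E) := by
        rw [Matrix.mul_sub, ← Matrix.mul_assoc A (T₁ * B), hE, Matrix.sub_mul]; abel
      rw [this, h₂.inner, hE]
      abel
  · rw [hR]
    rintro (i | i) (j | j) hij
    · exact h₁.tri hij
    · have := hN i
      simp only [Sum.elim_inl, Sum.elim_inr] at hij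
      omega
    · rfl
    · simp only [Sum.elim_inr] at hij
      exact h₂.tri (show b' j < b' i by omega)
  · rw [hR]
    rintro (l | l) hl (i | i)
    · simpa [Matrix.one_apply] using h₁.col l hl i
    · simp
    · rw [fromBlocks_apply₁₂, Matrix.sub_apply, mul_apply_of_col (h₂.col l hl)]
      simp
    · simpa [Matrix.one_apply] using h₂.col l hl i
  · rintro (l | l) hl i
    · rw [fromRows_apply_inl, Matrix.sub_apply, h₁.row l hl, Matrix.mul_assoc, h₁.row_mul hl,
        sub_zero]
    · rw [fromRows_apply_inr, hM, Matrix.sub_apply, h₂.row l hl, Matrix.mul_assoc, h₂.row_mul hl,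
        sub_zero]

theorem IsHermInv.submatrix {A : Matrix m n k} {T : Matrix n m k} (h : IsHermInv b L A T)
    (e : n' ≃ n) (f : m' ≃ m) :
    IsHermInv (b ∘ e) (L ∘ e) (A.submatrix f e) (T.submatrix e f) := by
  have hR : T.submatrix e f * A.submatrix f e = (T * A).submatrix e e :=
    submatrix_mul_equiv T A e f e
  refine ⟨?_, ?_, ?_, fun l hl i => h.row _ hl _⟩
  · rw [hR, submatrix_mul_equiv, h.inner]
  · rw [hR]
    exact fun i j hij => h.tri hij
  · intro l hl i
    rw [hR, submatrix_apply, h.col _ hl]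
    simp [Matrix.one_apply]

/-- The echelon form is unique. -/
theorem IsHermInv.unique {A : Matrix m n k} {T T' : Matrix n m k} (hb : b.Injective)
    (h : IsHermInv b L A T) (h' : IsHermInv b L₁ A T') : T * A = T' * A := by
  -- Echelon forms `R`, `R'` of the same matrix satisfy `R = R * R'`. Both are triangular, so the
  -- diagonal of the product is the product of the diagonals, and the two sets of pivots coincide.
  have aux : ∀ {T T' : Matrix n m k} {L L₁ : n → Prop}, IsHermInv b L A T → IsHermInv b L₁ A T' →
      ∀ l, (T * A) l l = (T * A) l l * (T' * A) l l := by
    intro T T' L L₁ h h' l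
    have : T * A = (T * A) * (T' * A) := by rw [Matrix.mul_assoc, h'.inner]
    conv_lhs => rw [this]
    rw [mul_apply]
    refine Finset.sum_eq_single l (fun j _ hj => ?_) (by simp)
    rcases lt_or_gt_of_ne (hb.ne hj) with hlt | hlt
    · rw [h.tri hlt, zero_mul]
    · rw [h'.tri hlt, mul_zero]
  have hL : ∀ l, L l ↔ L₁ l := by
    intro l
    rw [h.mem_iff, h'.mem_iff]
    constructor
    · intro hl h0
      exact hl (by rw [aux h h' l, h0, mul_zero])
    · intro hl h0
      exact hl (by rw [aux h' h l, h0, mul_zero])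
  obtain rfl : L = L₁ := funext fun l => propext (hL l)
  ext i j
  -- In row `i` of `R * R'` only the summand with row `i` of `R'` survives: `R i l` vanishes at the
  -- other pivots `l`, and the rows of `R'` without pivot are zero.
  by_cases hi : L i
  · have : T * A = (T * A) * (T' * A) := by rw [Matrix.mul_assoc, h'.inner]
    rw [this, mul_apply, Finset.sum_eq_single i]
    · rw [h.col i hi, one_apply_eq, one_mul]
    · intro l _ hl
      by_cases hlL : L l
      · rw [h.col l hlL, one_apply_ne hl.symm, zero_mul]
      · rw [h'.row_mul hlL, mul_zero]
    · simp
  · rw [h.row_mul hi, h'.row_mul hi]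

/-- The start of the recursion. Because `1 / 0 = 0`, the zero matrix needs no separate case, and the
program can divide without a test. -/
theorem IsHermInv.of_unique [Unique n] [DecidableEq m] [Unique m] (A : Matrix m n k) :
    IsHermInv b (fun _ => A default default ≠ 0) A (of fun _ _ => 1 / A default default) := by
  have hA : ∀ i j, A i j = A default default := fun i j => by
    rw [Subsingleton.elim i default, Subsingleton.elim j default]
  refine ⟨?_, ?_, ?_, ?_⟩
  · ext i j
    simp only [mul_apply, of_apply, Finset.univ_unique, Finset.sum_singleton, hA i j]
    by_cases h : A default default = 0
    · simp [h]
    · rw [hA i default, hA default j, one_div_mul_cancel h, _root_.mul_one]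
  · intro i j hij
    rw [Subsingleton.elim i j] at hij
    exact absurd hij (lt_irrefl _)
  · intro l hl i
    rw [Subsingleton.elim i l, one_apply_eq, mul_apply]
    simp only [of_apply, Finset.univ_unique, Finset.sum_singleton, hA _ l]
    exact one_div_mul_cancel hl
  · intro l hl i
    simp only [ne_eq, not_not] at hl
    simp [hl]

/-- The block recursion. -/
theorem IsHermInv.blocks {ι : Type*} [Fintype ι] [DecidableEq ι] {b : ι → ℕ} {N : ℕ}
    (hN : ∀ i, b i < N) {L₁ L₂ L₃ L₄ : ι → Prop} {A B C D T₁ T₂ T₃ T₄ P Q' V R S W : Matrix ι ι k}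
    (h₁ : IsHermInv b L₁ A T₁) (h₂ : IsHermInv b L₂ (C - C * (T₁ * A)) T₂)
    (hQ : Q' = T₂ - (T₁ * A) * T₂) (hP : P = T₁ - Q' * (C * T₁)) (hV : V = P * B + Q' * D)
    (h₃ : IsHermInv b L₃ (B - A * V) T₃)
    (h₄ : IsHermInv b L₄ ((D - C * V) - (D - C * V) * (T₃ * (B - A * V))) T₄)
    (hS : S = T₄ - (T₃ * (B - A * V)) * T₄) (hR : R = T₃ - S * ((D - C * V) * T₃))
    (hW : W = R * A + S * C) :
    IsHermInv (Sum.elim b fun i => N + b i) (Sum.elim (fun l => L₁ l ∨ L₂ l) fun l => L₃ l ∨ L₄ l) (fromBlocks A B C D)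
      (fromBlocks (P - V * (R - W * P)) (Q' - V * (S - W * Q')) (R - W * P) (S - W * Q')) := by
  -- The left block column is treated first, then the right one modulo it, and `fromCols` joins the
  -- two. Here `V` is the left inverse times the right column, and `W` the inverse of the reduced
  -- right column times the left column.
  have hl := h₁.fromRows h₂
  rw [← hQ, ← hP] at hl
  have hr := h₃.fromRows h₄
  rw [← hS, ← hR] at hr
  have hV' : Matrix.fromCols P Q' * Matrix.fromRows B D = V := by
    rw [fromCols_mul_fromRows, hV]
  have hW' : Matrix.fromCols R S * Matrix.fromRows A C = W := by
    rw [fromCols_mul_fromRows, hW]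
  have hsub : ∀ X Y Z Z' : Matrix ι ι k, Matrix.fromRows X Y - Matrix.fromRows Z Z'
      = Matrix.fromRows (X - Z) (Y - Z') := by
    intro X Y Z Z'
    ext (i | i) j <;> simp
  have hsub' : ∀ X Y Z Z' : Matrix ι ι k, Matrix.fromCols X Y - Matrix.fromCols Z Z'
      = Matrix.fromCols (X - Z) (Y - Z') := by
    intro X Y Z Z'
    ext i (j | j) <;> simp
  have hE : Matrix.fromRows B D
      - Matrix.fromRows A C * (Matrix.fromCols P Q' * Matrix.fromRows B D)
      = Matrix.fromRows (B - A * V) (D - C * V) := by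
    rw [hV', fromRows_mul, hsub]
  rw [← hE] at hr
  have := hl.fromCols hr hN
  rw [hW', hV', mul_fromCols, hsub', mul_fromCols, hsub', fromRows_fromCols_eq_fromBlocks] at this
  convert this using 1
  ext (i | i) (j | j) <;> rfl

end HermInv

/-! ## Filling of matrices by loops -/

section Fill

variable {k : Type u} {Q : Type v}

/-- The states differ only in array `3` of words and in the matrix `x` of array `a` of scalars. -/
structure Sim (a x : ℕ) (s s' : State k Q) : Prop where
  nat : ∀ b, b ≠ 3 → s'.nat b = s.nat b
  elt : s'.elt = s.elt
  scal : ∀ b y, (b ≠ a ∨ y ≠ x) → s'.scal b y = s.scal b y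

theorem Sim.refl (a x : ℕ) (s : State k Q) : Sim a x s s :=
  ⟨fun _ _ => rfl, rfl, fun _ _ _ => rfl⟩

theorem Sim.put {a x : ℕ} {s s' : State k Q} (h : Sim a x s s') (v y : ℕ) :
    Sim a x s (s'.put 3 v y) :=
  ⟨fun b hb => (Mem.write_of_ne _ _ hb).trans (h.nat b hb), h.elt, h.scal⟩

theorem Sim.write {a x : ℕ} {s s' : State k Q} (h : Sim a x s s') (i j : ℕ) (y : k) :
    Sim a x s { s' with scal := s'.scal.write a x i j y } := by
  refine ⟨h.nat, h.elt, fun b y hb => ?_⟩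
  rw [← h.scal b y hb]
  funext i' j'
  simp only [Mem.write]
  exact if_neg (by tauto)

variable [Field k] [PartialOrder Q] {procs : List (Stmt k)} {W : ℕ}

/-- Execute `body` for all values less than `n₁` and `n₂` of the two counters. -/
def forIJ (n₁ n₂ : NExp) (body : Stmt k) : Stmt k := forN 3 0 n₁ (forN 3 1 n₂ body)

/-- The value written at `(i, j)` is prescribed by `val` and must be obtained in every state that is
`Sim`-related to the initial one, whatever has been filled in so far. The assumption `1 ≤ N` allows
the overheads of both loops to be absorbed in the multiple of `N ^ 2`. -/
theorem Does.forIJ {a x n₁ n₂ c q N : ℕ} {e₁ e₂ : NExp} {body : Stmt k} {s : State k Q}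
    {val : ℕ → ℕ → k} (hW : N < W) (hN : 1 ≤ N) (hn₁ : n₁ ≤ N) (hn₂ : n₂ ≤ N)
    (hc₁ : e₁.cost ≤ q) (hc₂ : e₂.cost ≤ q)
    (he : ∀ s', Sim a x s s' → (e₁.Fits W s'.nat ∧ e₁.eval s'.nat = n₁) ∧
      e₂.Fits W s'.nat ∧ e₂.eval s'.nat = n₂)
    (hb : ∀ s', Sim a x s s' → ∀ i < n₁, ∀ j < n₂, s'.nat 3 0 0 0 = i → s'.nat 3 1 0 0 = j →
      Does procs W body s' c fun s'' =>
        s'' = { s' with scal := s'.scal.write a x i j (val i j) }) :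
    Does procs W (forIJ e₁ e₂ body) s ((c + 4 * (q + 20)) * N ^ 2) fun s' =>
      Sim a x s s' ∧ ∀ i < n₁, ∀ j < n₂, s'.scal a x i j = val i j := by
  have main := Does.forN (procs := procs) (W := W) (c := 3) (v := 0) (bound := e₁)
    (body := PosetComplex.forN 3 1 e₂ body) (s := s) (n := n₁) (T := n₂ * (c + e₂.cost + 20) + (e₂.cost + 20))
    (fun i s' => Sim a x s s' ∧ ∀ i' < i, ∀ j < n₂, s'.scal a x i' j = val i' j)
    (by omega) (by omega) (fun i _ s' hs _ => (he s' hs.1).1)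
    ⟨(Sim.refl a x s).put _ _, by simp⟩ ?_
  · refine main.mono ?_ fun _ h => h
    have h1 : n₂ * (c + e₂.cost + 20) ≤ N * (c + q + 20) := Nat.mul_le_mul hn₂ (by omega)
    have h2 : n₁ * (n₂ * (c + e₂.cost + 20) + (e₂.cost + 20) + e₁.cost + 20)
        ≤ N * (N * (c + q + 20) + (q + 20) + q + 20) := Nat.mul_le_mul hn₁ (by omega)
    have h3 : e₁.cost + 20 ≤ (q + 20) * N ^ 2 :=
      (by omega : e₁.cost + 20 ≤ (q + 20) * 1).trans
        (Nat.mul_le_mul_left _ (Nat.one_le_pow _ _ hN))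
    have h4 : N * (2 * (q + 20)) ≤ (2 * (q + 20)) * N ^ 2 := by nlinarith
    nlinarith
  · intro i hi s' hs hc
    have inner := Does.forN (procs := procs) (W := W) (c := 3) (v := 1) (bound := e₂)
      (body := body) (s := s') (n := n₂) (T := c)
      (fun j s'' => s''.nat 3 0 0 0 = i ∧ Sim a x s s'' ∧
        (∀ i' < i, ∀ j < n₂, s''.scal a x i' j = val i' j) ∧
        ∀ j' < j, s''.scal a x i j' = val i j')
      (by omega) (by omega) (fun j _ s'' hs _ => (he s'' hs.2.1).2)
      ⟨by simp [Mem.write, hc], hs.1.put _ _, hs.2, by simp⟩ ?_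
    · refine inner.mono le_rfl ?_
      rintro s'' ⟨h1, h2, h3, h4⟩
      refine ⟨h1, h2.put _ _, fun i' hi' j hj => ?_⟩
      rcases Nat.lt_succ_iff_lt_or_eq.1 hi' with h | rfl
      · exact h3 i' h j hj
      · exact h4 j hj
    · rintro j hj s'' ⟨h1, h2, h3, h4⟩ hc'
      refine (hb s'' h2 i hi j hj h1 hc').mono le_rfl ?_
      rintro s₃ rfl
      refine ⟨hc', ⟨by simp [Mem.write, h1], (h2.write _ _ _).put _ _, fun i' hi' j' hj' => ?_,
        fun j' hj' => ?_⟩⟩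
      · simp only [Mem.write]
        rw [if_neg (by omega)]
        exact h3 i' hi' j' hj'
      · simp only [Mem.write]
        by_cases h : j' = j
        · simp [h]
        · rw [if_neg (by tauto)]
          exact h4 j' (by omega)

end Fill

/-! ## Straight-line matrix programs -/

section MOp

open Matrix

variable {k : Type u} [Field k] {Q : Type v} [PartialOrder Q]

/-- The current level. -/
abbrev lev : NExp := cell 2 0

/-- The size of the matrices of the current level. -/
abbrev siz : NExp := cell 2 1

/-- The row counter. -/
abbrev cI : NExp := cell 3 0

/-- The column counter. -/
abbrev cJ : NExp := cell 3 1

/-- The entry in the current row and column of the matrix of array `a` at the current level. -/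
abbrev entry (a : ℕ) : KExp k := .get a lev cI cJ

/-- Set all entries of the matrix `x` of array `a`. -/
def setSlot (a : ℕ) (x : NExp) (e : KExp k) : Stmt k := forIJ siz siz (.setK a x cI cJ e)

/-- Operations on the matrices of the current level, the matrices being numbered by their arrays:
products, `x - y * z`, `x + y * z`, and echelon inverses. -/
inductive MOp
  | mul (d y z : ℕ)
  | sub (d x y z : ℕ)
  | add (d x y z : ℕ)
  | inv (d x : ℕ)

/-- The array of a matrix is available for the straight-line programs. -/
def IsSlot (a : ℕ) : Prop := 10 ≤ a ∧ a < 64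

instance (a : ℕ) : Decidable (IsSlot a) := inferInstanceAs (Decidable (_ ∧ _))

namespace MOp

/-- The summand `x` is read while `d` is being overwritten, hence `x ≠ d`. The factors may coincide
with `d`, since they are copied before the product is formed. Arrays `10` and `11` are reserved for
argument and result of the inversion procedure. -/
def Valid : MOp → Prop
  | mul d y z => IsSlot d ∧ IsSlot y ∧ IsSlot z
  | sub d x y z => IsSlot d ∧ IsSlot x ∧ IsSlot y ∧ IsSlot z ∧ x ≠ d
  | add d x y z => IsSlot d ∧ IsSlot x ∧ IsSlot y ∧ IsSlot z ∧ x ≠ d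
  | inv d x => IsSlot d ∧ IsSlot x ∧ 12 ≤ x ∧ 12 ≤ d

instance : DecidablePred Valid := fun o => by
  cases o <;> unfold Valid <;> infer_instance

/-- The weakest precondition of an operation. -/
def wp {n : ℕ} (Φ : (ℕ → Matrix (Fin n) (Fin n) k) → Prop)
    (σ : ℕ → Matrix (Fin n) (Fin n) k) : MOp → Prop
  | mul d y z => ∀ M, M = σ y * σ z → Φ (Function.update σ d M)
  | sub d x y z => ∀ M, M = σ x - σ y * σ z → Φ (Function.update σ d M)
  | add d x y z => ∀ M, M = σ x + σ y * σ z → Φ (Function.update σ d M)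
  | inv d x => ∀ L T, IsHermInv Fin.val L (σ x) T → Φ (Function.update σ d T)

/-- Multiplication of two matrices by the renamed multiplication program `main`; the result is in
matrix `0` of array `65`. -/
def product (main : Stmt k) (y z : ℕ) : Stmt k :=
  .seq (setSlot 64 (.lit 0) (entry y)) (.seq (setSlot 64 (.lit 1) (entry z))
    (.seq (setCell 64 0 siz) (main.shift 64)))

/-- The entry in the current row and column of the product. -/
abbrev productEntry : KExp k := .get 65 (.lit 0) cI cJ

/-- The statement performing an operation, `inv` being performed by procedure `p`. -/
def compile (main : Stmt k) (p : ℕ) : MOp → Stmt k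
  | mul d y z => .seq (product main y z) (setSlot d lev productEntry)
  | sub d x y z => .seq (product main y z) (setSlot d lev (.op .sub (entry x) productEntry))
  | add d x y z => .seq (product main y z) (setSlot d lev (.op .add (entry x) productEntry))
  | inv d x => .seq (setSlot 10 (.op .sub lev (.lit 1)) (entry x))
      (.seq (setCell 2 0 (.op .sub lev (.lit 1))) (.seq (.call p)
        (.seq (setCell 2 0 (.op .add lev (.lit 1)))
          (setSlot d lev (.get 11 (.op .sub lev (.lit 1)) cI cJ)))))

/-- A time bound for an operation on matrices of size `h`, if a product takes time `τ` and an
inversion takes time `T`. -/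
def time (h τ T : ℕ) : MOp → ℕ
  | inv _ _ => 600 * h ^ 2 + T
  | _ => 600 * h ^ 2 + τ

end MOp

/-- The weakest precondition of a list of operations. -/
def wpList {n : ℕ} (Φ : (ℕ → Matrix (Fin n) (Fin n) k) → Prop) :
    List MOp → (ℕ → Matrix (Fin n) (Fin n) k) → Prop
  | [], σ => Φ σ
  | o :: l, σ => o.wp (wpList Φ l) σ

def compileList (main : Stmt k) (p : ℕ) : List MOp → Stmt k
  | [] => .skip
  | o :: l => .seq (o.compile main p) (compileList main p l)

/-- The states agree except for scratch cells, the arrays of the multiplication program, and the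
matrices at levels up to `ℓ`. -/
structure Frame (ℓ : ℕ) (s s' : State k Q) : Prop where
  nat : ∀ b < 64, b ≠ 3 → s'.nat b = s.nat b
  elt : ∀ b < 64, s'.elt b = s.elt b
  scal : ∀ b < 64, ∀ y, (b < 10 ∨ ℓ < y) → s'.scal b y = s.scal b y

omit [Field k] [PartialOrder Q] in
theorem Frame.refl (ℓ : ℕ) (s : State k Q) : Frame ℓ s s :=
  ⟨fun _ _ _ => rfl, fun _ _ => rfl, fun _ _ _ _ => rfl⟩

omit [Field k] [PartialOrder Q] in
theorem Frame.trans {ℓ : ℕ} {s s' s'' : State k Q} (h : Frame ℓ s s') (h' : Frame ℓ s' s'') :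
    Frame ℓ s s'' :=
  ⟨fun b hb h3 => (h'.nat b hb h3).trans (h.nat b hb h3),
    fun b hb => (h'.elt b hb).trans (h.elt b hb),
    fun b hb y hy => (h'.scal b hb y hy).trans (h.scal b hb y hy)⟩

omit [Field k] [PartialOrder Q] in
theorem Sim.frame {a x ℓ : ℕ} {s s' : State k Q} (h : Sim a x s s') (ha : 10 ≤ a)
    (hx : x ≤ ℓ ∨ 64 ≤ a) : Frame ℓ s s' :=
  ⟨fun b _ hb => h.nat b hb, fun b _ => by rw [h.elt], fun b hb y hy => h.scal b y (by omega)⟩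

/-- The state contains the matrices `σ` of size `h` at level `ℓ`. -/
structure AtLevel (ℓ h : ℕ) (σ : ℕ → Matrix (Fin h) (Fin h) k) (s : State k Q) : Prop where
  lev : s.nat 2 0 0 0 = ℓ
  siz : s.nat 2 1 0 0 = h
  mat : ∀ b, IsSlot b → ∀ i j : Fin h, s.scal b ℓ i j = σ b i j

/-- The program `π` multiplies matrices of size `n` in time `τ n`, with word bound
`(n + 2) ^ c`. -/
def MulsIn (π : Program k) (c : ℕ) (τ : ℕ → ℕ) (Q : Type v) [PartialOrder Q] : Prop :=
  ∀ (n : ℕ) (A B : Matrix (Fin n) (Fin n) k) (s : State k Q), 0 < n →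
    s.nat 0 0 0 0 = n →
    (∀ i j : Fin n, s.scal 0 0 i j = A i j) →
    (∀ i j : Fin n, s.scal 0 1 i j = B i j) →
    ∃ (t : ℕ) (s' : State k Q), π.Runs ((n + 2) ^ c) s t s' ∧ t ≤ τ n ∧
      ∀ i j : Fin n, s'.scal 1 0 i j = (A * B) i j

/-- Procedure `p` computes echelon inverses at level `ℓ` in time `T`. -/
def InvertsIn (procs : List (Stmt k)) (W p ℓ T : ℕ) (Q : Type v) [PartialOrder Q] : Prop :=
  ∀ (n : ℕ), n = 2 ^ ℓ → ∀ s : State k Q, s.nat 2 0 0 0 = ℓ → s.nat 2 1 0 0 = n →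
    Does procs W (.call p) s T fun s' => Frame ℓ s s' ∧ ∃ L T',
      IsHermInv Fin.val L (of fun i j : Fin n => s.scal 10 ℓ i j) T' ∧
      ∀ i j : Fin n, s'.scal 11 ℓ i j = T' i j

variable {procs : List (Stmt k)} {W : ℕ}

theorem Does.setSlot {a x h : ℕ} {xe : NExp} {e : KExp k} {s : State k Q} {val : ℕ → ℕ → k}
    (hW : h < W) (h64 : 64 ≤ W) (hh : 1 ≤ h) (hs : s.nat 2 1 0 0 = h)
    (hxc : xe.cost ≤ 6) (hec : e.cost ≤ 40)
    (hx : ∀ s', Sim a x s s' → xe.Fits W s'.nat ∧ xe.eval s'.nat = x)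
    (he : ∀ s', Sim a x s s' → ∀ i < h, ∀ j < h, s'.nat 3 0 0 0 = i → s'.nat 3 1 0 0 = j →
      e.Fits W s'.nat ∧ e.eval s' = val i j) :
    Does procs W (setSlot a xe e) s (160 * h ^ 2) fun s' =>
      Sim a x s s' ∧ ∀ i < h, ∀ j < h, s'.scal a x i j = val i j := by
  refine (Does.forIJ (c := 60) (q := 4) (N := h) hW hh le_rfl le_rfl (by simp [NExp.cost])
    (by simp [NExp.cost]) (fun s' h' => ?_) fun s' h' i hi j hj hI hJ => ?_).mono
    (Nat.mul_le_mul_right _ (by norm_num)) fun _ h => h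
  · simp only [NExp.Fits, NExp.eval, h'.nat 2 (by norm_num), hs, and_true, and_self]
    omega
  · obtain ⟨hf, hv⟩ := he s' h' i hi j hj hI hJ
    obtain ⟨hxf, hxv⟩ := hx s' h'
    refine Does.setK ⟨hxf, ?_, ?_, hf⟩ ?_ ?_
    · simp only [NExp.Fits]; omega
    · simp only [NExp.Fits]; omega
    · simp only [NExp.cost]; omega
    · simp only [NExp.eval, hI, hJ, hxv, hv]

omit [Field k] [PartialOrder Q] in
theorem lev_fits {s : State k Q} {ℓ : ℕ} (hℓ : s.nat 2 0 0 0 = ℓ) :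
    NExp.Fits W s.nat lev ∧ NExp.eval s.nat lev = ℓ := by
  simp [NExp.Fits, NExp.eval, hℓ]

omit [PartialOrder Q] in
theorem entry_eval {s s' : State k Q} {a x ℓ h y i j : ℕ}
    {σ : ℕ → Matrix (Fin h) (Fin h) k} (h64 : 64 ≤ W) (hs : AtLevel ℓ h σ s)
    (hsim : Sim a x s s') (hy : IsSlot y) (hya : y ≠ a ∨ ℓ ≠ x) (hi : i < h) (hj : j < h)
    (hI : s'.nat 3 0 0 0 = i) (hJ : s'.nat 3 1 0 0 = j) :
    (entry y : KExp k).Fits W s'.nat ∧ (entry y : KExp k).eval s' = σ y ⟨i, hi⟩ ⟨j, hj⟩ := by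
  constructor
  · simp only [KExp.Fits, NExp.Fits]; omega
  · simp only [KExp.eval, NExp.eval, hI, hJ, hsim.nat 2 (by norm_num), hs.lev, hsim.scal y ℓ hya]
    exact hs.mat y hy ⟨i, hi⟩ ⟨j, hj⟩

omit [Field k] [PartialOrder Q] in
theorem AtLevel.frame {s s' : State k Q} {ℓ h : ℕ} {σ : ℕ → Matrix (Fin h) (Fin h) k}
    (hs : AtLevel ℓ h σ s) (hn : s'.nat 2 = s.nat 2) (hm : ∀ b, IsSlot b → s'.scal b ℓ = s.scal b ℓ) :
    AtLevel ℓ h σ s' :=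
  ⟨by rw [hn, hs.lev], by rw [hn, hs.siz], fun b hb i j => by rw [hm b hb, hs.mat b hb]⟩

omit [Field k] [PartialOrder Q] in
theorem AtLevel.update {s s' : State k Q} {d ℓ h : ℕ} {σ : ℕ → Matrix (Fin h) (Fin h) k}
    {M : Matrix (Fin h) (Fin h) k}
    (hs : AtLevel ℓ h σ s) (hsim : Sim d ℓ s s') (hM : ∀ i j : Fin h, s'.scal d ℓ i j = M i j) :
    AtLevel ℓ h (Function.update σ d M) s' := by
  refine ⟨by rw [hsim.nat 2 (by norm_num), hs.lev], by rw [hsim.nat 2 (by norm_num), hs.siz],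
    fun b hb i j => ?_⟩
  by_cases hbd : b = d
  · subst hbd
    rw [hM, Function.update_self]
  · rw [Function.update_of_ne hbd, hsim.scal b ℓ (Or.inl hbd), hs.mat b hb]

/-- The value of a function on pairs of numbers less than `h`, extended by zero. -/
def extend {h : ℕ} (M : Matrix (Fin h) (Fin h) k) (i j : ℕ) : k :=
  if hij : i < h ∧ j < h then M ⟨i, hij.1⟩ ⟨j, hij.2⟩ else 0

theorem extend_apply {h : ℕ} (M : Matrix (Fin h) (Fin h) k) {i j : ℕ} (hi : i < h) (hj : j < h) :
    extend M i j = M ⟨i, hi⟩ ⟨j, hj⟩ := dif_pos ⟨hi, hj⟩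

/-- Seen through `State.view 64`, the copied factors and the size are a valid input of the
multiplication program, and its output array `1` is array `65`. -/
theorem MOp.product_does {π : Program k} {c : ℕ} {τ : ℕ → ℕ} (hπ : MulsIn π c τ Q)
    (hprocs : ∀ (n : ℕ) (p : Stmt k), π.procs[n]? = some p → procs[n]? = some (p.shift 64))
    {ℓ h : ℕ} {σ : ℕ → Matrix (Fin h) (Fin h) k} {s : State k Q} (hs : AtLevel ℓ h σ s)
    (hh : 1 ≤ h) (hW : h < W) (h64 : 64 ≤ W) (hc : (h + 2) ^ c ≤ W) {y z : ℕ} (hy : IsSlot y)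
    (hz : IsSlot z) :
    Does procs W (product π.main y z) s (330 * h ^ 2 + τ h) fun s' =>
      Frame ℓ s s' ∧ AtLevel ℓ h σ s' ∧ ∀ i j : Fin h, s'.scal 65 0 i j = (σ y * σ z) i j := by
  have h2 : 1 ≤ h ^ 2 := Nat.one_le_pow _ _ hh
  have hyz := hy.2
  have hzz := hz.2
  have hcost : 160 * h ^ 2 + (160 * h ^ 2 + (10 + τ h)) ≤ 330 * h ^ 2 + τ h := by omega
  refine Does.mono (Does.seq ?_) hcost fun _ h => h
  refine (Does.setSlot (x := 0) (val := extend (σ y)) hW h64 hh hs.siz (by simp [NExp.cost])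
    (by simp [KExp.cost, NExp.cost]) (fun s' _ => ⟨Nat.zero_le _, rfl⟩)
    fun s' h' i hi j hj hI hJ => by
      rw [extend_apply _ hi hj]
      exact entry_eval h64 hs h' hy (Or.inl (by omega)) hi hj hI hJ).mono le_rfl ?_
  rintro s₁ ⟨hsim₁, hv₁⟩
  have hs₁ : AtLevel ℓ h σ s₁ := hs.frame (hsim₁.nat 2 (by norm_num)) fun b hb =>
    hsim₁.scal b ℓ (Or.inl (by have := hb.2; omega))
  refine Does.seq ?_
  refine (Does.setSlot (x := 1) (val := extend (σ z)) hW h64 hh hs₁.siz (by simp [NExp.cost])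
    (by simp [KExp.cost, NExp.cost])
    (fun s' _ => ⟨by simp only [NExp.Fits]; omega, rfl⟩)
    fun s' h' i hi j hj hI hJ => by
      rw [extend_apply _ hi hj]
      exact entry_eval h64 hs₁ h' hz (Or.inl (by omega)) hi hj hI hJ).mono le_rfl ?_
  rintro s₂ ⟨hsim₂, hv₂⟩
  have hs₂ : AtLevel ℓ h σ s₂ := hs₁.frame (hsim₂.nat 2 (by norm_num)) fun b hb =>
    hsim₂.scal b ℓ (Or.inl (by have := hb.2; omega))
  refine Does.seq ?_
  refine Does.setN ?_ (by simp [NExp.cost]) ?_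
  · simp only [NExp.Fits]; omega
  have hs₃ : AtLevel ℓ h σ (s₂.put 64 0 h) := hs₂.frame
    (s₂.put_nat_of_ne _ _ (by norm_num)) fun _ _ => rfl
  simp only [NExp.eval, hs₂.siz]
  obtain ⟨t, u', hrun, ht, hres⟩ := hπ h (σ y) (σ z) ((s₂.put 64 0 h).view 64) (by omega)
    (by simp [State.view, Mem.write])
    (fun i j => by
      simp only [State.view]
      rw [hsim₂.scal _ _ (Or.inr (by norm_num)), hv₁ i i.2 j j.2, extend_apply _ i.2 j.2])
    (fun i j => by
      simp only [State.view]
      rw [hv₂ i i.2 j j.2, extend_apply _ i.2 j.2])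
  -- The run on the viewed state is carried back to the whole memory, and its word bound `(h + 2) ^
  -- c` is enlarged to `W`.
  obtain ⟨s₄, hrun', hview, hlow⟩ := Exec.shift (procs' := procs) 64 hprocs hc hrun _ rfl
  refine ⟨t, s₄, hrun', ht, ?_, ?_, ?_⟩
  · refine (hsim₁.frame (by norm_num) (Or.inr (by norm_num))).trans
      ((hsim₂.frame (by norm_num) (Or.inr (by norm_num))).trans ⟨fun b hb _ => ?_, fun b hb => ?_,
        fun b hb y _ => ?_⟩)
    · rw [hlow.nat b hb]
      exact Mem.write_of_ne _ _ (by omega)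
    · rw [hlow.elt b hb]
    · rw [hlow.scal b hb]
  · exact hs₃.frame (hlow.nat 2 (by norm_num)) fun b hb => by rw [hlow.scal b hb.2]
  · intro i j
    rw [← hres i j, ← hview]
    rfl

/-- Matrices of size `2 ^ ℓ` are kept at level `ℓ + 1`, one higher than the level at which matrices
of this size are inverted. An inversion copies its argument one level down and fetches the result
from there, so no operand is lost. -/
theorem MOp.compile_does {π : Program k} {c : ℕ} {τ : ℕ → ℕ} (hπ : MulsIn π c τ Q)
    (hprocs : ∀ (n : ℕ) (p : Stmt k), π.procs[n]? = some p → procs[n]? = some (p.shift 64))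
    {ℓ h p T : ℕ} (hinv : InvertsIn procs W p ℓ T Q) (hhℓ : h = 2 ^ ℓ)
    {σ : ℕ → Matrix (Fin h) (Fin h) k} {s : State k Q} (hs : AtLevel (ℓ + 1) h σ s)
    (hW : h < W) (h64 : 64 ≤ W) (hc : (h + 2) ^ c ≤ W) (o : MOp) (ho : o.Valid)
    {Φ : (ℕ → Matrix (Fin h) (Fin h) k) → Prop} (hΦ : o.wp Φ σ) :
    Does procs W (o.compile π.main p) s (o.time h (τ h) T) fun s' =>
      Frame (ℓ + 1) s s' ∧ ∃ σ', AtLevel (ℓ + 1) h σ' s' ∧ Φ σ' := by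
  have hh : 1 ≤ h := hhℓ ▸ Nat.one_le_two_pow
  have h2 : 1 ≤ h ^ 2 := Nat.one_le_pow _ _ hh
  have hℓW : ℓ < h := hhℓ ▸ Nat.lt_two_pow_self
  -- The common part of the three operations with a product; they differ only in the entry
  -- expression `e` of the final copy.
  have hprod : ∀ {y z d : ℕ} {e : KExp k} {M : Matrix (Fin h) (Fin h) k}, IsSlot y → IsSlot z →
      IsSlot d → e.cost ≤ 40 → (∀ s₁ : State k Q, AtLevel (ℓ + 1) h σ s₁ → ∀ s' : State k Q, Sim d (ℓ + 1) s₁ s' →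
        (∀ i j : Fin h, s₁.scal 65 0 i j = (σ y * σ z) i j) →
        ∀ i (hi : i < h) j (hj : j < h), s'.nat 3 0 0 0 = i → s'.nat 3 1 0 0 = j →
        e.Fits W s'.nat ∧ e.eval s' = M ⟨i, hi⟩ ⟨j, hj⟩) → Φ (Function.update σ d M) →
      Does procs W (.seq (product π.main y z) (PosetComplex.setSlot d PosetComplex.lev e)) s
        (600 * h ^ 2 + τ h) fun s' =>
        Frame (ℓ + 1) s s' ∧ ∃ σ', AtLevel (ℓ + 1) h σ' s' ∧ Φ σ' := by
    intro y z d e M hy hz hd hec he hM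
    refine Does.mono (Does.seq (T₂ := 160 * h ^ 2)
      ((product_does hπ hprocs hs hh hW h64 hc hy hz).mono le_rfl ?_)) (by omega) fun _ h => h
    rintro s₁ ⟨hf₁, hs₁, hv₁⟩
    refine (Does.setSlot (x := ℓ + 1) (val := extend M) hW h64 hh hs₁.siz (by simp [NExp.cost])
      hec (fun s' h' => lev_fits (by rw [h'.nat 2 (by norm_num), hs₁.lev]))
      fun s' h' i hi j hj hI hJ => by
        rw [extend_apply _ hi hj]
        exact he s₁ hs₁ s' h' hv₁ i hi j hj hI hJ).mono le_rfl ?_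
    rintro s₂ ⟨hsim₂, hv₂⟩
    refine ⟨hf₁.trans (hsim₂.frame hd.1 (Or.inl le_rfl)), _, hs₁.update hsim₂ fun i j => ?_, hM⟩
    rw [hv₂ i i.2 j j.2, extend_apply _ i.2 j.2]
  have hpe : ∀ {y z d : ℕ} {s₁ s' : State k Q}, IsSlot d → Sim d (ℓ + 1) s₁ s' →
      (∀ i j : Fin h, s₁.scal 65 0 i j = (σ y * σ z) i j) →
      ∀ i (hi : i < h) j (hj : j < h), s'.nat 3 0 0 0 = i → s'.nat 3 1 0 0 = j →
      (productEntry : KExp k).Fits W s'.nat ∧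
        (productEntry : KExp k).eval s' = (σ y * σ z) ⟨i, hi⟩ ⟨j, hj⟩ := by
    intro y z d s₁ s' hd hsim hv i hi j hj hI hJ
    have := hd.2
    constructor
    · simp only [KExp.Fits, NExp.Fits]; omega
    · simp only [KExp.eval, NExp.eval, hI, hJ]
      rw [hsim.scal 65 0 (Or.inl (by omega))]
      exact hv ⟨i, hi⟩ ⟨j, hj⟩
  cases o with
  | mul d y z =>
    obtain ⟨hd, hy, hz⟩ := ho
    exact hprod hy hz hd (by simp [KExp.cost, NExp.cost])
      (fun s₁ hs₁ s' hsim hv i hi j hj hI hJ => hpe hd hsim hv i hi j hj hI hJ) (hΦ _ rfl)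
  | sub d x y z =>
    obtain ⟨hd, hx, hy, hz, hxd⟩ := ho
    refine hprod hy hz hd (by simp [KExp.cost, NExp.cost])
      (fun s₁ hs₁ s' hsim hv i hi j hj hI hJ => ?_) (hΦ _ rfl)
    obtain ⟨h1, h2⟩ := hpe hd hsim hv i hi j hj hI hJ
    obtain ⟨h3, h4⟩ := entry_eval h64 hs₁ hsim hx (Or.inl hxd) hi hj hI hJ
    exact ⟨⟨h3, h1⟩, by simp only [KExp.eval] at h2 h4 ⊢; rw [h2, h4]; rfl⟩
  | add d x y z =>
    obtain ⟨hd, hx, hy, hz, hxd⟩ := ho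
    refine hprod hy hz hd (by simp [KExp.cost, NExp.cost])
      (fun s₁ hs₁ s' hsim hv i hi j hj hI hJ => ?_) (hΦ _ rfl)
    obtain ⟨h1, h2⟩ := hpe hd hsim hv i hi j hj hI hJ
    obtain ⟨h3, h4⟩ := entry_eval h64 hs₁ hsim hx (Or.inl hxd) hi hj hI hJ
    exact ⟨⟨h3, h1⟩, by simp only [KExp.eval] at h2 h4 ⊢; rw [h2, h4]; rfl⟩
  | inv d x =>
    obtain ⟨hd, hx, hx12, hd12⟩ := ho
    have hd' := hd.2
    have hcost : 160 * h ^ 2 + (15 + (T + (15 + 160 * h ^ 2))) ≤ 600 * h ^ 2 + T := by omega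
    refine Does.mono (Does.seq ?_) hcost fun _ h => h
    refine (Does.setSlot (x := ℓ) (val := extend (σ x)) hW h64 hh hs.siz (by simp [NExp.cost])
      (by simp [KExp.cost, NExp.cost])
      (fun s' h' => by
        simp only [NExp.Fits, NExp.eval, h'.nat 2 (by norm_num), hs.lev, NOp.eval]
        omega)
      fun s' h' i hi j hj hI hJ => by
        rw [extend_apply _ hi hj]
        exact entry_eval h64 hs h' hx (Or.inr (by omega)) hi hj hI hJ).mono le_rfl ?_
    rintro s₁ ⟨hsim₁, hv₁⟩
    have hs₁ : AtLevel (ℓ + 1) h σ s₁ := hs.frame (hsim₁.nat 2 (by norm_num)) fun b hb =>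
      hsim₁.scal b _ (Or.inr (by omega))
    refine Does.seq ?_
    refine Does.setN ?_ (by simp [NExp.cost]) ?_
    · simp only [NExp.Fits, NExp.eval, hs₁.lev, NOp.eval]; omega
    have e₂ : NExp.eval s₁.nat (.op .sub PosetComplex.lev (.lit 1)) = ℓ := by
      simp only [NExp.eval, hs₁.lev, NOp.eval]; omega
    rw [e₂]
    simp only [NExp.eval]
    set s₂ := s₁.put 2 0 ℓ with hs₂
    refine Does.seq ((hinv h hhℓ s₂ (by simp [hs₂, Mem.write]) (by
      simp [hs₂, Mem.write, hs₁.siz])).mono le_rfl ?_)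
    rintro s₃ ⟨hf₃, L, T', hT', hv₃⟩
    have hn₃ : s₃.nat 2 = s₂.nat 2 := hf₃.nat 2 (by norm_num) (by norm_num)
    have hlev₃ : s₃.nat 2 0 0 0 = ℓ := by rw [hn₃]; simp [hs₂, Mem.write]
    refine Does.seq ?_
    refine Does.setN ?_ (by simp [NExp.cost]) ?_
    · simp only [NExp.Fits, NExp.eval, hlev₃, NOp.eval]; omega
    have e₄ : NExp.eval s₃.nat (.op .add PosetComplex.lev (.lit 1)) = ℓ + 1 := by
      simp only [NExp.eval, hlev₃, NOp.eval]
    rw [e₄]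
    simp only [NExp.eval]
    set s₄ := s₃.put 2 0 (ℓ + 1) with hs₄
    -- The level cell has been decremented and incremented again, so array `2` is as before the
    -- call.
    have hn₄ : s₄.nat 2 = s₁.nat 2 := by
      funext i j l
      simp only [hs₄, Mem.write, hn₃, hs₂]
      by_cases hijl : i = 0 ∧ j = 0 ∧ l = 0
      · obtain ⟨rfl, rfl, rfl⟩ := hijl
        simp [hs₁.lev]
      · simp [hijl]
    have hs₄' : AtLevel (ℓ + 1) h σ s₄ := hs₁.frame hn₄ fun b hb => by
      change s₃.scal b _ = _
      rw [hf₃.scal b hb.2 (ℓ + 1) (Or.inr (by omega))]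
    refine (Does.setSlot (x := ℓ + 1) (val := extend T') hW h64 hh hs₄'.siz (by simp [NExp.cost])
      (by simp [KExp.cost, NExp.cost])
      (fun s' h' => lev_fits (by rw [h'.nat 2 (by norm_num), hs₄'.lev]))
      fun s' h' i hi j hj hI hJ => ?_).mono le_rfl ?_
    · rw [extend_apply _ hi hj]
      have hl : s'.nat 2 0 0 0 = ℓ + 1 := by rw [h'.nat 2 (by norm_num), hs₄'.lev]
      constructor
      · simp only [KExp.Fits, NExp.Fits, NExp.eval, NOp.eval, hl]; omega
      · simp only [KExp.eval, NExp.eval, hI, hJ, NOp.eval, hl, Nat.add_sub_cancel]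
        rw [h'.scal 11 ℓ (Or.inr (by omega))]
        exact hv₃ ⟨i, hi⟩ ⟨j, hj⟩
    rintro s₅ ⟨hsim₅, hv₅⟩
    have hf₄ : Frame (ℓ + 1) s₁ s₄ := by
      refine ⟨fun b hb hb3 => ?_, fun b hb => hf₃.elt b hb, fun b hb y hy => ?_⟩
      · by_cases hb2 : b = 2
        · rw [hb2, hn₄]
        · rw [hs₄]
          change s₃.nat.write 2 0 0 0 (ℓ + 1) b = _
          rw [Mem.write_of_ne _ _ hb2, hf₃.nat b hb hb3]
          exact Mem.write_of_ne _ _ hb2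
      · exact hf₃.scal b hb y (hy.imp_right fun h => by omega)
    refine ⟨(hsim₁.frame (by norm_num) (Or.inl (by omega))).trans
      (hf₄.trans (hsim₅.frame hd.1 (Or.inl le_rfl))), _,
      hs₄'.update hsim₅ fun i j => ?_, hΦ L T' ?_⟩
    · rw [hv₅ i i.2 j j.2, extend_apply _ i.2 j.2]
    · convert hT' using 1
      ext i j
      simp only [of_apply]
      change _ = s₁.scal 10 ℓ i j
      rw [hv₁ i i.2 j j.2, extend_apply _ i.2 j.2]

theorem compileList_does {π : Program k} {c : ℕ} {τ : ℕ → ℕ} (hπ : MulsIn π c τ Q)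
    (hprocs : ∀ (n : ℕ) (p : Stmt k), π.procs[n]? = some p → procs[n]? = some (p.shift 64))
    {ℓ h p T : ℕ} (hinv : InvertsIn procs W p ℓ T Q) (hhℓ : h = 2 ^ ℓ)
    (hW : h < W) (h64 : 64 ≤ W) (hc : (h + 2) ^ c ≤ W)
    {Φ : (ℕ → Matrix (Fin h) (Fin h) k) → Prop} (l : List MOp) (hl : ∀ o ∈ l, o.Valid) :
    ∀ {σ : ℕ → Matrix (Fin h) (Fin h) k} {s : State k Q}, AtLevel (ℓ + 1) h σ s →
    wpList Φ l σ →
    Does procs W (compileList π.main p l) s ((l.map (MOp.time h (τ h) T)).sum + 1) fun s' =>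
      Frame (ℓ + 1) s s' ∧ ∃ σ', AtLevel (ℓ + 1) h σ' s' ∧ Φ σ' := by
  induction l with
  | nil => exact fun {σ s} hs hΦ => Does.skip (by simp) ⟨Frame.refl _ _, σ, hs, hΦ⟩
  | cons o l ih =>
    intro σ s hs hΦ
    rw [List.map_cons, List.sum_cons, add_assoc]
    refine Does.seq ((MOp.compile_does hπ hprocs hinv hhℓ hs hW h64 hc o (hl o (by simp))
      hΦ).mono le_rfl ?_)
    rintro s₁ ⟨hf₁, σ₁, hs₁, hΦ₁⟩
    refine (ih (fun o ho => hl o (by simp [ho])) hs₁ hΦ₁).mono le_rfl ?_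
    rintro s₂ ⟨hf₂, hs₂⟩
    exact ⟨hf₁.trans hf₂, hs₂⟩

end MOp

/-! ## The recursive inversion procedure -/

section Recursion

open Matrix

variable {k : Type u} [Field k]

/-- One step of the block recursion. The blocks are in `12, 13, 14, 15`, the blocks of the result in
`38, 39, 36, 37`. -/
def blockOps : List MOp :=
  [.inv 16 12, .mul 17 16 12, .sub 18 14 14 17, .inv 19 18, .sub 20 19 17 19, .mul 21 14 16,
    .sub 22 16 20 21, .mul 23 22 13, .add 24 23 20 15, .sub 25 13 12 24, .sub 26 15 14 24,
    .inv 27 25, .mul 28 27 25, .sub 29 26 26 28, .inv 30 29, .sub 31 30 28 30, .mul 32 26 27,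
    .sub 33 27 31 32, .mul 34 33 12, .add 35 34 31 14, .sub 36 33 35 22, .sub 37 31 35 20,
    .sub 38 22 24 36, .sub 39 20 24 37]

theorem blockOps_valid : ∀ o ∈ blockOps, o.Valid := by decide

theorem blockOps_time (h τ T : ℕ) :
    (blockOps.map (MOp.time h τ T)).sum = 4 * T + 20 * τ + 24 * (600 * h ^ 2) := by
  simp only [blockOps, List.map_cons, List.map_nil, List.sum_cons, List.sum_nil, MOp.time]
  ring

/-- The list `blockOps` evaluates the formulas of `IsHermInv.blocks` one product at a time. As
`MOp.wp` introduces each result by an equation, eliminating the auxiliary products leaves precisely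
the hypotheses of that lemma. -/
theorem blockOps_wp {h : ℕ} (σ : ℕ → Matrix (Fin h) (Fin h) k) :
    wpList (fun σ' => ∃ L, IsHermInv (Sum.elim Fin.val fun i : Fin h => h + i.val) L
      (fromBlocks (σ 12) (σ 13) (σ 14) (σ 15))
      (fromBlocks (σ' 38) (σ' 39) (σ' 36) (σ' 37))) blockOps σ := by
  simp only [blockOps, wpList, MOp.wp]
  intro L₁ T₁ h₁ R₁ eR₁ C' eC' L₂ T₂ h₂ Q' eQ CT eCT P eP V₀ eV₀ V eV E₁ eE₁ E₂ eE₂ L₃ T₃ h₃ R₃ eR₃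
    E₂' eE₂' L₄ T₄ h₄ S eS ET eET R eR W₀ eW₀ W eW M₁ eM₁ M₂ eM₂ N₁ eN₁ N₂ eN₂
  simp only [ne_eq, Nat.reduceEqDiff, not_false_eq_true,
    Function.update_of_ne, Function.update_self] at *
  subst eR₁ eC' eCT eV₀ eR₃ eE₂' eET eW₀ eE₁ eE₂ eM₁ eM₂ eN₁ eN₂
  exact ⟨_, IsHermInv.blocks (fun i => i.2) h₁ h₂ eQ eP eV h₃ h₄ eS eR eW⟩

theorem isHermInv_of_blocks {h : ℕ} {L : Fin h ⊕ Fin h → Prop}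
    {M T : Matrix (Fin (h + h)) (Fin (h + h)) k} {A B C D A' B' C' D' : Matrix (Fin h) (Fin h) k}
    (hT : IsHermInv (Sum.elim Fin.val fun i : Fin h => h + i.val) L (fromBlocks A B C D)
      (fromBlocks A' B' C' D'))
    (hM : M = (fromBlocks A B C D).submatrix finSumFinEquiv.symm finSumFinEquiv.symm)
    (hT' : T = (fromBlocks A' B' C' D').submatrix finSumFinEquiv.symm finSumFinEquiv.symm) :
    IsHermInv Fin.val (L ∘ finSumFinEquiv.symm) M T := by
  have := hT.submatrix finSumFinEquiv.symm finSumFinEquiv.symm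
  rw [← hM, ← hT'] at this
  convert this using 1
  funext i
  refine Fin.addCases (fun i => ?_) (fun i => ?_) i
  · rw [Function.comp_apply, finSumFinEquiv_symm_apply_castAdd, Sum.elim_inl, Fin.val_castAdd]
  · rw [Function.comp_apply, finSumFinEquiv_symm_apply_natAdd, Sum.elim_inr, Fin.val_natAdd]

/-- Echelon inverses exist for matrices whose size is a power of two. -/
theorem exists_isHermInv (ℓ n : ℕ) (hn : n = 2 ^ ℓ) (A : Matrix (Fin n) (Fin n) k) :
    ∃ L T, IsHermInv Fin.val L A T := by
  induction ℓ generalizing n with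
  | zero =>
    obtain rfl : n = 1 := hn
    exact ⟨_, _, IsHermInv.of_unique A⟩
  | succ ℓ ih =>
    obtain ⟨h, hh⟩ : ∃ h, h = 2 ^ ℓ := ⟨_, rfl⟩
    obtain rfl : n = h + h := by rw [hn, hh]; ring
    set A' := A.submatrix finSumFinEquiv finSumFinEquiv with hA'
    obtain ⟨L₁, T₁, h₁⟩ := ih h hh A'.toBlocks₁₁
    obtain ⟨L₂, T₂, h₂⟩ := ih h hh (A'.toBlocks₂₁ - A'.toBlocks₂₁ * (T₁ * A'.toBlocks₁₁))
    -- The placeholders here and in the next line are determined by the application of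
    -- `IsHermInv.blocks`.
    obtain ⟨L₃, T₃, h₃⟩ := ih h hh (A'.toBlocks₁₂ - A'.toBlocks₁₁ * _)
    obtain ⟨L₄, T₄, h₄⟩ := ih h hh _
    have := IsHermInv.blocks (fun i => i.2) h₁ h₂ rfl rfl (D := A'.toBlocks₂₂) rfl h₃ h₄ rfl rfl rfl
    refine ⟨_, _, isHermInv_of_blocks this ?_ rfl⟩
    rw [fromBlocks_toBlocks, hA']
    simp

/-- The procedure computing an echelon inverse, to be called as procedure `p`. -/
def invProc (main : Stmt k) (p : ℕ) : Stmt k :=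
  .cond (.neq lev (.lit 0))
    (.setK 11 lev (.lit 0) (.lit 0) (.op .div (.lit 1) (.get 10 lev (.lit 0) (.lit 0))))
    (.seq (setCell 2 1 (.op .div siz (.lit 2)))
    (.seq (setSlot 12 lev (.get 10 lev cI cJ))
    (.seq (setSlot 13 lev (.get 10 lev cI (.op .add cJ siz)))
    (.seq (setSlot 14 lev (.get 10 lev (.op .add cI siz) cJ))
    (.seq (setSlot 15 lev (.get 10 lev (.op .add cI siz) (.op .add cJ siz)))
    (.seq (compileList main p blockOps)
    (.seq (setCell 2 1 (.op .mul siz (.lit 2)))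
    (forIJ siz siz (.cond (.nlt cI (.op .div siz (.lit 2)))
      (.cond (.nlt cJ (.op .div siz (.lit 2)))
        (.setK 11 lev cI cJ (.get 38 lev cI cJ))
        (.setK 11 lev cI cJ (.get 39 lev cI (.op .sub cJ (.op .div siz (.lit 2))))))
      (.cond (.nlt cJ (.op .div siz (.lit 2)))
        (.setK 11 lev cI cJ (.get 36 lev (.op .sub cI (.op .div siz (.lit 2))) cJ))
        (.setK 11 lev cI cJ (.get 37 lev (.op .sub cI (.op .div siz (.lit 2)))
          (.op .sub cJ (.op .div siz (.lit 2)))))))))))))))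

/-- A time bound for the inversion procedure, if products take time `τ`. -/
def invTime (τ : ℕ → ℕ) : ℕ → ℕ
  | 0 => 100
  | ℓ + 1 => 4 * invTime τ ℓ + 20 * τ (2 ^ ℓ) + 20000 * (2 ^ ℓ) ^ 2

variable {Q : Type v} [PartialOrder Q] {procs : List (Stmt k)} {W : ℕ}

set_option maxHeartbeats 1000000 in
-- While the block operations run, the size is halved but the level stays `ℓ + 1`. Their recursive
-- calls take place at level `ℓ`, where the induction hypothesis applies, and its `Frame` protects
-- the blocks stored at level `ℓ + 1`.
theorem invProc_does {π : Program k} {c : ℕ} {τ : ℕ → ℕ} (hπ : MulsIn π c τ Q) {p : ℕ}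
    (hprocs : ∀ (n : ℕ) (p : Stmt k), π.procs[n]? = some p → procs[n]? = some (p.shift 64))
    (hp : procs[p]? = some (invProc π.main p)) (h64 : 64 ≤ W) (ℓ : ℕ) (hW : 2 ^ ℓ < W)
    (hc : (2 ^ ℓ + 2) ^ c ≤ W) : InvertsIn procs W p ℓ (invTime τ ℓ) Q := by
  induction ℓ with
  | zero =>
    intro n hn s hlev hsiz
    obtain rfl : n = 1 := hn
    refine (Does.call hp (T := 90) ?_).mono (by simp [invTime]) fun _ h => h
    refine Does.cond (T := 60) (by simp [BExp.Fits, NExp.Fits]) (by simp [BExp.cost, NExp.cost])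
      (fun _ => ?_) fun hn => absurd (by simp [BExp.Holds, NExp.eval, hlev]) hn
    refine Does.setK (by simp [KExp.Fits, NExp.Fits]) (by simp [KExp.cost, NExp.cost]) ?_
    refine ⟨⟨fun _ _ _ => rfl, fun _ _ => rfl, fun b hb y hy => ?_⟩, _, _,
      IsHermInv.of_unique _, fun i j => ?_⟩
    · funext i j
      simp only [Mem.write, NExp.eval, hlev]
      exact if_neg (by omega)
    · simp [Mem.write, NExp.eval, KExp.eval, KOp.eval, hlev, Subsingleton.elim i 0,
        Subsingleton.elim j 0]
  | succ ℓ ih =>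
    intro n hn s hlev hsiz
    obtain ⟨h, hh⟩ : ∃ h, h = 2 ^ ℓ := ⟨_, rfl⟩
    obtain rfl : n = h + h := by rw [hn, hh]; ring
    have hnW : h + h < W := by rw [hn]; exact hW
    have h1 : 1 ≤ h := hh ▸ Nat.one_le_two_pow
    have hℓh : ℓ < h := hh ▸ Nat.lt_two_pow_self
    have h2 : 1 ≤ h ^ 2 := Nat.one_le_pow _ _ h1
    have hhW : h < W := by omega
    have hcW : (h + 2) ^ c ≤ W := (Nat.pow_le_pow_left (by omega) c).trans (hn ▸ hc)
    have hinv := ih (hh ▸ hhW) (hh ▸ hcW)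
    refine (Does.call hp (T := 30 + (10 + (160 * h ^ 2 + (160 * h ^ 2 + (160 * h ^ 2 +
      (160 * h ^ 2 + ((4 * invTime τ ℓ + 20 * τ h + 24 * (600 * h ^ 2)) + 1 +
      (10 + 400 * (h + h) ^ 2)))))))) ?_).mono ?_ fun _ h => h
    swap
    -- Multiples of `h ^ 2`: `24 * 600` for the operations, `4 * 160` for loading the blocks, and `4
    -- * 400` for storing a result of size `2 * h`. With the constant terms this stays below
    -- `20000`, as `1 ≤ h`.
    · simp only [invTime, ← hh]
      nlinarith
    refine Does.cond (T := 10 + (160 * h ^ 2 + (160 * h ^ 2 + (160 * h ^ 2 +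
      (160 * h ^ 2 + ((4 * invTime τ ℓ + 20 * τ h + 24 * (600 * h ^ 2)) + 1 +
      (10 + 400 * (h + h) ^ 2)))))))
      (by simp [BExp.Fits, NExp.Fits]) (by simp only [BExp.cost, NExp.cost]; omega)
      (fun hn => absurd hn (by simp [BExp.Holds, NExp.eval, hlev])) fun _ => ?_
    refine Does.seq (Does.setN ?_ (by simp [NExp.cost]) ?_)
    · simp only [NExp.Fits, NExp.eval, NOp.eval, hsiz]; omega
    have e₁ : NExp.eval s.nat (.op .div siz (.lit 2)) = h := by
      simp only [NExp.eval, NOp.eval, hsiz]; omega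
    rw [e₁]
    simp only [NExp.eval]
    set s₁ := s.put 2 1 h with hs₁
    have hlev₁ : s₁.nat 2 0 0 0 = ℓ + 1 := by simp [hs₁, Mem.write, hlev]
    have hsiz₁ : s₁.nat 2 1 0 0 = h := by simp [hs₁, Mem.write]
    -- loading one block
    have load : ∀ (a : ℕ) (eI eJ : NExp) (o₁ o₂ : ℕ), o₁ ≤ h → o₂ ≤ h → 12 ≤ a → a < 64 →
        eI.cost ≤ 10 → eJ.cost ≤ 10 →
        (∀ s' : State k Q, s'.nat 2 1 0 0 = h → ∀ i < h, ∀ j < h,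
          s'.nat 3 0 0 0 = i → s'.nat 3 1 0 0 = j →
          (eI.Fits W s'.nat ∧ eI.eval s'.nat = i + o₁) ∧
            eJ.Fits W s'.nat ∧ eJ.eval s'.nat = j + o₂) →
        ∀ s' : State k Q, s'.nat 2 0 0 0 = ℓ + 1 → s'.nat 2 1 0 0 = h →
        Does procs W (setSlot a lev (.get 10 lev eI eJ)) s' (160 * h ^ 2) fun s'' =>
          Sim a (ℓ + 1) s' s'' ∧ ∀ i < h, ∀ j < h,
            s''.scal a (ℓ + 1) i j = s'.scal 10 (ℓ + 1) (i + o₁) (j + o₂) := by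
      intro a eI eJ o₁ o₂ ho₁ ho₂ ha ha' hcI hcJ he s' hl hs
      refine Does.setSlot (x := ℓ + 1)
        (val := fun i j => s'.scal 10 (ℓ + 1) (i + o₁) (j + o₂)) hhW h64 h1 hs
        (by simp [NExp.cost]) ?_ (fun s'' h'' => lev_fits (by rw [h''.nat 2 (by norm_num), hl]))
        fun s'' h'' i hi j hj hI hJ => ?_
      · simp only [KExp.cost, NExp.cost]; omega
      · obtain ⟨⟨f1, v1⟩, f2, v2⟩ := he s'' (by rw [h''.nat 2 (by norm_num), hs]) i hi j hj hI hJ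
        have hl'' : s''.nat 2 0 0 0 = ℓ + 1 := by rw [h''.nat 2 (by norm_num), hl]
        refine ⟨⟨(lev_fits hl'').1, f1, f2⟩, ?_⟩
        simp only [KExp.eval, v1, v2, (lev_fits (W := W) hl'').2]
        rw [h''.scal 10 (ℓ + 1) (Or.inl (by omega))]
    refine Does.seq ((load 12 _ _ 0 0 (by omega) (by omega) (by norm_num) (by norm_num)
      (by simp [NExp.cost]) (by simp [NExp.cost]) (fun s' hs i hi j hj hI hJ => by
        simp only [NExp.Fits, NExp.eval, hI, hJ]; omega) s₁ hlev₁ hsiz₁).mono le_rfl ?_)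
    rintro s₂ ⟨hsim₂, hv₂⟩
    have hlev₂ : s₂.nat 2 0 0 0 = ℓ + 1 := by rw [hsim₂.nat 2 (by norm_num), hlev₁]
    have hsiz₂ : s₂.nat 2 1 0 0 = h := by rw [hsim₂.nat 2 (by norm_num), hsiz₁]
    refine Does.seq ((load 13 _ _ 0 h (by omega) (by omega) (by norm_num) (by norm_num)
      (by simp [NExp.cost]) (by simp [NExp.cost]) (fun s' hs i hi j hj hI hJ => by
        simp only [NExp.Fits, NExp.eval, NOp.eval, hI, hJ, hs, and_true]; omega) s₂ hlev₂ hsiz₂).mono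
          le_rfl ?_)
    rintro s₃ ⟨hsim₃, hv₃⟩
    have hlev₃ : s₃.nat 2 0 0 0 = ℓ + 1 := by rw [hsim₃.nat 2 (by norm_num), hlev₂]
    have hsiz₃ : s₃.nat 2 1 0 0 = h := by rw [hsim₃.nat 2 (by norm_num), hsiz₂]
    refine Does.seq ((load 14 _ _ h 0 (by omega) (by omega) (by norm_num) (by norm_num)
      (by simp [NExp.cost]) (by simp [NExp.cost]) (fun s' hs i hi j hj hI hJ => by
        simp only [NExp.Fits, NExp.eval, NOp.eval, hI, hJ, hs, and_true]; omega) s₃ hlev₃ hsiz₃).mono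
          le_rfl ?_)
    rintro s₄ ⟨hsim₄, hv₄⟩
    have hlev₄ : s₄.nat 2 0 0 0 = ℓ + 1 := by rw [hsim₄.nat 2 (by norm_num), hlev₃]
    have hsiz₄ : s₄.nat 2 1 0 0 = h := by rw [hsim₄.nat 2 (by norm_num), hsiz₃]
    refine Does.seq ((load 15 _ _ h h (by omega) (by omega) (by norm_num) (by norm_num)
      (by simp [NExp.cost]) (by simp [NExp.cost]) (fun s' hs i hi j hj hI hJ => by
        simp only [NExp.Fits, NExp.eval, NOp.eval, hI, hJ, hs, and_true]; omega) s₄ hlev₄ hsiz₄).mono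
          le_rfl ?_)
    rintro s₅ ⟨hsim₅, hv₅⟩
    have hlev₅ : s₅.nat 2 0 0 0 = ℓ + 1 := by rw [hsim₅.nat 2 (by norm_num), hlev₄]
    have hsiz₅ : s₅.nat 2 1 0 0 = h := by rw [hsim₅.nat 2 (by norm_num), hsiz₄]
    -- the recursion
    have hs₅ : AtLevel (ℓ + 1) h (fun b => of fun i j => s₅.scal b (ℓ + 1) i j) s₅ :=
      ⟨hlev₅, hsiz₅, fun _ _ _ _ => rfl⟩
    refine Does.seq ((compileList_does hπ hprocs hinv hh hhW h64 hcW blockOps blockOps_valid hs₅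
      (blockOps_wp _)).mono (by rw [blockOps_time]) ?_)
    rintro s₆ ⟨hf₆, σ', hs₆, L, hT⟩
    refine Does.seq (Does.setN ?_ (by simp [NExp.cost]) ?_)
    · simp only [NExp.Fits, NExp.eval, NOp.eval, hs₆.siz]; omega
    have e₇ : NExp.eval s₆.nat (.op .mul siz (.lit 2)) = h + h := by
      simp only [NExp.eval, NOp.eval, hs₆.siz]; omega
    rw [e₇]
    simp only [NExp.eval]
    set s₇ := s₆.put 2 1 (h + h) with hs₇
    have hlev₇ : s₇.nat 2 0 0 0 = ℓ + 1 := by simp [hs₇, Mem.write, hs₆.lev]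
    have hsiz₇ : s₇.nat 2 1 0 0 = h + h := by simp [hs₇, Mem.write]
    -- The size has been doubled back, so array `2` is restored as `Frame` demands.
    have hn₇ : s₇.nat 2 = s.nat 2 := by
      have h6 : s₆.nat 2 = s₁.nat 2 := by
        rw [hf₆.nat 2 (by norm_num) (by norm_num), hsim₅.nat 2 (by norm_num),
          hsim₄.nat 2 (by norm_num), hsim₃.nat 2 (by norm_num), hsim₂.nat 2 (by norm_num)]
      funext i j l
      simp only [hs₇, Mem.write, h6, hs₁]
      by_cases hijl : i = 1 ∧ j = 0 ∧ l = 0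
      · obtain ⟨rfl, rfl, rfl⟩ := hijl
        simp [hsiz]
      · simp [hijl]
    set T : Matrix (Fin (h + h)) (Fin (h + h)) k := (fromBlocks (σ' 38) (σ' 39) (σ' 36)
      (σ' 37)).submatrix finSumFinEquiv.symm finSumFinEquiv.symm with hTdef
    -- The quadrants of the result in the global indices that the copying loop uses.
    have hT11 : ∀ i j : Fin h, extend T i j = σ' 38 i j := fun i j => by
      rw [extend_apply T (i := i) (j := j) (by omega) (by omega), hTdef, submatrix_apply]
      have e1 : (⟨i, by omega⟩ : Fin (h + h)) = Fin.castAdd h i := rfl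
      have e2 : (⟨j, by omega⟩ : Fin (h + h)) = Fin.castAdd h j := rfl
      rw [e1, e2, finSumFinEquiv_symm_apply_castAdd, finSumFinEquiv_symm_apply_castAdd,
        fromBlocks_apply₁₁]
    have hT12 : ∀ i j : Fin h, extend T i (h + j) = σ' 39 i j := fun i j => by
      rw [extend_apply T (i := i) (j := h + j) (by omega) (by omega), hTdef, submatrix_apply]
      have e1 : (⟨i, by omega⟩ : Fin (h + h)) = Fin.castAdd h i := rfl
      have e2 : (⟨h + j, by omega⟩ : Fin (h + h)) = Fin.natAdd h j := rfl
      rw [e1, e2, finSumFinEquiv_symm_apply_castAdd, finSumFinEquiv_symm_apply_natAdd,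
        fromBlocks_apply₁₂]
    have hT21 : ∀ i j : Fin h, extend T (h + i) j = σ' 36 i j := fun i j => by
      rw [extend_apply T (i := h + i) (j := j) (by omega) (by omega), hTdef, submatrix_apply]
      have e1 : (⟨h + i, by omega⟩ : Fin (h + h)) = Fin.natAdd h i := rfl
      have e2 : (⟨j, by omega⟩ : Fin (h + h)) = Fin.castAdd h j := rfl
      rw [e1, e2, finSumFinEquiv_symm_apply_castAdd, finSumFinEquiv_symm_apply_natAdd,
        fromBlocks_apply₂₁]
    have hT22 : ∀ i j : Fin h, extend T (h + i) (h + j) = σ' 37 i j := fun i j => by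
      rw [extend_apply T (i := h + i) (j := h + j) (by omega) (by omega), hTdef, submatrix_apply]
      have e1 : (⟨h + i, by omega⟩ : Fin (h + h)) = Fin.natAdd h i := rfl
      have e2 : (⟨h + j, by omega⟩ : Fin (h + h)) = Fin.natAdd h j := rfl
      rw [e1, e2, finSumFinEquiv_symm_apply_natAdd, finSumFinEquiv_symm_apply_natAdd,
        fromBlocks_apply₂₂]
    have hmat₇ : ∀ b, 12 ≤ b → b < 64 → ∀ s', Sim 11 (ℓ + 1) s₇ s' → ∀ i j : Fin h,
        s'.scal b (ℓ + 1) i j = σ' b i j := by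
      intro b hb hb' s' h' i j
      rw [h'.scal b _ (Or.inl (by omega))]
      exact hs₆.mat b ⟨by omega, hb'⟩ i j
    refine (Does.forIJ (a := 11) (x := ℓ + 1) (val := extend T) (c := 200) (q := 4)
      (N := h + h) hnW (by omega) le_rfl le_rfl
      (by simp [NExp.cost]) (by simp [NExp.cost]) (fun s' h' => ?_)
      fun s' h' i hi j hj hI hJ => ?_).mono (Nat.mul_le_mul_right _ (by norm_num)) ?_
    · have hz' : s'.nat 2 1 0 0 = h + h := by rw [h'.nat 2 (by norm_num)]; exact hsiz₇
      simp only [NExp.Fits, NExp.eval, hz', and_true, and_self]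
      omega
    · have hl' : s'.nat 2 0 0 0 = ℓ + 1 := by rw [h'.nat 2 (by norm_num), hlev₇]
      have hz' : s'.nat 2 1 0 0 = h + h := by rw [h'.nat 2 (by norm_num), hsiz₇]
      have hdiv : (h + h) / 2 = h := by omega
      have h64' := h64
      refine Does.cond (T := 160) ?_ (by simp [BExp.cost, NExp.cost]) ?_ ?_
      · simp only [BExp.Fits, NExp.Fits, NExp.eval, NOp.eval, hz', hdiv]; omega
      · intro hIh
        simp only [BExp.Holds, NExp.eval, NOp.eval, hz', hdiv, hI] at hIh
        refine Does.cond (T := 120) ?_ (by simp [BExp.cost, NExp.cost]) ?_ ?_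
        · simp only [BExp.Fits, NExp.Fits, NExp.eval, NOp.eval, hz', hdiv]; omega
        · intro hJh
          simp only [BExp.Holds, NExp.eval, NOp.eval, hz', hdiv, hJ] at hJh
          refine Does.setK ?_ (by simp [KExp.cost, NExp.cost]) ?_
          · simp only [KExp.Fits, NExp.Fits]; omega
          · simp only [NExp.eval, KExp.eval, hI, hJ, hl']
            have e1 := hT11 ⟨i, hIh⟩ ⟨j, hJh⟩
            have e2 := hmat₇ 38 (by norm_num) (by norm_num) s' h' ⟨i, hIh⟩ ⟨j, hJh⟩
            simp only at e1 e2
            rw [e1, e2]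
        · intro hJh
          simp only [BExp.Holds, NExp.eval, NOp.eval, hz', hdiv, hJ] at hJh
          refine Does.setK ?_ (by simp [KExp.cost, NExp.cost]) ?_
          · simp only [KExp.Fits, NExp.Fits, NExp.eval, NOp.eval, hz', hdiv, hJ]; omega
          · simp only [NExp.eval, NOp.eval, KExp.eval, hI, hJ, hl', hz', hdiv]
            have e1 := hT12 ⟨i, hIh⟩ ⟨j - h, by omega⟩
            have e2 := hmat₇ 39 (by norm_num) (by norm_num) s' h' ⟨i, hIh⟩ ⟨j - h, by omega⟩
            simp only [show h + (j - h) = j by omega] at e1 e2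
            rw [e1, e2]
      · intro hIh
        simp only [BExp.Holds, NExp.eval, NOp.eval, hz', hdiv, hI] at hIh
        refine Does.cond (T := 120) ?_ (by simp [BExp.cost, NExp.cost]) ?_ ?_
        · simp only [BExp.Fits, NExp.Fits, NExp.eval, NOp.eval, hz', hdiv]; omega
        · intro hJh
          simp only [BExp.Holds, NExp.eval, NOp.eval, hz', hdiv, hJ] at hJh
          refine Does.setK ?_ (by simp [KExp.cost, NExp.cost]) ?_
          · simp only [KExp.Fits, NExp.Fits, NExp.eval, NOp.eval, hz', hdiv, hI]; omega
          · simp only [NExp.eval, NOp.eval, KExp.eval, hI, hJ, hl', hz', hdiv]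
            have e1 := hT21 ⟨i - h, by omega⟩ ⟨j, hJh⟩
            have e2 := hmat₇ 36 (by norm_num) (by norm_num) s' h' ⟨i - h, by omega⟩ ⟨j, hJh⟩
            simp only [show h + (i - h) = i by omega] at e1 e2
            rw [e1, e2]
        · intro hJh
          simp only [BExp.Holds, NExp.eval, NOp.eval, hz', hdiv, hJ] at hJh
          refine Does.setK ?_ (by simp [KExp.cost, NExp.cost]) ?_
          · simp only [KExp.Fits, NExp.Fits, NExp.eval, NOp.eval, hz', hdiv, hI, hJ]; omega
          · simp only [NExp.eval, NOp.eval, KExp.eval, hI, hJ, hl', hz', hdiv]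
            have e1 := hT22 ⟨i - h, by omega⟩ ⟨j - h, by omega⟩
            have e2 := hmat₇ 37 (by norm_num) (by norm_num) s' h' ⟨i - h, by omega⟩
              ⟨j - h, by omega⟩
            simp only [show h + (i - h) = i by omega, show h + (j - h) = j by omega] at e1 e2
            rw [e1, e2]
    rintro s₈ ⟨hsim₈, hv₈⟩
    have hf : Frame (ℓ + 1) s₁ s₆ :=
      (hsim₂.frame (by norm_num) (Or.inl le_rfl)).trans
        ((hsim₃.frame (by norm_num) (Or.inl le_rfl)).trans
        ((hsim₄.frame (by norm_num) (Or.inl le_rfl)).trans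
        ((hsim₅.frame (by norm_num) (Or.inl le_rfl)).trans hf₆)))
    refine ⟨?_, _, T, isHermInv_of_blocks hT ?_ hTdef, fun i j => ?_⟩
    · refine Frame.trans (s' := s₇) ⟨fun b hb hb3 => ?_, fun b hb => hf.elt b hb,
        fun b hb y hy => hf.scal b hb y hy⟩ (hsim₈.frame (by norm_num) (Or.inl le_rfl))
      by_cases hb2 : b = 2
      · rw [hb2, hn₇]
      · rw [hs₇, State.put_nat_of_ne _ _ _ hb2, hf.nat b hb hb3, hs₁,
          State.put_nat_of_ne _ _ _ hb2]
    · have e12 : ∀ i j : Fin h, s₅.scal 12 (ℓ + 1) i j = s.scal 10 (ℓ + 1) i j := fun i j => by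
        rw [hsim₅.scal _ _ (Or.inl (by norm_num)), hsim₄.scal _ _ (Or.inl (by norm_num)),
          hsim₃.scal _ _ (Or.inl (by norm_num)), hv₂ i i.2 j j.2]
        rfl
      have e13 : ∀ i j : Fin h, s₅.scal 13 (ℓ + 1) i j = s.scal 10 (ℓ + 1) i (j + h) :=
        fun i j => by
        rw [hsim₅.scal _ _ (Or.inl (by norm_num)), hsim₄.scal _ _ (Or.inl (by norm_num)),
          hv₃ i i.2 j j.2, hsim₂.scal _ _ (Or.inl (by norm_num))]
        rfl
      have e14 : ∀ i j : Fin h, s₅.scal 14 (ℓ + 1) i j = s.scal 10 (ℓ + 1) (i + h) j :=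
        fun i j => by
        rw [hsim₅.scal _ _ (Or.inl (by norm_num)), hv₄ i i.2 j j.2,
          hsim₃.scal _ _ (Or.inl (by norm_num)), hsim₂.scal _ _ (Or.inl (by norm_num))]
        rfl
      have e15 : ∀ i j : Fin h, s₅.scal 15 (ℓ + 1) i j = s.scal 10 (ℓ + 1) (i + h) (j + h) :=
        fun i j => by
        rw [hv₅ i i.2 j j.2, hsim₄.scal _ _ (Or.inl (by norm_num)),
          hsim₃.scal _ _ (Or.inl (by norm_num)), hsim₂.scal _ _ (Or.inl (by norm_num))]
      ext i j
      refine Fin.addCases (fun i => ?_) (fun i => ?_) i <;>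
        refine Fin.addCases (fun j => ?_) (fun j => ?_) j
      · simp only [submatrix_apply, of_apply, finSumFinEquiv_symm_apply_castAdd, fromBlocks_apply₁₁,
          e12, Fin.val_castAdd]
      · simp only [submatrix_apply, of_apply, finSumFinEquiv_symm_apply_castAdd,
          finSumFinEquiv_symm_apply_natAdd, fromBlocks_apply₁₂, e13, Fin.val_castAdd,
          Fin.val_natAdd, add_comm]
      · simp only [submatrix_apply, of_apply, finSumFinEquiv_symm_apply_castAdd,
          finSumFinEquiv_symm_apply_natAdd, fromBlocks_apply₂₁, e14, Fin.val_castAdd,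
          Fin.val_natAdd, add_comm]
      · simp only [submatrix_apply, of_apply, finSumFinEquiv_symm_apply_natAdd,
          fromBlocks_apply₂₂, e15, Fin.val_natAdd, add_comm]
    · rw [hv₈ i i.2 j j.2, extend_apply _ i.2 j.2]

end Recursion

/-! ## The time bound of the recursion -/

/-- With `x = 2 ^ ω` the overhead at level `ℓ` is at most `a * x ^ ℓ`, because `(2 ^ ℓ) ^ 2 = 4 ^ ℓ
≤ x ^ ℓ`. The induction step needs `4 * E + a ≤ E * x`, which holds for `E = 100 + a / (x - 4)`;
this is where `2 < ω` enters. The summand `100` covers the start of the induction. -/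
theorem invTime_le {τ : ℕ → ℕ} {ω C₀ : ℝ} (hω : 2 < ω) (hC₀ : 0 ≤ C₀)
    (hτ : ∀ n, 0 < n → (τ n : ℝ) ≤ C₀ * (n : ℝ) ^ ω) :
    ∃ C : ℝ, 0 ≤ C ∧ ∀ ℓ, (invTime τ ℓ : ℝ) ≤ C * ((2 ^ ℓ : ℕ) : ℝ) ^ ω := by
  have hpow : ∀ ℓ : ℕ, ((2 ^ ℓ : ℕ) : ℝ) ^ ω = ((2 : ℝ) ^ ω) ^ ℓ := by
    intro ℓ
    push_cast
    rw [← Real.rpow_natCast, ← Real.rpow_natCast, ← Real.rpow_mul (by norm_num),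
      ← Real.rpow_mul (by norm_num), mul_comm]
  have hx : (4 : ℝ) < (2 : ℝ) ^ ω := by
    calc (4 : ℝ) = (2 : ℝ) ^ (2 : ℝ) := by norm_num
      _ < (2 : ℝ) ^ ω := Real.rpow_lt_rpow_of_exponent_lt (by norm_num) hω
  set x := (2 : ℝ) ^ ω with hxdef
  set a := 20 * C₀ + 20000 with ha
  have ha0 : 0 ≤ a := by positivity
  set E := 100 + a / (x - 4) with hE
  have hE0 : 0 ≤ a / (x - 4) := div_nonneg ha0 (by linarith)
  have hEx : a ≤ E * (x - 4) := by
    rw [hE, add_mul, div_mul_cancel₀ _ (by linarith)]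
    nlinarith
  refine ⟨E, by linarith, fun ℓ => ?_⟩
  rw [hpow]
  induction ℓ with
  | zero => simp [invTime]; linarith
  | succ ℓ ih =>
    have h1 : (τ (2 ^ ℓ) : ℝ) ≤ C₀ * x ^ ℓ := by
      have := hτ (2 ^ ℓ) (by positivity)
      rwa [hpow] at this
    have h2 : (((2 ^ ℓ) ^ 2 : ℕ) : ℝ) ≤ x ^ ℓ := by
      rw [← pow_mul, mul_comm, pow_mul]
      push_cast
      exact pow_le_pow_left₀ (by norm_num) (by linarith) ℓ
    have h3 : 0 ≤ x ^ ℓ := by positivity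
    have h4 : a * x ^ ℓ ≤ E * (x - 4) * x ^ ℓ := mul_le_mul_of_nonneg_right hEx h3
    have h5 : ((invTime τ (ℓ + 1) : ℕ) : ℝ)
        = 4 * invTime τ ℓ + 20 * τ (2 ^ ℓ) + 20000 * (((2 ^ ℓ) ^ 2 : ℕ) : ℝ) := by
      simp only [invTime]; push_cast; ring
    rw [h5, pow_succ x]
    rw [ha] at h4
    linarith

/-- Running times are natural numbers, so the real bound can be replaced by its floor. The constant
is made nonnegative, and `τ` is chosen before the poset `Q`. -/
theorem IsMatMulExponent.mulsIn {k : Type u} [Field k] {ω : ℝ}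
    (h : IsMatMulExponent.{u, v} k ω) :
    ∃ (π : Program k) (c : ℕ) (τ : ℕ → ℕ) (C₀ : ℝ), 0 ≤ C₀ ∧
      (∀ n, (τ n : ℝ) ≤ C₀ * (n : ℝ) ^ ω) ∧
      ∀ (Q : Type v) [PartialOrder Q], MulsIn π c τ Q := by
  obtain ⟨π, c, C, hπ⟩ := h
  refine ⟨π, c, fun n => ⌊max C 0 * (n : ℝ) ^ ω⌋₊, max C 0, le_max_right _ _,
    fun n => Nat.floor_le (by positivity), fun Q _ n A B s hn h0 hA hB => ?_⟩
  obtain ⟨t, s', hr, ht, hs⟩ := hπ Q n A B s hn h0 hA hB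
  refine ⟨t, s', hr, Nat.le_floor (ht.trans ?_), hs⟩
  exact mul_le_mul_of_nonneg_right (le_max_left _ _) (by positivity)

/-! ## Coordinates in free modules -/

section Comb

variable {k : Type u} [Field k] {Q : Type v} [PartialOrder Q]
variable {X Y : Q ⥤ ModuleCat.{w} k} {n m : ℕ}

/-- The vector `x` is supported on the basis elements of grade at most `q`. -/
def Supp (gr : Fin n → Q) (q : Q) (x : Fin n → k) : Prop := ∀ j, ¬ gr j ≤ q → x j = 0

/-- `GradedBasis.comb` as a linear map. -/
noncomputable def GradedBasis.combLin (B : GradedBasis X n) (q : Q) : (Fin n → k) →ₗ[k] X.obj q where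
  toFun := B.comb q
  map_add' x y := by
    simp only [comb, ← Finset.sum_add_distrib]
    refine Finset.sum_congr rfl fun j _ => ?_
    split_ifs <;> simp [add_smul]
  map_smul' c x := by
    simp only [comb, Finset.smul_sum, RingHom.id_apply]
    refine Finset.sum_congr rfl fun j _ => ?_
    split_ifs <;> simp [mul_smul]

theorem GradedBasis.combLin_apply (B : GradedBasis X n) (q : Q) (x : Fin n → k) :
    B.combLin q x = B.comb q x := rfl

open Classical in
theorem GradedBasis.comb_eq_sum (B : GradedBasis X n) (q : Q) (x : Fin n → k) :
    B.comb q x = ∑ j : {j : Fin n // B.gr j ≤ q},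
      x j.1 • (X.map (homOfLE j.2)).hom (B.elt j.1) := by
  have h := Finset.sum_subtype (p := fun j => B.gr j ≤ q) (F := inferInstance)
    (Finset.univ.filter fun j => B.gr j ≤ q) (by simp)
    (fun j => if h : B.gr j ≤ q then x j • (X.map (homOfLE h)).hom (B.elt j) else 0)
  rw [comb, ← Finset.sum_filter_of_ne (p := fun j => B.gr j ≤ q), h]
  · exact Finset.sum_congr rfl fun j _ => dif_pos j.2
  · intro j _ hj
    by_contra hn
    exact hj (dif_neg hn)

theorem GradedBasis.comb_injective (B : GradedBasis X n) (q : Q) {x : Fin n → k}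
    (hx : Supp B.gr q x) (h : B.comb q x = 0) : x = 0 := by
  classical
  rw [comb_eq_sum] at h
  have := Fintype.linearIndependent_iff.1 (B.linearIndependent q) (fun j => x j.1) h
  funext j
  by_cases hj : B.gr j ≤ q
  · exact this ⟨j, hj⟩
  · exact hx j hj

theorem GradedBasis.exists_comb (B : GradedBasis X n) (q : Q) (y : X.obj q) :
    ∃ x, Supp B.gr q x ∧ B.comb q x = y := by
  classical
  have hy : y ∈ Submodule.span k (Set.range fun j : {j : Fin n // B.gr j ≤ q} =>
    (X.map (homOfLE j.2)).hom (B.elt j.1)) := by rw [B.span_eq_top]; trivial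
  obtain ⟨c, hc⟩ := (Submodule.mem_span_range_iff_exists_fun k).1 hy
  refine ⟨fun j => if h : B.gr j ≤ q then c ⟨j, h⟩ else 0, fun j hj => dif_neg hj, ?_⟩
  rw [comb_eq_sum, ← hc]
  exact Finset.sum_congr rfl fun j _ => by rw [dif_pos j.2]

/-- Structure maps do not change coordinates: they send images of basis elements to images of the
same elements, and the elements that are new at `q` have coefficient zero. This makes a cycle vector
at `p` also a cycle vector at `q`. -/
theorem GradedBasis.map_comb (B : GradedBasis X n) {p q : Q} (hpq : p ≤ q) {x : Fin n → k}
    (hx : Supp B.gr p x) : (X.map (homOfLE hpq)).hom (B.comb p x) = B.comb q x := by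
  simp only [comb, map_sum]
  refine Finset.sum_congr rfl fun j _ => ?_
  by_cases hj : B.gr j ≤ p
  · rw [dif_pos hj, dif_pos (hj.trans hpq), map_smul]
    congr 1
    rw [← LinearMap.comp_apply, ← ModuleCat.hom_comp, ← X.map_comp]
    rfl
  · rw [dif_neg hj, map_zero]
    split_ifs <;> simp [hx j hj]

/-- By naturality, `f (b j)` is carried from the grade of `b j` to `q`, so one and the same matrix
`F` describes `f` at every grade. -/
theorem IsMatrixOf.app_comb {B : GradedBasis X n} {B' : GradedBasis Y m} {f : X ⟶ Y}
    {F : Matrix (Fin m) (Fin n) k} (h : IsMatrixOf B B' f F) (q : Q) {x : Fin n → k}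
    (hx : Supp B.gr q x) : (f.app q).hom (B.comb q x) = B'.comb q (F.mulVec x) := by
  have : F.mulVec x = ∑ j, x j • fun i => F i j := by
    funext i
    simp [Matrix.mulVec, dotProduct, mul_comm]
  rw [this, ← B'.combLin_apply, map_sum, GradedBasis.comb, map_sum]
  refine Finset.sum_congr rfl fun j _ => ?_
  by_cases hj : B.gr j ≤ q
  · rw [dif_pos hj, map_smul, map_smul, B'.combLin_apply,
      ← B'.map_comb hj (fun i hi => h.eq_zero i j hi), ← h.apply_elt]
    congr 1
    rw [← LinearMap.comp_apply, ← ModuleCat.hom_comp, f.naturality]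
    rfl
  · rw [dif_neg hj, map_zero, hx j hj, zero_smul, map_zero]

theorem IsMatrixOf.supp_mulVec {B : GradedBasis X n} {B' : GradedBasis Y m} {f : X ⟶ Y}
    {F : Matrix (Fin m) (Fin n) k} (h : IsMatrixOf B B' f F) (q : Q) {x : Fin n → k}
    (hx : Supp B.gr q x) : Supp B'.gr q (F.mulVec x) := by
  intro i hi
  simp only [Matrix.mulVec, dotProduct]
  refine Finset.sum_eq_zero fun j _ => ?_
  by_cases hj : B.gr j ≤ q
  · rw [h.eq_zero i j fun hij => hi (hij.trans hj), zero_mul]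
  · rw [hx j hj, mul_zero]

end Comb

/-! ## Homology classes -/

section Classes

variable {k : Type u} [Field k] {Q : Type v} [PartialOrder Q]
  (S : ShortComplex (Q ⥤ ModuleCat.{w} k))

/-- Evaluation at `q`. -/
abbrev evalAt (q : Q) : (Q ⥤ ModuleCat.{w} k) ⥤ ModuleCat.{w} k := (evaluation Q _).obj q

/-- Evaluation at `q` preserves monomorphisms; here and below it is also exact, so cycles and
homology can be handled pointwise in vector spaces. -/
theorem iCycles_injective (q : Q) : Function.Injective (S.iCycles.app q).hom := by
  have : Mono ((evalAt q).map S.iCycles) := inferInstance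
  exact (ModuleCat.mono_iff_injective _).1 this

theorem exact_cycles : (ShortComplex.mk S.iCycles S.g (by simp)).Exact := 
  ShortComplex.exact_of_f_is_kernel _ S.cyclesIsKernel

theorem exact_homology : (ShortComplex.mk S.toCycles S.homologyπ (by simp)).Exact := 
  ShortComplex.exact_of_g_is_cokernel _ S.homologyIsCokernel

theorem iCycles_range (q : Q) (y : S.X₂.obj q) :
    (∃ z, (S.iCycles.app q).hom z = y) ↔ (S.g.app q).hom y = 0 := by
  have h := (ShortComplex.moduleCat_exact_iff _).1 ((exact_cycles S).map (evalAt q))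
  constructor
  · rintro ⟨z, rfl⟩
    rw [← LinearMap.comp_apply, ← ModuleCat.hom_comp, ← NatTrans.comp_app, S.iCycles_g]
    rfl
  · intro hy
    exact h y hy

theorem homologyπ_surjective (q : Q) : Function.Surjective (S.homologyπ.app q).hom := by
  have : Epi ((evalAt q).map S.homologyπ) := inferInstance
  exact (ModuleCat.epi_iff_surjective _).1 this

theorem homologyπ_eq_zero (q : Q) (z : S.cycles.obj q) :
    (S.homologyπ.app q).hom z = 0 ↔ ∃ x, (S.f.app q).hom x = (S.iCycles.app q).hom z := by
  have h := (ShortComplex.moduleCat_exact_iff _).1 ((exact_homology S).map (evalAt q))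
  have hf : ∀ x, (S.iCycles.app q).hom ((S.toCycles.app q).hom x) = (S.f.app q).hom x := by
    intro x
    rw [← LinearMap.comp_apply, ← ModuleCat.hom_comp, ← NatTrans.comp_app, S.toCycles_i]
  constructor
  · intro hz
    obtain ⟨x, hx⟩ := h z hz
    exact ⟨x, (hf x).symm.trans (congrArg _ hx)⟩
  · rintro ⟨x, hx⟩
    rw [← hf] at hx
    rw [← iCycles_injective S q hx, ← LinearMap.comp_apply, ← ModuleCat.hom_comp,
      ← NatTrans.comp_app, S.toCycles_comp_homologyπ]
    rfl

/-! ### Homology classes in coordinates. -/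

variable {r : ℕ} (D : QrComplex.{u, v, w} k Q r) 

/-- The coordinate vectors of the cycles at `q`. -/
def QrComplex.cyc (q : Q) : Submodule k (Fin D.rankY → k) where
  carrier := {y | Supp D.basisY.gr q y ∧ D.matG.mulVec y = 0}
  add_mem' := fun {x y} hx hy => ⟨fun j hj => by simp [hx.1 j hj, hy.1 j hj], by
    rw [Matrix.mulVec_add, hx.2, hy.2, add_zero]⟩
  zero_mem' := ⟨fun _ _ => rfl, Matrix.mulVec_zero _⟩
  smul_mem' := fun c x hx => ⟨fun j hj => by simp [hx.1 j hj], by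
    rw [Matrix.mulVec_smul, hx.2, smul_zero]⟩

theorem QrComplex.exists_cycle (q : Q) (y : D.cyc q) :
    ∃ z, (D.cx.iCycles.app q).hom z = D.basisY.comb q y := by
  rw [iCycles_range, D.isMatrixOf_g.app_comb q y.2.1, y.2.2, ← GradedBasis.combLin_apply, map_zero]

/-- The homology class of a cycle given by coordinates. -/
noncomputable def QrComplex.cls (q : Q) : D.cyc q →ₗ[k] D.homology.obj q where
  toFun y := (D.cx.homologyπ.app q).hom (D.exists_cycle q y).choose
  map_add' x y := by
    rw [← map_add]
    congr 1
    -- The chosen preimages are unique, hence compatible with the linear structure.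
    apply iCycles_injective D.cx q
    rw [map_add, (D.exists_cycle q _).choose_spec, (D.exists_cycle q _).choose_spec,
      (D.exists_cycle q _).choose_spec]
    exact map_add (D.basisY.combLin q) _ _
  map_smul' c x := by
    rw [RingHom.id_apply, ← map_smul]
    congr 1
    apply iCycles_injective D.cx q
    rw [map_smul, (D.exists_cycle q _).choose_spec, (D.exists_cycle q _).choose_spec]
    exact map_smul (D.basisY.combLin q) _ _

theorem QrComplex.isClassOf_cls (q : Q) (y : D.cyc q) :
    IsClassOf D.cx q (D.basisY.comb q y) (D.cls q y) :=
  ⟨_, (D.exists_cycle q y).choose_spec, rfl⟩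

theorem IsClassOf.unique {S} {q : Q} {y : S.X₂.obj q} {x x' : S.homology.obj q}
    (h : IsClassOf (k := k) S q y x) (h' : IsClassOf S q y x') : x = x' := by
  obtain ⟨z, hz, rfl⟩ := h
  obtain ⟨z', hz', rfl⟩ := h'
  rw [iCycles_injective S q (hz.trans hz'.symm)]

theorem IsClassOf.map {S} {p q : Q} (hpq : p ≤ q) {y : S.X₂.obj p} {x : S.homology.obj p}
    (h : IsClassOf (k := k) S p y x) :
    IsClassOf S q ((S.X₂.map (homOfLE hpq)).hom y) ((S.homology.map (homOfLE hpq)).hom x) := by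
  obtain ⟨z, rfl, rfl⟩ := h
  refine ⟨(S.cycles.map (homOfLE hpq)).hom z, ?_, ?_⟩
  · rw [← LinearMap.comp_apply, ← LinearMap.comp_apply, ← ModuleCat.hom_comp, ← ModuleCat.hom_comp,
      S.iCycles.naturality]
  · rw [← LinearMap.comp_apply, ← LinearMap.comp_apply, ← ModuleCat.hom_comp, ← ModuleCat.hom_comp,
      S.homologyπ.naturality]

theorem QrComplex.cyc_mono {p q : Q} (hpq : p ≤ q) : D.cyc p ≤ D.cyc q :=
  fun _ hy => ⟨fun j hj => hy.1 j fun h => hj (h.trans hpq), hy.2⟩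

/-- Class formation is natural, and by `map_comb` the coordinates of the representing cycle stay the
same. -/
theorem QrComplex.map_cls {p q : Q} (hpq : p ≤ q) (y : D.cyc p) :
    (D.homology.map (homOfLE hpq)).hom (D.cls p y) = D.cls q ⟨y, D.cyc_mono hpq y.2⟩ := by
  have h := (D.isClassOf_cls p y).map hpq
  rw [D.basisY.map_comb hpq y.2.1] at h
  exact h.unique (D.isClassOf_cls q ⟨y, D.cyc_mono hpq y.2⟩)

theorem QrComplex.cls_surjective (q : Q) : Function.Surjective (D.cls q) := by
  intro x
  obtain ⟨z, rfl⟩ := homologyπ_surjective D.cx q x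
  obtain ⟨y, hy, hyz⟩ := D.basisY.exists_comb q ((D.cx.iCycles.app q).hom z)
  have hy0 : D.matG.mulVec y = 0 := by
    apply D.basisZ.comb_injective q (D.isMatrixOf_g.supp_mulVec q hy)
    rw [← D.isMatrixOf_g.app_comb q hy, hyz]
    exact (iCycles_range D.cx q _).1 ⟨z, rfl⟩
  refine ⟨⟨y, hy, hy0⟩, (D.isClassOf_cls q _).unique ⟨z, hyz.symm, rfl⟩⟩

theorem QrComplex.cls_eq_zero (q : Q) (y : D.cyc q) :
    D.cls q y = 0 ↔ ∃ x, Supp D.basisX.gr q x ∧ D.matF.mulVec x = y := by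
  rw [show D.cls q y = (D.cx.homologyπ.app q).hom (D.exists_cycle q y).choose from rfl,
    homologyπ_eq_zero, (D.exists_cycle q y).choose_spec]
  constructor
  · rintro ⟨x', hx'⟩
    obtain ⟨x, hx, rfl⟩ := D.basisX.exists_comb q x'
    refine ⟨x, hx, ?_⟩
    rw [D.isMatrixOf_f.app_comb q hx] at hx'
    have hs := D.isMatrixOf_f.supp_mulVec q hx
    refine sub_eq_zero.1 (D.basisY.comb_injective q (x := D.matF.mulVec x - y)
      (fun j hj => by simp [hs j hj, y.2.1 j hj]) ?_)
    rw [← GradedBasis.combLin_apply, map_sub, GradedBasis.combLin_apply, GradedBasis.combLin_apply,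
      hx', sub_self]
  · rintro ⟨x, hx, hxy⟩
    exact ⟨D.basisX.comb q x, by rw [D.isMatrixOf_f.app_comb q hx, hxy]⟩

end Classes

/-! ## Echelon forms of cycles and boundaries -/

section Echelon

variable {k : Type u} [Field k] {Q : Type v} [PartialOrder Q] {r : ℕ}
  (D : QrComplex.{u, v, w} k Q r)

open Matrix

theorem sum_castLE {M : Type*} [AddCommMonoid M] {n N : ℕ} (h : n ≤ N) (f : Fin N → M)
    (hf : ∀ i : Fin N, n ≤ i.val → f i = 0) : ∑ i, f i = ∑ y : Fin n, f (Fin.castLE h y) := by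
  refine (Finset.sum_of_injOn (Fin.castLE h) (Fin.castLE_injective h).injOn (by simp) ?_
    (fun _ _ => rfl)).symm
  intro i _ hi
  refine hf i (not_lt.1 fun hlt => hi ⟨⟨i, hlt⟩, by simp, rfl⟩)

/-- Extension of a vector by zero. -/
def pad {n : ℕ} (N : ℕ) (x : Fin n → k) : Fin N → k :=
  fun i => if h : i.val < n then x ⟨i, h⟩ else 0

open Classical in
/-- Restriction to the first `n` coordinates, where the coordinates with grade not below `p` are
replaced by zero. -/
noncomputable def cut {n N : ℕ} (h : n ≤ N) (gr : Fin n → Q) (p : Q) (c : Fin N → k) :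
    Fin n → k :=
  fun y => if gr y ≤ p then c (Fin.castLE h y) else 0

theorem supp_cut {n N : ℕ} (h : n ≤ N) (gr : Fin n → Q) (p : Q) (c : Fin N → k) :
    Supp gr p (cut h gr p c) := fun _ hj => if_neg hj

theorem cut_pad {n N : ℕ} (h : n ≤ N) {gr : Fin n → Q} {p : Q} {x : Fin n → k}
    (hx : Supp gr p x) : cut h gr p (pad N x) = x := by
  funext y
  by_cases hy : gr y ≤ p
  · simp [cut, pad, hy]
  · simp [cut, hy, hx y hy]

namespace QrComplex

open Classical in
/-- The rows of this matrix span the graph of `g` at `p`. -/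
noncomputable def cycEntry (p : Q) (i j : ℕ) : k :=
  if h : ∃ hi : i < D.rankY, D.basisY.gr ⟨i, hi⟩ ≤ p then
    if hj : j < D.rankZ then D.matG ⟨j, hj⟩ ⟨i, h.1⟩ else if j = D.rankZ + i then 1 else 0
  else 0

open Classical in
/-- The rows of this matrix span the image of `f` at `p`. -/
noncomputable def bdEntry (p : Q) (i j : ℕ) : k :=
  if h : ∃ hi : i < D.rankX, D.basisX.gr ⟨i, hi⟩ ≤ p then
    if hj : D.rankZ ≤ j ∧ j - D.rankZ < D.rankY then D.matF ⟨j - D.rankZ, hj.2⟩ ⟨i, h.1⟩ else 0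
  else 0

noncomputable def cycMat (N : ℕ) (p : Q) : Matrix (Fin N) (Fin N) k :=
  of fun i j => D.cycEntry p i j

noncomputable def bdMat (N : ℕ) (p : Q) : Matrix (Fin N) (Fin N) k :=
  of fun i j => D.bdEntry p i j

/-- Coordinate vectors in `Y`, shifted by the rank of `Z`. -/
def embed (N : ℕ) : (Fin D.rankY → k) →ₗ[k] (Fin N → k) where
  toFun y j := if h : D.rankZ ≤ j.val ∧ j.val - D.rankZ < D.rankY then y ⟨j.val - D.rankZ, h.2⟩ else 0
  map_add' x y := by
    funext j
    by_cases h : D.rankZ ≤ j.val ∧ j.val - D.rankZ < D.rankY <;> simp [h]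
  map_smul' c x := by
    funext j
    by_cases h : D.rankZ ≤ j.val ∧ j.val - D.rankZ < D.rankY <;> simp [h]

theorem embed_apply (N : ℕ) (y : Fin D.rankY → k) (j : Fin N) : D.embed N y j =
    if h : D.rankZ ≤ j.val ∧ j.val - D.rankZ < D.rankY then y ⟨j.val - D.rankZ, h.2⟩ else 0 := rfl

variable {D} {N : ℕ} {p : Q}

/-- Row combinations run through the graph of `g` at `p`. Rows belonging to grades not below `p`, or
beyond the rank, are zero, so only the cut coefficient vector matters; it reappears as the `Y` part.
-/
theorem cyc_vecMul (hN : D.rankZ + D.rankY ≤ N) (c : Fin N → k) (j : Fin N) :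
    (c ᵥ* D.cycMat N p) j = if hj : j.val < D.rankZ then
      (D.matG *ᵥ cut (by omega) D.basisY.gr p c) ⟨j, hj⟩
      else D.embed N (cut (by omega) D.basisY.gr p c) j := by
  have hYN : D.rankY ≤ N := by omega
  simp only [vecMul, dotProduct, cycMat, of_apply]
  rw [sum_castLE hYN]
  swap
  · intro i hi
    rw [cycEntry, dif_neg (fun h => absurd h.1 (by omega)), mul_zero]
  have he : ∀ y : Fin D.rankY, c (Fin.castLE hYN y) * D.cycEntry p (Fin.castLE hYN y) j
      = cut hYN D.basisY.gr p c y * if hj : j.val < D.rankZ then D.matG ⟨j, hj⟩ y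
        else if j.val = D.rankZ + y then 1 else 0 := by
    intro y
    by_cases hy : D.basisY.gr y ≤ p
    · rw [cycEntry, dif_pos ⟨y.2, hy⟩, cut, if_pos hy]
      rfl
    · rw [cycEntry, dif_neg (by rintro ⟨_, h⟩; exact hy h), cut, if_neg hy, zero_mul, mul_zero]
  simp only [he]
  by_cases hj : j.val < D.rankZ
  · simp only [hj, dif_pos, mulVec, dotProduct]
    exact Finset.sum_congr rfl fun _ _ => mul_comm _ _
  · simp only [hj, dif_neg, not_false_eq_true, embed_apply]
    by_cases h : D.rankZ ≤ j.val ∧ j.val - D.rankZ < D.rankY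
    · rw [dif_pos h, Finset.sum_eq_single ⟨j.val - D.rankZ, h.2⟩]
      · rw [if_pos (by simp only; omega), mul_one]
      · intro y _ hy
        rw [if_neg (fun h' => hy (by ext; simp only; omega)), mul_zero]
      · simp
    · rw [dif_neg h]
      refine Finset.sum_eq_zero fun y _ => ?_
      rw [if_neg (by omega), mul_zero]

theorem bd_vecMul (hN : D.rankX ≤ N) (c : Fin N → k) :
    c ᵥ* D.bdMat N p = D.embed N (D.matF *ᵥ cut hN D.basisX.gr p c) := by
  funext j
  simp only [vecMul, dotProduct, bdMat, of_apply, embed_apply]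
  rw [sum_castLE hN]
  swap
  · intro i hi
    rw [bdEntry, dif_neg (fun h => absurd h.1 (by omega)), mul_zero]
  have he : ∀ y : Fin D.rankX, c (Fin.castLE hN y) * D.bdEntry p (Fin.castLE hN y) j
      = cut hN D.basisX.gr p c y * if hj : D.rankZ ≤ j.val ∧ j.val - D.rankZ < D.rankY then
        D.matF ⟨j.val - D.rankZ, hj.2⟩ y else 0 := by
    intro y
    by_cases hy : D.basisX.gr y ≤ p
    · rw [bdEntry, dif_pos ⟨y.2, hy⟩, cut, if_pos hy]
      rfl
    · rw [bdEntry, dif_neg (by rintro ⟨_, h⟩; exact hy h), cut, if_neg hy, zero_mul, mul_zero]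
  simp only [he]
  by_cases h : D.rankZ ≤ j.val ∧ j.val - D.rankZ < D.rankY
  · simp only [h, dif_pos, and_self, mulVec, dotProduct]
    exact Finset.sum_congr rfl fun _ _ => mul_comm _ _
  · simp only [h, dif_neg, not_false_eq_true, mul_zero, Finset.sum_const_zero]

theorem mulVec_mem_cyc {x : Fin D.rankX → k} (hx : Supp D.basisX.gr p x) :
    D.matF *ᵥ x ∈ D.cyc p := by
  have hs := D.isMatrixOf_f.supp_mulVec p hx
  refine ⟨hs, D.basisZ.comb_injective p (D.isMatrixOf_g.supp_mulVec p hs) ?_⟩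
  rw [← D.isMatrixOf_g.app_comb p hs, ← D.isMatrixOf_f.app_comb p hx, ← LinearMap.comp_apply,
    ← ModuleCat.hom_comp, ← NatTrans.comp_app, D.cx.zero]
  rfl

/-- The coordinate vector in `Y` from the shifted one. -/
def proj (hN : D.rankZ + D.rankY ≤ N) (v : Fin N → k) : Fin D.rankY → k :=
  fun y => v ⟨D.rankZ + y, by omega⟩

theorem proj_embed (hN : D.rankZ + D.rankY ≤ N) (y : Fin D.rankY → k) :
    proj hN (D.embed N y) = y := by
  funext j
  simp [proj, embed_apply]

variable {L₁ L₂ : Fin N → Prop} {T₁ T₂ : Matrix (Fin N) (Fin N) k}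

/-- By triangularity, row `l` vanishes to the left of column `l`. If `l` is not a column of `Z`, the
whole `Z` part is zero, and a point of the graph of `g` with zero `Z` part is a cycle. -/
theorem exists_embed_row (hN : D.rankZ + D.rankY ≤ N)
    (h₁ : IsHermInv Fin.val L₁ (D.cycMat N p) T₁) {l : Fin N} (hl : D.rankZ ≤ l) :
    ∃ y ∈ D.cyc p, (T₁ * D.cycMat N p) l = D.embed N y := by
  have hrow : ∀ j, (T₁ * D.cycMat N p) l j = (T₁ l ᵥ* D.cycMat N p) j := fun j => by
    rw [mul_apply_eq_vecMul]
  have hG : D.matG *ᵥ cut (by omega) D.basisY.gr p (T₁ l) = 0 := by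
    funext j
    have h := hrow ⟨j, by omega⟩
    rw [cyc_vecMul hN, dif_pos (show (⟨j, by omega⟩ : Fin N).val < D.rankZ from j.2),
      h₁.tri (show (⟨j, _⟩ : Fin N).val < l.val by simp only; omega)] at h
    exact h.symm
  refine ⟨_, ⟨supp_cut _ _ _ _, hG⟩, ?_⟩
  funext j
  rw [hrow, cyc_vecMul hN]
  by_cases hj : j.val < D.rankZ
  · rw [dif_pos hj, hG, embed_apply, dif_neg (by omega)]
    rfl
  · rw [dif_neg hj]

/-- A matrix `A` satisfies `A * (T * A) = A`, so multiplication by its echelon form fixes its row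
space. A cycle `y` is in the row space as the combination with coefficients `y`, its image under `g`
being zero. -/
theorem embed_vecMul_of_mem (hN : D.rankZ + D.rankY ≤ N)
    (h₁ : IsHermInv Fin.val L₁ (D.cycMat N p) T₁) {y : Fin D.rankY → k} (hy : y ∈ D.cyc p) :
    D.embed N y ᵥ* (T₁ * D.cycMat N p) = D.embed N y := by
  have h : D.embed N y = pad N y ᵥ* D.cycMat N p := by
    funext j
    rw [cyc_vecMul hN, cut_pad _ hy.1, hy.2]
    split_ifs with hj
    · rw [embed_apply, dif_neg (by omega)]
      rfl
    · rfl
  rw [h, vecMul_vecMul, h₁.inner]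

theorem embed_mulVec_vecMul (hN : D.rankX ≤ N)
    (h₂ : IsHermInv Fin.val L₂ (D.bdMat N p) T₂) {x : Fin D.rankX → k}
    (hx : Supp D.basisX.gr p x) :
    D.embed N (D.matF *ᵥ x) ᵥ* (T₂ * D.bdMat N p) = D.embed N (D.matF *ᵥ x) := by
  have h : D.embed N (D.matF *ᵥ x) = pad N x ᵥ* D.bdMat N p := by
    rw [bd_vecMul hN, cut_pad _ hx]
  rw [h, vecMul_vecMul, h₂.inner]

theorem exists_vecMul_eq (hN : D.rankX ≤ N) (v : Fin N → k) :
    ∃ x, Supp D.basisX.gr p x ∧ v ᵥ* (T₂ * D.bdMat N p) = D.embed N (D.matF *ᵥ x) :=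
  ⟨_, supp_cut hN _ _ _, by rw [← vecMul_vecMul, bd_vecMul hN]⟩

/-- Row `l` of the boundary form is a cycle `v` with `v l = 1` and zeros before `l`, and `v * R₁ =
v`. If `l` were no pivot of `R₁`, then entry `l` of `v * R₁` would vanish: summands before `l` by
the zeros of `v`, summand `l` because row `l` of `R₁` is zero, and later ones by triangularity. -/
theorem pivot_of_pivot (hN : D.rankZ + D.rankY ≤ N) (hN' : D.rankX ≤ N)
    (h₁ : IsHermInv Fin.val L₁ (D.cycMat N p) T₁) (h₂ : IsHermInv Fin.val L₂ (D.bdMat N p) T₂)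
    {l : Fin N} (hl : L₂ l) : L₁ l := by
  by_contra hn
  obtain ⟨x, hx, he⟩ := exists_vecMul_eq (D := D) (p := p) (T₂ := T₂) hN' (Pi.single l (1 : k))
  rw [single_one_vecMul] at he
  have hm := embed_vecMul_of_mem hN h₁ (mulVec_mem_cyc hx)
  rw [← he] at hm
  have h1 : (T₂ * D.bdMat N p) l l = 1 := by rw [h₂.col l hl, one_apply_eq]
  have h0 : ((T₂ * D.bdMat N p).row l ᵥ* (T₁ * D.cycMat N p)) l = 0 := by
    simp only [vecMul, dotProduct]
    refine Finset.sum_eq_zero fun i _ => ?_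
    rcases lt_trichotomy i.val l.val with h | h | h
    · rw [show (T₂ * D.bdMat N p).row l i = 0 from h₂.tri h, zero_mul]
    · rw [Fin.ext h, h₁.row_mul hn, mul_zero]
    · rw [h₁.tri h, mul_zero]
  rw [hm] at h0
  exact one_ne_zero (h1.symm.trans h0)

/-- The rows of the echelon form of the cycles whose pivots are not pivots of boundaries represent
a basis of the homology. -/
theorem exists_basis (hN : D.rankZ + D.rankY ≤ N) (hN' : D.rankX ≤ N)
    (h₁ : IsHermInv Fin.val L₁ (D.cycMat N p) T₁) (h₂ : IsHermInv Fin.val L₂ (D.bdMat N p) T₂)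
    {d : ℕ} (s : Fin d → Fin N) (hs : Function.Injective s)
    (hS : ∀ l, (∃ i, s i = l) ↔ D.rankZ ≤ l.val ∧ L₁ l ∧ ¬ L₂ l) :
    ∃ b : Module.Basis (Fin d) k (D.homology.obj p),
      (∀ i, ∃ y : D.cyc p, (T₁ * D.cycMat N p) (s i) = D.embed N y ∧ b i = D.cls p y) ∧
      ∀ (z : D.cyc p) (i), b.repr (D.cls p z) i
        = (D.embed N z - D.embed N z ᵥ* (T₂ * D.bdMat N p)) (s i) := by
  have hL := fun l => pivot_of_pivot hN hN' h₁ h₂ (l := l)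
  have col₁ := h₁.col
  have row₁ := fun l hl => h₁.row_mul (l := l) hl (D.cycMat N p)
  have col₂ := h₂.col
  have row₂ := fun l hl => h₂.row_mul (l := l) hl (D.bdMat N p)
  have hemb := fun l => exists_embed_row hN h₁ (l := l)
  have hvec₁ := fun y => embed_vecMul_of_mem hN h₁ (y := y)
  have hvec₂ := fun x => embed_mulVec_vecMul hN' h₂ (x := x)
  have hex := exists_vecMul_eq (D := D) (p := p) (T₂ := T₂) hN'
  -- Only the collected properties of the two echelon forms are needed from here on.
  generalize T₁ * D.cycMat N p = R₁ at *
  generalize T₂ * D.bdMat N p = R₂ at *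
  have hs' : ∀ i, D.rankZ ≤ (s i).val ∧ L₁ (s i) ∧ ¬ L₂ (s i) := fun i => (hS _).1 ⟨i, rfl⟩
  choose y hyc hy using fun i => hemb _ (hs' i).1
  set b : Fin d → D.homology.obj p := fun i => D.cls p ⟨y i, hyc i⟩ with hb
  -- The vector `w = z - z R₂` differs from `z` by a boundary and vanishes at the pivots of `R₂` and
  -- in the `Z` part. In `w = w R₁ = ∑ w l • R₁ l` the rows without pivot are zero, so only the
  -- selected positions contribute.
  have key : ∀ z : D.cyc p, D.cls p z
      = ∑ i, (D.embed N z - D.embed N z ᵥ* R₂) (s i) • b i := by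
    intro z
    obtain ⟨x, hx, he⟩ := hex (D.embed N z)
    set w := D.embed N z - D.embed N z ᵥ* R₂ with hw
    set z' : D.cyc p := z - ⟨_, mulVec_mem_cyc hx⟩ with hz'
    have hwz : w = D.embed N z' := by
      rw [hw, he, hz', Submodule.coe_sub, map_sub]
    have hwR : w ᵥ* R₁ = w := by rw [hwz, hvec₁ _ z'.2]
    have hwL : ∀ l, L₂ l → w l = 0 := by
      intro l hl
      have : (D.embed N z ᵥ* R₂) l = D.embed N z l := by
        have h : (D.embed N z ᵥ* R₂) l = (D.embed N z ᵥ* (1 : Matrix (Fin N) (Fin N) k)) l := by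
          simp only [vecMul, dotProduct, col₂ l hl]
        rw [h, vecMul_one]
      rw [hw, Pi.sub_apply, this, sub_self]
    have hw0 : ∀ l : Fin N, l.val < D.rankZ → w l = 0 := by
      intro l hl
      rw [hwz, embed_apply, dif_neg (by omega)]
    have hsum : w = ∑ i, w (s i) • R₁ (s i) := by
      conv_lhs => rw [← hwR]
      funext j
      rw [Finset.sum_apply]
      simp only [vecMul, dotProduct, Pi.smul_apply, smul_eq_mul]
      refine (Finset.sum_of_injOn s hs.injOn (by simp) ?_ (fun _ _ => rfl)).symm
      intro l _ hl
      have hl' : ¬ (D.rankZ ≤ l.val ∧ L₁ l ∧ ¬ L₂ l) := fun h => hl (by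
        obtain ⟨i, rfl⟩ := (hS l).2 h
        exact ⟨i, by simp, rfl⟩)
      by_cases h1 : D.rankZ ≤ l.val
      · by_cases h2 : L₂ l
        · rw [hwL l h2, zero_mul]
        · have h3 : ¬ L₁ l := fun h3 => hl' ⟨h1, h3, h2⟩
          rw [row₁ l h3, mul_zero]
      · rw [hw0 l (by omega), zero_mul]
    have hzsum : z' = ∑ i, w (s i) • (⟨y i, hyc i⟩ : D.cyc p) := by
      apply Subtype.ext
      have h : D.embed N z' = D.embed N (∑ i, w (s i) • y i) := by
        rw [← hwz, map_sum]
        conv_lhs => rw [hsum]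
        exact Finset.sum_congr rfl fun i _ => by rw [hy, map_smul]
      rw [← proj_embed hN (z' : Fin D.rankY → k), h, proj_embed]
      simp
    have hcls : D.cls p z = D.cls p z' := by
      rw [hz', map_sub, (D.cls_eq_zero p ⟨_, mulVec_mem_cyc hx⟩).2 ⟨x, hx, rfl⟩, sub_zero]
    rw [hcls, hzsum, map_sum]
    simp only [map_smul, hb]
  -- If the combination `v` of the selected rows is a boundary, then `v R₂ = v`. At pivots of `R₂`,
  -- which are unselected pivots of `R₁`, the vector `v` vanishes, and the other rows of `R₂` are
  -- zero; so `v = 0`. Its entry at the position `s j` is the coefficient `c j`.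
  have hli : LinearIndependent k b := by
    rw [Fintype.linearIndependent_iff]
    intro c hc j
    have h0 : D.cls p (∑ i, c i • (⟨y i, hyc i⟩ : D.cyc p)) = 0 := by
      rw [map_sum]
      simpa only [map_smul, hb] using hc
    obtain ⟨x, hx, hxe⟩ := (D.cls_eq_zero p _).1 h0
    have hv : D.embed N (D.matF *ᵥ x) = ∑ i, c i • R₁ (s i) := by
      rw [hxe, Submodule.coe_sum, map_sum]
      exact Finset.sum_congr rfl fun i _ => by rw [hy, Submodule.coe_smul, map_smul]
    have hvR := hvec₂ x hx
    rw [hv] at hvR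
    have hcol : ∀ l, L₁ l → ∀ i, R₁ (s i) l = if s i = l then 1 else 0 := fun l hl i => by
      rw [col₁ l hl, one_apply]
    have hz : (∑ i, c i • R₁ (s i)) ᵥ* R₂ = 0 := by
      funext m
      simp only [vecMul, dotProduct, Pi.zero_apply]
      refine Finset.sum_eq_zero fun l _ => ?_
      by_cases hl : L₂ l
      · have hl₁ := hL l hl
        rw [Finset.sum_apply, Finset.sum_eq_zero, zero_mul]
        intro i _
        rw [Pi.smul_apply, hcol l hl₁, if_neg, smul_zero]
        rintro rfl
        exact (hs' i).2.2 hl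
      · rw [row₂ l hl, mul_zero]
    rw [hvR] at hz
    have := congrFun hz (s j)
    rw [Finset.sum_apply, Finset.sum_eq_single j] at this
    · simpa [hcol _ (hs' j).2.1] using this
    · intro i _ hij
      rw [Pi.smul_apply, hcol _ (hs' j).2.1, if_neg (fun h => hij (hs h)), smul_zero]
    · simp
  have hsp : ⊤ ≤ Submodule.span k (Set.range b) := by
    intro x _
    obtain ⟨z, rfl⟩ := D.cls_surjective p x
    rw [key]
    exact Submodule.sum_mem _ fun i _ => Submodule.smul_mem _ _ (Submodule.subset_span ⟨i, rfl⟩)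
  refine ⟨Module.Basis.mk hli hsp, fun i => ⟨⟨y i, hyc i⟩, hy i, by rw [Module.Basis.mk_apply]⟩,
    fun z i => ?_⟩
  have := (Module.Basis.mk hli hsp).repr_sum_self
    fun i => (D.embed N z - D.embed N z ᵥ* R₂) (s i)
  simp only [Module.Basis.mk_apply] at this
  rw [key]
  exact congrFun this i

end QrComplex

end Echelon

/-! ## The matrix representation -/

section Representation

variable {k : Type u} [Field k] {Q : Type v} [PartialOrder Q] {r : ℕ}
  (D : QrComplex.{u, v, w} k Q r)

open Matrix

open Classical in
/-- The echelon form of a matrix (zero if there is none). -/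
noncomputable def ech {N : ℕ} (A : Matrix (Fin N) (Fin N) k) : Matrix (Fin N) (Fin N) k :=
  if h : ∃ L T, IsHermInv Fin.val L A T then h.choose_spec.choose * A else 0

/-- Uniqueness identifies the form found by the program, whatever its inner inverse and pivot set,
with a matrix depending on `A` only. Thus all relations involving `p` use the same basis at `p`. -/
theorem IsHermInv.eq_ech {N : ℕ} {A T : Matrix (Fin N) (Fin N) k} {L : Fin N → Prop}
    (h : IsHermInv Fin.val L A T) : T * A = ech A := by
  have h' : ∃ L T, IsHermInv Fin.val L A T := ⟨L, T, h⟩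
  rw [ech, dif_pos h']
  exact h.unique Fin.val_injective h'.choose_spec.choose_spec

namespace QrComplex

/-- The position `l` carries an element of the basis of the homology at `p`. -/
def IsPos (N : ℕ) (p : Q) (l : ℕ) : Prop :=
  D.rankZ ≤ l ∧ extend (ech (D.cycMat N p)) l l ≠ 0 ∧ extend (ech (D.bdMat N p)) l l = 0

theorem IsPos.lt {D : QrComplex.{u, v, w} k Q r} {N : ℕ} {p : Q} {l : ℕ} (h : D.IsPos N p l) :
    l < N := by
  by_contra hn
  exact h.2.1 (dif_neg fun h => hn h.1)

open Classical in
/-- The number of positions less than `l` which carry a basis element. -/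
noncomputable def num (N : ℕ) (p : Q) (l : ℕ) : ℕ := Nat.count (D.IsPos N p) l

theorem num_succ (N : ℕ) (p : Q) (l : ℕ) [Decidable (D.IsPos N p l)] :
    D.num N p (l + 1) = D.num N p l + if D.IsPos N p l then 1 else 0 := by
  rw [num, num, Nat.count_succ]
  congr

theorem num_lt {N : ℕ} {p : Q} {l l' : ℕ} (h : l < l') (hl : D.IsPos N p l) :
    D.num N p l < D.num N p l' := by
  classical
  have h1 : D.num N p (l + 1) = D.num N p l + 1 := by rw [num_succ, if_pos hl]
  have h2 : D.num N p (l + 1) ≤ D.num N p l' := Nat.count_monotone _ h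
  omega

theorem num_le (N : ℕ) (p : Q) (l : ℕ) : D.num N p l ≤ l := by
  classical exact Nat.count_le _

theorem num_injective {N : ℕ} {p : Q} {l l' : ℕ} (hl : D.IsPos N p l) (hl' : D.IsPos N p l')
    (h : D.num N p l = D.num N p l') : l = l' := by
  rcases lt_trichotomy l l' with hlt | heq | hlt
  · exact absurd h (D.num_lt hlt hl).ne
  · exact heq
  · exact absurd h (D.num_lt hlt hl').ne'

theorem exists_num_eq {N : ℕ} {p : Q} (n : ℕ) {j : ℕ} (hj : j < D.num N p n) :
    ∃ l, D.IsPos N p l ∧ D.num N p l = j := by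
  classical
  induction n with
  | zero => simp [num] at hj
  | succ n ih =>
    by_cases h : j < D.num N p n
    · exact ih h
    · rw [num_succ] at hj
      split_ifs at hj with hn
      · exact ⟨n, hn, by omega⟩
      · omega

/-- The state contains, for each relation, the dimensions, the matrix and the representing
cycles. -/
structure Output (N : ℕ) (p q : Q) (t : ℕ) (s : State k Q) : Prop where
  dim_source : s.nat 1 0 t 0 = D.num N p N
  dim_target : s.nat 1 1 t 0 = D.num N q N
  matrix : ∀ (i j : Fin N), D.IsPos N q i → D.IsPos N p j →
    s.scal 1 t (D.num N q i) (D.num N p j)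
      = (ech (D.cycMat N p) - ech (D.cycMat N p) * ech (D.bdMat N q)) j i
  basis : ∀ (j l : Fin N) (y : ℕ), y < D.rankY → l.val = D.rankZ + y → D.IsPos N p j →
    s.scal 2 t (D.num N p j) y = ech (D.cycMat N p) j l

variable {D} {N : ℕ}

/-- The basis of `exists_basis` with positions in increasing order: `num` converts a position to its
index. Existence of echelon forms is available because `N` is a power of two. -/
theorem exists_pos_basis {ℓ : ℕ} (hℓ : N = 2 ^ ℓ) (hN : D.rankZ + D.rankY ≤ N)
    (hN' : D.rankX ≤ N) (p : Q) :
    ∃ b : Module.Basis (Fin (D.num N p N)) k (D.homology.obj p),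
      (∀ i : Fin (D.num N p N), ∃ (y : D.cyc p) (l : Fin N), D.IsPos N p l ∧ D.num N p l = i ∧
        ech (D.cycMat N p) l = D.embed N y ∧ b i = D.cls p y) ∧
      ∀ (z : D.cyc p) (i : Fin (D.num N p N)), ∃ l : Fin N, D.IsPos N p l ∧ D.num N p l = i ∧
        b.repr (D.cls p z) i = (D.embed N z - D.embed N z ᵥ* ech (D.bdMat N p)) l := by
  obtain ⟨L₁, T₁, h₁⟩ := exists_isHermInv ℓ N hℓ (D.cycMat N p)
  obtain ⟨L₂, T₂, h₂⟩ := exists_isHermInv ℓ N hℓ (D.bdMat N p)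
  have hex : ∀ i : Fin (D.num N p N), ∃ l : Fin N, D.IsPos N p l ∧ D.num N p l = i := by
    intro i
    obtain ⟨l, hl, hi⟩ := D.exists_num_eq N i.2
    exact ⟨⟨l, hl.lt⟩, hl, hi⟩
  choose s hs hsi using hex
  have hS : ∀ l, (∃ i, s i = l) ↔ D.rankZ ≤ l.val ∧ L₁ l ∧ ¬ L₂ l := by
    intro l
    have hpos : D.IsPos N p l ↔ D.rankZ ≤ l.val ∧ L₁ l ∧ ¬ L₂ l := by
      rw [IsPos, h₁.mem_iff, h₂.mem_iff, h₁.eq_ech, h₂.eq_ech, extend_apply _ l.2 l.2,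
        extend_apply _ l.2 l.2, not_not]
    rw [← hpos]
    constructor
    · rintro ⟨i, rfl⟩
      exact hs i
    · intro hl
      refine ⟨⟨D.num N p l, D.num_lt l.2 hl⟩, Fin.ext (D.num_injective (hs _) hl (hsi _))⟩
  have hinj : Function.Injective s := by
    intro i j hij
    apply Fin.ext
    rw [← hsi i, ← hsi j, hij]
  obtain ⟨b, hb, hr⟩ := exists_basis hN hN' h₁ h₂ s hinj hS
  rw [h₁.eq_ech] at hb
  rw [h₂.eq_ech] at hr
  refine ⟨b, fun i => ?_, fun z i => ⟨s i, hs i, hsi i, hr z i⟩⟩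
  obtain ⟨y, hy, hby⟩ := hb i
  exact ⟨y, s i, hs i, hsi i, hy, hby⟩

/-- The basis at `p` is fixed independently of the relations. The `j`-th basis cycle at `p` is a row
of `ech (D.cycMat N p)`; reading it as a cycle at `q` and reducing by the boundaries at `q` gives
column `j` of the matrix. -/
theorem exists_isOutput {ℓ : ℕ} (hℓ : N = 2 ^ ℓ) (hN : D.rankZ + D.rankY ≤ N)
    (hN' : D.rankX ≤ N) (P : Subposet Q) {m : ℕ} (e : Fin m ≃ P.Relations) (s : State k Q)
    (hs : ∀ t : Fin m, D.Output N (e t).1.1.val (e t).1.2.val t s) :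
    ∃ M : MatrixRep (P.incl ⋙ D.homology), IsOutput D P e M s := by
  choose b hb hr using exists_pos_basis (D := D) hℓ hN hN'
  let M : MatrixRep (P.incl ⋙ D.homology) :=
    { dim := fun p => D.num N p.val N
      basis := fun p => b p.val }
  have hrow : ∀ (p : P.Elem) (j : Fin (M.dim p)), ∃ y : D.cyc p.val,
      (∀ z, s.scal 2 (e.symm ⟨(p, p), le_refl p⟩) j (z : Fin D.rankY) = y.1 z) ∧
        b p.val j = D.cls p.val y := by
    intro p j
    obtain ⟨y, l, hl, hlj, hy, hby⟩ := hb p.val j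
    refine ⟨y, fun z => ?_, hby⟩
    have h := (hs (e.symm ⟨(p, p), le_refl p⟩)).basis l ⟨D.rankZ + z, by omega⟩ z z.2 rfl
    simp only [Equiv.apply_symm_apply] at h
    rw [hlj, hy] at h
    rw [h hl, embed_apply, dif_pos (by simp)]
    simp
  refine ⟨M, fun t => (hs t).dim_source, fun t => (hs t).dim_target, fun t i j => ?_,
    fun p j => ?_, fun p j y hy => ?_⟩
  · obtain ⟨y, l, hl, hlj, hy, hby⟩ := hb (e t).1.1.val j
    have hle : (e t).1.1.val ≤ (e t).1.2.val := P.le_of_rel (e t).2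
    obtain ⟨l', hl', hli, hr'⟩ := hr (e t).1.2.val ⟨y, D.cyc_mono hle y.2⟩ i
    have h := (hs t).matrix l' l hl' hl
    rw [hlj, hli] at h
    rw [h, MatrixRep.matrix, LinearMap.toMatrix_apply]
    have hmap : ((P.incl ⋙ D.homology).map (homOfLE (e t).2)).hom (M.basis (e t).1.1 j)
        = D.cls (e t).1.2.val ⟨y, D.cyc_mono hle y.2⟩ := by
      rw [← D.map_cls hle, ← hby]
      rfl
    rw [hmap]
    refine Eq.trans ?_ hr'.symm
    rw [Matrix.sub_apply, Pi.sub_apply, hy, mul_apply_eq_vecMul, hy]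
  · obtain ⟨y, hy, hby⟩ := hrow p j
    have : (fun z : Fin D.rankY => s.scal 2 (e.symm ⟨(p, p), le_refl p⟩) j z) = y.1 := funext hy
    rw [this]
    change IsClassOf D.cx p.val _ (b p.val j)
    rw [hby]
    exact D.isClassOf_cls p.val y
  · obtain ⟨y', hy', _⟩ := hrow p j
    rw [hy']
    exact y'.2.1 y hy

end QrComplex

end Representation

/-! ## The main program -/

section Main

open Matrix

variable {k : Type u} [Field k]

/-- The number of the current relation. -/
abbrev cT : NExp := cell 2 2

/-- The sum of the ranks. -/
abbrev totalRank : NExp := .op .add (.op .add (cell 0 0) (cell 0 1)) (cell 0 2)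

/-- Find a power of two which is at least the sum of the ranks. -/
def initSize : Stmt k :=
  .seq (setCell 2 0 (.lit 1)) (.seq (setCell 2 1 (.lit 1)) (.loop (.nlt siz totalRank)
    (.seq (setCell 2 1 (.op .mul siz (.lit 2))) (setCell 2 0 (.op .add lev (.lit 1))))))

/-- The grade number `cI` in row `a` is at most the source (`side = 0`) or target (`side = 1`) of
the current relation. -/
abbrev gradeTest (a side : ℕ) : BExp k :=
  .qle ⟨0, .lit a, cI, .lit 0⟩ ⟨1, .lit side, cT, .lit 0⟩

/-- The matrix of `g` is read with its indices exchanged, as the basis of `Y` labels the rows here.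
For a row number beyond the rank the grade test reads an arbitrary cell, but then the first conjunct
already fails. -/
def loadCyc (d side : ℕ) : Stmt k :=
  forIJ siz siz (.cond (.and (.nlt cI (cell 0 1)) (gradeTest 1 side))
    (.cond (.nlt cJ (cell 0 2)) (.setK d lev cI cJ (.get 0 (.lit 1) cJ cI))
      (.cond (.neq cJ (.op .add (cell 0 2) cI)) (.setK d lev cI cJ (.lit 1))
        (.setK d lev cI cJ (.lit 0))))
    (.setK d lev cI cJ (.lit 0)))

/-- Subtraction of words is truncated, hence the test that the column is not in the `Z` part before
its number is reduced by the rank of `Z`. -/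
def loadBd (d side : ℕ) : Stmt k :=
  forIJ siz siz (.cond (.and (.nlt cI (cell 0 0)) (gradeTest 0 side))
    (.cond (.and (.not (.nlt cJ (cell 0 2))) (.nlt (.op .sub cJ (cell 0 2)) (cell 0 1)))
      (.setK d lev cI cJ (.get 0 (.lit 0) (.op .sub cJ (cell 0 2)) cI))
      (.setK d lev cI cJ (.lit 0)))
    (.setK d lev cI cJ (.lit 0)))

/-- Echelon forms `20, 21` at the source, `22, 23` at the target, and the reduced cycles `24`. -/
def mainOps : List MOp :=
  [.inv 16 12, .mul 20 16 12, .inv 17 13, .mul 21 17 13, .inv 18 14, .mul 22 18 14, .inv 19 15,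
    .mul 23 19 15, .sub 24 20 20 23]

/-- The dimension at the source or target. -/
abbrev dimAt (side : ℕ) : NExp := .get 1 (.lit side) cT (.lit 0)

/-- List the positions of the basis elements in array `a`. -/
def buildList (a side R₁ R₂ : ℕ) : Stmt k :=
  .seq (.setN 1 (.lit side) cT (.lit 0) (.lit 0)) (forN 3 0 siz
    (.cond (.and (.not (.nlt cI (cell 0 2))) (.and (.not (.keq (.get R₁ lev cI cI) (.lit 0)))
        (.keq (.get R₂ lev cI cI) (.lit 0))))
      (.seq (.setN a (dimAt side) (.lit 0) (.lit 0) cI)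
        (.setN 1 (.lit side) cT (.lit 0) (.op .add (dimAt side) (.lit 1))))
      .skip))

/-- Array `24` has the basis vectors at the source as rows, so source positions (array `4`) are row
indices and target positions (array `5`) column indices: the output is a transposed submatrix. -/
def writeMatrix : Stmt k :=
  forIJ (dimAt 1) (dimAt 0) (.setK 1 cT cI cJ
    (.get 24 lev (.get 4 cJ (.lit 0) (.lit 0)) (.get 5 cI (.lit 0) (.lit 0))))

def writeBasis : Stmt k :=
  forIJ (dimAt 0) (cell 0 1) (.setK 2 cT cI cJ
    (.get 20 lev (.get 4 cI (.lit 0) (.lit 0)) (.op .add (cell 0 2) cJ)))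

/-- The treatment of one relation. -/
def mainBody (main : Stmt k) (p : ℕ) : Stmt k :=
  .seq (loadCyc 12 0) (.seq (loadBd 13 0) (.seq (loadCyc 14 1) (.seq (loadBd 15 1)
    (.seq (compileList main p mainOps) (.seq (buildList 4 0 20 21) (.seq (buildList 5 1 22 23)
      (.seq writeMatrix writeBasis)))))))

/-- The inversion procedure is appended, so the procedures of `π` keep their numbers and its own
number is their count. -/
def mainProgram (π : Program k) : Program k where
  procs := π.procs.map (Stmt.shift 64) ++ [invProc π.main π.procs.length]
  main := .seq initSize (forN 2 2 (cell 0 3) (mainBody π.main π.procs.length))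

theorem mainOps_valid : ∀ o ∈ mainOps, o.Valid := by decide

theorem mainOps_time (h τ T : ℕ) :
    (mainOps.map (MOp.time h τ T)).sum = 4 * T + 5 * τ + 9 * (600 * h ^ 2) := by
  simp only [mainOps, List.map_cons, List.map_nil, List.sum_cons, List.sum_nil, MOp.time]
  ring

/-- By `IsHermInv.eq_ech` the unspecified inverses and pivot sets disappear. The cycle form at the
target serves only to find the positions there; the coordinates use the boundary form alone. -/
theorem mainOps_wp {h : ℕ} (σ : ℕ → Matrix (Fin h) (Fin h) k) :
    wpList (fun σ' => σ' 20 = ech (σ 12) ∧ σ' 21 = ech (σ 13) ∧ σ' 22 = ech (σ 14) ∧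
      σ' 23 = ech (σ 15) ∧ σ' 24 = ech (σ 12) - ech (σ 12) * ech (σ 15)) mainOps σ := by
  simp only [mainOps, wpList, MOp.wp]
  intro L₁ T₁ h₁ R₁ e₁ L₂ T₂ h₂ R₂ e₂ L₃ T₃ h₃ R₃ e₃ L₄ T₄ h₄ R₄ e₄ U eU
  simp only [ne_eq, Nat.reduceEqDiff, not_false_eq_true,
    Function.update_of_ne, Function.update_self] at *
  rw [h₁.eq_ech] at e₁
  rw [h₂.eq_ech] at e₂
  rw [h₃.eq_ech] at e₃
  rw [h₄.eq_ech] at e₄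
  exact ⟨e₁, e₂, e₃, e₄, by rw [eU, e₁, e₄]⟩

/-! ### Invariants during one relation, and the loading of its matrices. -/

variable {Q : Type v} [PartialOrder Q]

/-- The states agree except for what is changed by the treatment of relation `t`. -/
structure Step (t : ℕ) (s s' : State k Q) : Prop where
  nat_zero : s'.nat 0 = s.nat 0
  nat_one : ∀ i j l, j ≠ t → s'.nat 1 i j l = s.nat 1 i j l
  nat_two : s'.nat 2 = s.nat 2
  elt : ∀ b < 10, s'.elt b = s.elt b
  scal : ∀ b < 10, ∀ y, (b = 0 ∨ y ≠ t) → s'.scal b y = s.scal b y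

omit [Field k] [PartialOrder Q] in
theorem Step.trans {t : ℕ} {s s' s'' : State k Q} (h : Step t s s') (h' : Step t s' s'') :
    Step t s s'' :=
  ⟨h'.nat_zero.trans h.nat_zero, fun i j l hj => (h'.nat_one i j l hj).trans (h.nat_one i j l hj),
    h'.nat_two.trans h.nat_two, fun b hb => (h'.elt b hb).trans (h.elt b hb),
    fun b hb y hy => (h'.scal b hb y hy).trans (h.scal b hb y hy)⟩

omit [Field k] [PartialOrder Q] in
theorem Frame.step {ℓ : ℕ} {s s' : State k Q} (h : Frame ℓ s s') (t : ℕ) : Step t s s' :=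
  ⟨h.nat 0 (by norm_num) (by norm_num), fun i j l _ => by rw [h.nat 1 (by norm_num) (by norm_num)],
    h.nat 2 (by norm_num) (by norm_num), fun b hb => h.elt b (by omega),
    fun b hb y _ => h.scal b (by omega) y (Or.inl hb)⟩

omit [Field k] [PartialOrder Q] in
theorem Sim.step {a t : ℕ} {s s' : State k Q} (h : Sim a t s s') (ha : a ≠ 0) : Step t s s' :=
  ⟨h.nat 0 (by norm_num), fun i j l _ => by rw [h.nat 1 (by norm_num)],
    h.nat 2 (by norm_num), fun b _ => by rw [h.elt],
    fun b _ y hy => h.scal b y (hy.imp_left fun h => by omega)⟩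

variable {r : ℕ} {D : QrComplex.{u, v, w} k Q r} {P : Subposet Q} {m : ℕ} {e : Fin m ≃ P.Relations}

/-- The situation during the treatment of relation `t`. -/
structure Ctx (D : QrComplex.{u, v, w} k Q r) (P : Subposet Q) {m : ℕ} (e : Fin m ≃ P.Relations)
    (ℓ N t : ℕ) (s : State k Q) : Prop where
  input : IsInput D P e s
  lev : s.nat 2 0 0 0 = ℓ
  siz : s.nat 2 1 0 0 = N
  idx : s.nat 2 2 0 0 = t

theorem IsInput.congr {s s' : State k Q} (h : IsInput D P e s) (hn : s'.nat 0 = s.nat 0)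
    (he : ∀ b < 10, s'.elt b = s.elt b) (hs : ∀ y, s'.scal 0 y = s.scal 0 y) :
    IsInput D P e s' := by
  constructor
  · rw [hn, h.rankX]
  · rw [hn, h.rankY]
  · rw [hn, h.rankZ]
  · rw [hn, h.num]
  · intro j; rw [he 0 (by norm_num), h.grX]
  · intro j; rw [he 0 (by norm_num), h.grY]
  · intro j; rw [he 0 (by norm_num), h.grZ]
  · intro i j; rw [hs, h.matF]
  · intro i j; rw [hs, h.matG]
  · intro t; rw [he 1 (by norm_num), h.source]
  · intro t; rw [he 1 (by norm_num), h.target]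

theorem Ctx.step {ℓ N t : ℕ} {s s' : State k Q} (h : Ctx D P e ℓ N t s) (hs : Step t s s') :
    Ctx D P e ℓ N t s' :=
  ⟨h.input.congr hs.nat_zero hs.elt fun y => hs.scal 0 (by norm_num) y (Or.inl rfl),
    by rw [hs.nat_two, h.lev], by rw [hs.nat_two, h.siz], by rw [hs.nat_two, h.idx]⟩

variable {procs : List (Stmt k)} {W : ℕ}

theorem Does.setEntry {a x i j : ℕ} {y : k} {xe : NExp} {ex : KExp k} {s : State k Q} {T : ℕ}
    (h64 : 64 ≤ W) (hx : xe.Fits W s.nat) (hxe : xe.eval s.nat = x) (hI : s.nat 3 0 0 0 = i)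
    (hJ : s.nat 3 1 0 0 = j) (hf : ex.Fits W s.nat) (hy : ex.eval s = y)
    (hT : 1 + xe.cost + 8 + ex.cost ≤ T) :
    Does procs W (.setK a xe cI cJ ex) s T fun s' =>
      s' = { s with scal := s.scal.write a x i j y } := by
  refine Does.setK ⟨hx, ?_, ?_, hf⟩ (by simp only [NExp.cost]; omega) ?_
  · simp only [NExp.Fits]; omega
  · simp only [NExp.Fits]; omega
  · simp only [NExp.eval, hI, hJ, hxe, hy]

theorem loadCyc_does {ℓ N t : ℕ} {s : State k Q} (hs : Ctx D P e ℓ N t s) (h64 : 64 ≤ W)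
    (hN : 1 ≤ N) (hNW : 4 * N < W) {d side : ℕ} (hd : 10 ≤ d)
    (hside : side ≤ 1) {q : Q} (hq : s.elt 1 side t 0 = some q) :
    Does procs W (loadCyc d side) s (400 * N ^ 2) fun s' => Sim d ℓ s s' ∧
      ∀ i < N, ∀ j < N, s'.scal d ℓ i j = D.cycEntry q i j := by
  refine (Does.forIJ (c := 200) (q := 4) (by omega : N < W) hN le_rfl le_rfl (by simp [NExp.cost])
    (by simp [NExp.cost]) (fun s' h' => ?_) fun s' h' i hi j hj hI hJ => ?_).mono
    (Nat.mul_le_mul_right _ (by norm_num)) fun _ h => h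
  all_goals
    have hs' := hs.step ((h'.frame hd (Or.inl le_rfl)).step t)
    have hlev := hs'.lev
    have hsiz := hs'.siz
    have hidx := hs'.idx
    have hY := hs'.input.rankY
    have hZ := hs'.input.rankZ
  · simp only [NExp.Fits, NExp.eval, hsiz, and_true, and_self]
    omega
  have hq' : s'.elt 1 side t 0 = some q := by rw [h'.elt, hq]
  have hset : ∀ (ex : KExp k) (y : k), ex.Fits W s'.nat → ex.eval s' = y → ex.cost ≤ 40 →
      Does procs W (.setK d lev cI cJ ex) s' 60 fun s'' =>
        s'' = { s' with scal := s'.scal.write d ℓ i j y } := fun ex y hf hy hc =>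
    Does.setEntry h64 (lev_fits hlev).1 (lev_fits (W := W) hlev).2 hI hJ hf hy
      (by simp only [NExp.cost]; omega)
  have hcond : BExp.Holds s' (.and (.nlt cI (cell 0 1)) (gradeTest 1 side) : BExp k) ↔
      ∃ hi : i < D.rankY, D.basisY.gr ⟨i, hi⟩ ≤ q := by
    simp only [BExp.Holds, NExp.eval, QExp.eval, hI, hY, hidx, hq', Option.some.injEq]
    constructor
    · rintro ⟨h1, p, q', h2, rfl, h3⟩
      have := hs'.input.grY ⟨i, h1⟩
      rw [this, Option.some.injEq] at h2
      exact ⟨h1, h2 ▸ h3⟩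
    · rintro ⟨h1, h2⟩
      exact ⟨h1, _, q, hs'.input.grY ⟨i, h1⟩, rfl, h2⟩
  refine Does.cond (T := 170) ?_ (by simp [BExp.cost, NExp.cost, QExp.cost]) (fun h => ?_)
    fun h => ?_
  · simp only [BExp.Fits, NExp.Fits, QExp.Fits]; omega
  · have hc := hcond.1 h
    refine Does.cond (T := 140) ?_ (by simp [BExp.cost, NExp.cost]) (fun h2 => ?_) fun h2 => ?_
    · simp only [BExp.Fits, NExp.Fits]; omega
    · simp only [BExp.Holds, NExp.eval, hJ, hZ] at h2
      refine (hset _ _ ?_ ?_ (by simp [KExp.cost, NExp.cost])).mono (by norm_num) fun _ h => h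
      · simp only [KExp.Fits, NExp.Fits]; omega
      · simp only [KExp.eval, NExp.eval, hI, hJ]
        rw [QrComplex.cycEntry, dif_pos hc, dif_pos h2]
        exact hs'.input.matG ⟨j, h2⟩ ⟨i, hc.1⟩
    · simp only [BExp.Holds, NExp.eval, hJ, hZ] at h2
      refine Does.cond (T := 80) ?_ (by simp [BExp.cost, NExp.cost]) (fun h3 => ?_) fun h3 => ?_
      · simp only [BExp.Fits, NExp.Fits, NExp.eval, NOp.eval, hI, hZ]; omega
      · simp only [BExp.Holds, NExp.eval, NOp.eval, hI, hJ, hZ] at h3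
        refine (hset (.lit _) _ trivial ?_ (by simp [KExp.cost])).mono (by norm_num) fun _ h => h
        rw [QrComplex.cycEntry, dif_pos hc, dif_neg h2, if_pos h3]
        rfl
      · simp only [BExp.Holds, NExp.eval, NOp.eval, hI, hJ, hZ] at h3
        refine (hset (.lit _) _ trivial ?_ (by simp [KExp.cost])).mono (by norm_num) fun _ h => h
        rw [QrComplex.cycEntry, dif_pos hc, dif_neg h2, if_neg h3]
        rfl
  · refine (hset (.lit _) _ trivial ?_ (by simp [KExp.cost])).mono (by norm_num) fun _ h => h
    rw [QrComplex.cycEntry, dif_neg (fun h' => h (hcond.2 h'))]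
    rfl

theorem loadBd_does {ℓ N t : ℕ} {s : State k Q} (hs : Ctx D P e ℓ N t s) (h64 : 64 ≤ W)
    (hN : 1 ≤ N) (hNW : 4 * N < W) {d side : ℕ} (hd : 10 ≤ d)
    (hside : side ≤ 1) {q : Q} (hq : s.elt 1 side t 0 = some q) :
    Does procs W (loadBd d side) s (400 * N ^ 2) fun s' => Sim d ℓ s s' ∧
      ∀ i < N, ∀ j < N, s'.scal d ℓ i j = D.bdEntry q i j := by
  refine (Does.forIJ (c := 200) (q := 4) (by omega : N < W) hN le_rfl le_rfl (by simp [NExp.cost])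
    (by simp [NExp.cost]) (fun s' h' => ?_) fun s' h' i hi j hj hI hJ => ?_).mono
    (Nat.mul_le_mul_right _ (by norm_num)) fun _ h => h
  all_goals
    have hs' := hs.step ((h'.frame hd (Or.inl le_rfl)).step t)
    have hlev := hs'.lev
    have hsiz := hs'.siz
    have hidx := hs'.idx
    have hX := hs'.input.rankX
    have hY := hs'.input.rankY
    have hZ := hs'.input.rankZ
  · simp only [NExp.Fits, NExp.eval, hsiz, and_true, and_self]
    omega
  have hq' : s'.elt 1 side t 0 = some q := by rw [h'.elt, hq]
  have hset : ∀ (ex : KExp k) (y : k), ex.Fits W s'.nat → ex.eval s' = y → ex.cost ≤ 40 →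
      Does procs W (.setK d lev cI cJ ex) s' 60 fun s'' =>
        s'' = { s' with scal := s'.scal.write d ℓ i j y } := fun ex y hf hy hc =>
    Does.setEntry h64 (lev_fits hlev).1 (lev_fits (W := W) hlev).2 hI hJ hf hy
      (by simp only [NExp.cost]; omega)
  have hcond : BExp.Holds s' (.and (.nlt cI (cell 0 0)) (gradeTest 0 side) : BExp k) ↔
      ∃ hi : i < D.rankX, D.basisX.gr ⟨i, hi⟩ ≤ q := by
    simp only [BExp.Holds, NExp.eval, QExp.eval, hI, hX, hidx, hq', Option.some.injEq]
    constructor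
    · rintro ⟨h1, p, q', h2, rfl, h3⟩
      have := hs'.input.grX ⟨i, h1⟩
      rw [this, Option.some.injEq] at h2
      exact ⟨h1, h2 ▸ h3⟩
    · rintro ⟨h1, h2⟩
      exact ⟨h1, _, q, hs'.input.grX ⟨i, h1⟩, rfl, h2⟩
  refine Does.cond (T := 170) ?_ (by simp [BExp.cost, NExp.cost, QExp.cost]) (fun h => ?_)
    fun h => ?_
  · simp only [BExp.Fits, NExp.Fits, QExp.Fits]; omega
  · have hc := hcond.1 h
    refine Does.cond (T := 120) ?_ (by simp [BExp.cost, NExp.cost]) (fun h2 => ?_) fun h2 => ?_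
    · simp only [BExp.Fits, NExp.Fits, NExp.eval, NOp.eval, hJ, hZ]; omega
    · simp only [BExp.Holds, NExp.eval, NOp.eval, hJ, hZ, hY, not_lt] at h2
      refine (hset _ _ ?_ ?_ (by simp [KExp.cost, NExp.cost])).mono (by norm_num) fun _ h => h
      · simp only [KExp.Fits, NExp.Fits, NExp.eval, NOp.eval, hJ, hZ]; omega
      · simp only [KExp.eval, NExp.eval, NOp.eval, hI, hJ, hZ]
        rw [QrComplex.bdEntry, dif_pos hc, dif_pos h2]
        exact hs'.input.matF ⟨j - D.rankZ, h2.2⟩ ⟨i, hc.1⟩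
    · simp only [BExp.Holds, NExp.eval, NOp.eval, hJ, hZ, hY, not_lt] at h2
      refine (hset (.lit _) _ trivial ?_ (by simp [KExp.cost])).mono (by norm_num) fun _ h => h
      rw [QrComplex.bdEntry, dif_pos hc, dif_neg h2]
      rfl
  · refine (hset (.lit _) _ trivial ?_ (by simp [KExp.cost])).mono (by norm_num) fun _ h => h
    rw [QrComplex.bdEntry, dif_neg (fun h' => h (hcond.2 h'))]
    rfl

end Main

/-! ### Correctness of the treatment of one relation. -/

section Run

open Matrix

variable {k : Type u} [Field k] {Q : Type v} [PartialOrder Q]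
variable {r : ℕ} {D : QrComplex.{u, v, w} k Q r} {P : Subposet Q} {m : ℕ} {e : Fin m ≃ P.Relations}
variable {procs : List (Stmt k)} {W : ℕ}

/-- Array `a` of the state `s'` lists the positions of the basis elements at `p`, and their number
is stored in array `1`. -/
structure Listed (D : QrComplex.{u, v, w} k Q r) (N : ℕ) (p : Q) (a side t : ℕ)
    (s s' : State k Q) : Prop where
  scal : s'.scal = s.scal
  elt : s'.elt = s.elt
  nat : ∀ b, b ≠ 1 → b ≠ 3 → b ≠ a → s'.nat b = s.nat b
  nat_one : ∀ i j l, (i ≠ side ∨ j ≠ t) → s'.nat 1 i j l = s.nat 1 i j l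
  num : s'.nat 1 side t 0 = D.num N p N
  list : ∀ l, D.IsPos N p l → s'.nat a (D.num N p l) 0 0 = l

theorem Listed.step {N : ℕ} {p : Q} {a side t : ℕ} {s s' : State k Q}
    (h : Listed D N p a side t s s') (ha : 3 < a) : Step t s s' :=
  ⟨h.nat 0 (by norm_num) (by norm_num) (by omega), fun i j l hj => h.nat_one i j l (Or.inr hj),
    h.nat 2 (by norm_num) (by norm_num) (by omega), fun b _ => by rw [h.elt],
    fun b _ y _ => by rw [h.scal]⟩

/-- The dimension cell doubles as the next free index of the list: before position `i` is inspected
it contains `num i`. Since `num` grows strictly at each listed position, no entry is overwritten. -/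
theorem buildList_does {ℓ N t : ℕ} {s : State k Q} (hs : Ctx D P e ℓ N t s) (h64 : 64 ≤ W)
    (hN : 1 ≤ N) (hNW : 4 * N < W) {a side R₁ R₂ : ℕ} (ha : 3 < a)
    (hside : side ≤ 1) {p : Q}
    (h₁ : ∀ l < N, s.scal R₁ ℓ l l = extend (ech (D.cycMat N p)) l l)
    (h₂ : ∀ l < N, s.scal R₂ ℓ l l = extend (ech (D.bdMat N p)) l l) :
    Does procs W (buildList a side R₁ R₂) s (300 * N ^ 2) fun s' =>
      Listed D N p a side t s s' := by
  classical
  have hNN : N ≤ N ^ 2 := Nat.le_self_pow (by norm_num) N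
  refine Does.mono (Does.seq (T₁ := 20) (T₂ := N * (150 + siz.cost + 20) + (siz.cost + 20)) ?_)
    (by simp only [NExp.cost]; omega) fun _ h => h
  refine Does.setN ?_ (by simp [NExp.cost]) ?_
  · simp only [NExp.Fits]; omega
  simp only [NExp.eval, hs.idx]
  refine (Does.forN (procs := procs) (W := W) (n := N) (fun i s' =>
    s'.scal = s.scal ∧ s'.elt = s.elt ∧ (∀ b, b ≠ 1 → b ≠ 3 → b ≠ a → s'.nat b = s.nat b) ∧
    (∀ i j l, (i ≠ side ∨ j ≠ t) → s'.nat 1 i j l = s.nat 1 i j l) ∧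
    s'.nat 1 side t 0 = D.num N p i ∧
    ∀ l < i, D.IsPos N p l → s'.nat a (D.num N p l) 0 0 = l) (by omega) (by omega) ?_ ?_
    ?_).mono le_rfl ?_
  · rintro i _ s' ⟨_, _, h3, _⟩ _
    simp only [NExp.Fits, NExp.eval, h3 2 (by norm_num) (by norm_num) (by omega), hs.siz]
    simp only [and_true]
    omega
  · refine ⟨rfl, rfl, fun b hb1 hb3 _ => ?_, fun i j l hij => ?_, ?_, by simp⟩
    · rw [State.put_nat_of_ne _ _ _ hb3]
      exact Mem.write_of_ne _ _ hb1
    · simp only [Mem.write]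
      rw [if_neg (by omega), if_neg (by omega)]
    · simp [Mem.write, QrComplex.num]
  · rintro i hi s' ⟨hsc, hel, hn, hn1, hnum, hlist⟩ hI
    have hstep : Step t s s' := ⟨hn 0 (by norm_num) (by norm_num) (by omega),
      fun i j l hj => hn1 i j l (Or.inr hj), hn 2 (by norm_num) (by norm_num) (by omega),
      fun b _ => by rw [hel], fun b _ y _ => by rw [hsc]⟩
    have hs' := hs.step hstep
    have hlev := hs'.lev
    have hidx := hs'.idx
    have hZ := hs'.input.rankZ
    have hle := D.num_le N p i
    have hcond : BExp.Holds s' (.and (.not (.nlt cI (cell 0 2)))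
        (.and (.not (.keq (.get R₁ lev cI cI) (.lit 0))) (.keq (.get R₂ lev cI cI) (.lit 0)))) ↔
        D.IsPos N p i := by
      simp only [BExp.Holds, NExp.eval, KExp.eval, hI, hZ, hlev, hsc, h₁ i hi, h₂ i hi, not_lt,
        QrComplex.IsPos, ne_eq]
    refine Does.cond (T := 60) ?_ (by simp [BExp.cost, NExp.cost, KExp.cost]) (fun h => ?_)
      fun h => ?_
    · simp only [BExp.Fits, NExp.Fits, KExp.Fits, and_true]; omega
    · rw [hcond] at h
      refine Does.mono (Does.seq (T₁ := 20) (T₂ := 30) (Does.setN ?_ (by simp [NExp.cost])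
        (Does.setN ?_ (by simp [NExp.cost]) ?_))) (by norm_num) fun _ h => h
      · simp only [NExp.Fits]; omega
      · simp only [NExp.Fits, NExp.eval, NOp.eval, Mem.write_of_ne _ _ (show 2 ≠ a by omega), hidx,
          Mem.write_of_ne _ _ (show 1 ≠ a by omega), hnum]
        omega
      · simp only [NExp.eval, NOp.eval, Mem.write_of_ne _ _ (show 2 ≠ a by omega), hidx,
          Mem.write_of_ne _ _ (show 1 ≠ a by omega), hnum, hI]
        refine ⟨?_, hsc, hel, fun b hb1 hb3 hba => ?_, fun i' j l hij => ?_, ?_, fun l hl hpos => ?_⟩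
        · rw [Mem.write_of_ne _ _ (by norm_num), Mem.write_of_ne _ _ (by omega), hI]
        · rw [Mem.write_of_ne _ _ hb3, ← hn b hb1 hb3 hba]
          exact (Mem.write_of_ne _ _ hb1).trans (Mem.write_of_ne _ _ hba)
        · rw [Mem.write_of_ne _ _ (show 1 ≠ 3 by norm_num), ← hn1 i' j l hij]
          simp only [Mem.write]
          rw [if_neg (by omega), if_neg (by omega)]
        · rw [Mem.write_of_ne _ _ (show 1 ≠ 3 by norm_num), QrComplex.num_succ, if_pos h]
          simp [Mem.write]
        · rw [Mem.write_of_ne _ _ (show a ≠ 3 by omega),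
            Mem.write_of_ne _ _ (show a ≠ 1 by omega)]
          rcases Nat.lt_succ_iff_lt_or_eq.1 hl with hlt | rfl
          · simp only [Mem.write]
            have := D.num_lt hlt hpos
            rw [if_neg (by omega), hlist l hlt hpos]
          · simp [Mem.write]
    · rw [hcond] at h
      refine Does.skip (by norm_num) ⟨hI, hsc, hel, fun b hb1 hb3 hba => ?_, fun i' j l hij => ?_,
        ?_, fun l hl hpos => ?_⟩
      · rw [State.put_nat_of_ne _ _ _ hb3, hn b hb1 hb3 hba]
      · rw [State.put_nat_of_ne _ _ _ (by norm_num), hn1 i' j l hij]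
      · rw [State.put_nat_of_ne _ _ _ (by norm_num), QrComplex.num_succ, if_neg h, hnum, add_zero]
      · rw [State.put_nat_of_ne _ _ _ (by omega)]
        rcases Nat.lt_succ_iff_lt_or_eq.1 hl with hlt | rfl
        · exact hlist l hlt hpos
        · exact absurd hpos h
  · rintro s' ⟨hsc, hel, hn, hn1, hnum, hlist⟩
    exact ⟨hsc, hel, hn, hn1, hnum, fun l hl => hlist l hl.lt hl⟩

theorem writeMatrix_does {ℓ N t : ℕ} {s : State k Q} (hs : Ctx D P e ℓ N t s) (h64 : 64 ≤ W)
    (hN : 1 ≤ N) (hNW : 4 * N < W) {p q : Q} (hp : s.nat 1 0 t 0 = D.num N p N)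
    (hq : s.nat 1 1 t 0 = D.num N q N) :
    Does procs W writeMatrix s (300 * N ^ 2) fun s' => Sim 1 t s s' ∧
      ∀ i < D.num N q N, ∀ j < D.num N p N,
        s'.scal 1 t i j = s.scal 24 ℓ (s.nat 4 j 0 0) (s.nat 5 i 0 0) := by
  refine (Does.forIJ (c := 100) (q := 7) (by omega : N < W) hN (D.num_le N q N) (D.num_le N p N)
    (by simp [NExp.cost]) (by simp [NExp.cost]) (fun s' h' => ?_)
    fun s' h' i hi j hj hI hJ => ?_).mono (Nat.mul_le_mul_right _ (by norm_num)) fun _ h => h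
  all_goals
    have hs' := hs.step (h'.step (by norm_num))
    have hidx := hs'.idx
  · simp only [NExp.Fits, NExp.eval, hidx, h'.nat 1 (by norm_num), hp, hq, and_true]
    omega
  · have hl' := hs'.lev
    refine Does.setEntry h64 ?_ hidx hI hJ ?_ ?_ (by simp [KExp.cost, NExp.cost])
    · simp only [NExp.Fits]; omega
    · simp only [KExp.Fits, NExp.Fits]; omega
    · simp only [KExp.eval, NExp.eval, hI, hJ, hl', h'.nat 4 (by norm_num), h'.nat 5 (by norm_num)]
      rw [h'.scal 24 ℓ (Or.inl (by norm_num))]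

theorem writeBasis_does {ℓ N t : ℕ} {s : State k Q} (hs : Ctx D P e ℓ N t s) (h64 : 64 ≤ W)
    (hN : 1 ≤ N) (hNW : 4 * N < W) (hr : D.rankZ + D.rankY ≤ N) {p : Q}
    (hp : s.nat 1 0 t 0 = D.num N p N) :
    Does procs W writeBasis s (300 * N ^ 2) fun s' => Sim 2 t s s' ∧
      ∀ i < D.num N p N, ∀ j < D.rankY,
        s'.scal 2 t i j = s.scal 20 ℓ (s.nat 4 i 0 0) (D.rankZ + j) := by
  refine (Does.forIJ (c := 100) (q := 7) (by omega : N < W) hN (D.num_le N p N) (by omega)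
    (by simp [NExp.cost]) (by simp [NExp.cost]) (fun s' h' => ?_)
    fun s' h' i hi j hj hI hJ => ?_).mono (Nat.mul_le_mul_right _ (by norm_num)) fun _ h => h
  all_goals
    have hs' := hs.step (h'.step (by norm_num))
    have hidx := hs'.idx
    have hY := hs'.input.rankY
    have hZ := hs'.input.rankZ
  · simp only [NExp.Fits, NExp.eval, hidx, h'.nat 1 (by norm_num), hp, hY, and_true]
    omega
  · have hl' := hs'.lev
    refine Does.setEntry h64 ?_ hidx hI hJ ?_ ?_ (by simp [KExp.cost, NExp.cost])
    · simp only [NExp.Fits]; omega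
    · simp only [KExp.Fits, NExp.Fits, NExp.eval, NOp.eval, hJ, hZ]; omega
    · simp only [KExp.eval, NExp.eval, NOp.eval, hI, hJ, hl', hZ, h'.nat 4 (by norm_num)]
      rw [h'.scal 20 ℓ (Or.inl (by norm_num))]

theorem mainBody_does {π : Program k} {c : ℕ} {τ : ℕ → ℕ} (hπ : MulsIn π c τ Q)
    (hprocs : ∀ (n : ℕ) (p : Stmt k), π.procs[n]? = some p → procs[n]? = some (p.shift 64))
    {ℓ N pr T t : ℕ} (hinv : InvertsIn procs W pr ℓ T Q) (hNℓ : N = 2 ^ ℓ) {s : State k Q}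
    (hs : Ctx D P e (ℓ + 1) N t s) (h64 : 64 ≤ W)
    (hNW : 4 * N < W) (hc : (N + 2) ^ c ≤ W) (hr : D.rankZ + D.rankY ≤ N)
    {p q : Q} (hp : s.elt 1 0 t 0 = some p) (hq : s.elt 1 1 t 0 = some q) :
    Does procs W (mainBody π.main pr) s (10000 * N ^ 2 + 4 * T + 5 * τ N) fun s' =>
      Step t s s' ∧ D.Output N p q t s' := by
  have hN : 1 ≤ N := hNℓ ▸ Nat.one_le_two_pow
  have hN2 : 1 ≤ N ^ 2 := Nat.one_le_pow _ _ hN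
  -- The multiples of `N ^ 2` are `4 * 400` for loading, `9 * 600` for the operations and `4 * 300`
  -- for lists and output, in total `8200`.
  refine Does.mono (Does.seq (T₁ := 400 * N ^ 2) (T₂ := 400 * N ^ 2 + (400 * N ^ 2 + (400 * N ^ 2 +
    ((4 * T + 5 * τ N + 9 * (600 * N ^ 2)) + 1 + (300 * N ^ 2 + (300 * N ^ 2 +
    (300 * N ^ 2 + 300 * N ^ 2))))))) ?_) (by omega) fun _ h => h
  refine (loadCyc_does hs h64 hN hNW (by norm_num) (by norm_num) hp).mono le_rfl ?_
  rintro s₁ ⟨m₁, v₁⟩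
  have t₁ : Step t s s₁ := (m₁.frame (by norm_num) (Or.inl le_rfl)).step t
  refine Does.seq ((loadBd_does (hs.step t₁) h64 hN hNW (by norm_num) (by norm_num)
    (by rw [t₁.elt 1 (by norm_num), hp])).mono le_rfl ?_)
  rintro s₂ ⟨m₂, v₂⟩
  have t₂ := t₁.trans ((m₂.frame (by norm_num) (Or.inl le_rfl)).step t)
  refine Does.seq ((loadCyc_does (hs.step t₂) h64 hN hNW (by norm_num) (by norm_num)
    (by rw [t₂.elt 1 (by norm_num), hq])).mono le_rfl ?_)
  rintro s₃ ⟨m₃, v₃⟩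
  have t₃ := t₂.trans ((m₃.frame (by norm_num) (Or.inl le_rfl)).step t)
  refine Does.seq ((loadBd_does (hs.step t₃) h64 hN hNW (by norm_num) (by norm_num)
    (by rw [t₃.elt 1 (by norm_num), hq])).mono le_rfl ?_)
  rintro s₄ ⟨m₄, v₄⟩
  have t₄ := t₃.trans ((m₄.frame (by norm_num) (Or.inl le_rfl)).step t)
  have c₄ := hs.step t₄
  have a₄ : AtLevel (ℓ + 1) N (fun b => of fun i j => s₄.scal b (ℓ + 1) i j) s₄ :=
    ⟨c₄.lev, c₄.siz, fun _ _ _ _ => rfl⟩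
  have e12 : (of fun i j : Fin N => s₄.scal 12 (ℓ + 1) i j) = D.cycMat N p := by
    ext i j
    rw [of_apply, m₄.scal _ _ (Or.inl (by norm_num)), m₃.scal _ _ (Or.inl (by norm_num)),
      m₂.scal _ _ (Or.inl (by norm_num)), v₁ i i.2 j j.2]
    rfl
  have e13 : (of fun i j : Fin N => s₄.scal 13 (ℓ + 1) i j) = D.bdMat N p := by
    ext i j
    rw [of_apply, m₄.scal _ _ (Or.inl (by norm_num)), m₃.scal _ _ (Or.inl (by norm_num)),
      v₂ i i.2 j j.2]
    rfl
  have e14 : (of fun i j : Fin N => s₄.scal 14 (ℓ + 1) i j) = D.cycMat N q := by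
    ext i j
    rw [of_apply, m₄.scal _ _ (Or.inl (by norm_num)), v₃ i i.2 j j.2]
    rfl
  have e15 : (of fun i j : Fin N => s₄.scal 15 (ℓ + 1) i j) = D.bdMat N q := by
    ext i j
    rw [of_apply, v₄ i i.2 j j.2]
    rfl
  refine Does.seq ((compileList_does hπ hprocs hinv hNℓ (by omega) h64 hc mainOps mainOps_valid a₄
    (mainOps_wp _)).mono (by rw [mainOps_time]) ?_)
  rintro s₅ ⟨f₅, σ, a₅, w20, w21, w22, w23, w24⟩
  rw [e12] at w20 w24
  rw [e13] at w21
  rw [e14] at w22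
  rw [e15] at w23 w24
  have t₅ := t₄.trans (f₅.step t)
  have hdiag : ∀ b, IsSlot b → ∀ l < N, s₅.scal b (ℓ + 1) l l = extend (σ b) l l := by
    intro b hb l hl
    rw [extend_apply _ hl hl]
    exact a₅.mat b hb ⟨l, hl⟩ ⟨l, hl⟩
  refine Does.seq ((buildList_does (p := p) (hs.step t₅) h64 hN hNW (by norm_num) (by norm_num)
    (w20 ▸ hdiag 20 (by decide)) (w21 ▸ hdiag 21 (by decide))).mono le_rfl ?_)
  intro s₆ l₆
  have t₆ := t₅.trans (l₆.step (by norm_num))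
  refine Does.seq ((buildList_does (p := q) (hs.step t₆) h64 hN hNW (by norm_num) (by norm_num)
    (by rw [l₆.scal]; exact w22 ▸ hdiag 22 (by decide))
    (by rw [l₆.scal]; exact w23 ▸ hdiag 23 (by decide))).mono le_rfl ?_)
  intro s₇ l₇
  have t₇ := t₆.trans (l₇.step (by norm_num))
  have hdp : s₇.nat 1 0 t 0 = D.num N p N := by
    rw [l₇.nat_one 0 t 0 (Or.inl (by norm_num)), l₆.num]
  have hl4 : ∀ l, D.IsPos N p l → s₇.nat 4 (D.num N p l) 0 0 = l := fun l hl => by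
    rw [l₇.nat 4 (by norm_num) (by norm_num) (by norm_num), l₆.list l hl]
  refine Does.seq ((writeMatrix_does (hs.step t₇) h64 hN hNW hdp l₇.num).mono le_rfl ?_)
  rintro s₈ ⟨m₈, v₈⟩
  have t₈ := t₇.trans (m₈.step (by norm_num))
  refine (writeBasis_does (p := p) (hs.step t₈) h64 hN hNW hr
    (by rw [m₈.nat 1 (by norm_num), hdp])).mono le_rfl ?_
  rintro s₉ ⟨m₉, v₉⟩
  refine ⟨t₈.trans (m₉.step (by norm_num)), ?_, ?_, fun i j hi hj => ?_, fun j l y hy hl hj => ?_⟩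
  · rw [m₉.nat 1 (by norm_num), m₈.nat 1 (by norm_num), hdp]
  · rw [m₉.nat 1 (by norm_num), m₈.nat 1 (by norm_num), l₇.num]
  · rw [m₉.scal 1 t (Or.inl (by norm_num)), v₈ _ (D.num_lt i.2 hi) _ (D.num_lt j.2 hj),
      hl4 j hj, l₇.list i hi, l₇.scal, l₆.scal, ← w24]
    exact a₅.mat 24 (by decide) j i
  · rw [v₉ _ (D.num_lt j.2 hj) y hy, m₈.nat 4 (by norm_num), hl4 j hj,
      m₈.scal 20 _ (Or.inl (by norm_num)), l₇.scal, l₆.scal, ← w20, ← hl]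
    exact a₅.mat 20 (by decide) j l

end Run

/-! ### Correctness of the whole program. -/

section Total

variable {k : Type u} [Field k] {Q : Type v} [PartialOrder Q]
variable {r : ℕ} {D : QrComplex.{u, v, w} k Q r} {P : Subposet Q} {m : ℕ} {e : Fin m ≃ P.Relations}
variable {procs : List (Stmt k)} {W : ℕ}

/-- Each doubling reduces the gap between the size and `r` by at least one, so at most `r` of them
occur, and the last one starts below `r`. The level is one more than the logarithm of the size, as
`MOp.compile_does` requires. -/
theorem initSize_does {s : State k Q} (hs : IsInput D P e s) (hW : 4 * r + 8 ≤ W) :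
    Does procs W initSize s (40 * r + 40) fun s' => IsInput D P e s' ∧ ∃ ℓ,
      s'.nat 2 0 0 0 = ℓ + 1 ∧ s'.nat 2 1 0 0 = 2 ^ ℓ ∧ r ≤ 2 ^ ℓ ∧ 2 ^ ℓ ≤ 2 * max 1 r := by
  -- Here `d` bounds the number of doublings still to come.
  have key : ∀ (d ℓ : ℕ) (s' : State k Q), IsInput D P e s' → s'.nat 2 0 0 0 = ℓ + 1 →
      s'.nat 2 1 0 0 = 2 ^ ℓ → r ≤ 2 ^ ℓ + d → 2 ^ ℓ ≤ 2 * max 1 r →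
      Does procs W (.loop (.nlt siz totalRank)
        (.seq (setCell 2 1 (.op .mul siz (.lit 2))) (setCell 2 0 (.op .add lev (.lit 1))))) s'
        (40 * d + 20) fun s' => IsInput D P e s' ∧ ∃ ℓ,
      s'.nat 2 0 0 0 = ℓ + 1 ∧ s'.nat 2 1 0 0 = 2 ^ ℓ ∧ r ≤ 2 ^ ℓ ∧ 2 ^ ℓ ≤ 2 * max 1 r := by
    intro d
    induction d with
    | zero =>
      intro ℓ s' hin hlev hsiz hd hN
      have hr := D.rank_eq
      refine ⟨_, s', .loopStop ?_ ?_, ?_, hin, ℓ, hlev, hsiz, hd, hN⟩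
      · simp only [BExp.Fits, NExp.Fits, NExp.eval, NOp.eval, hin.rankX, hin.rankY, hin.rankZ]
        omega
      · simp only [BExp.Holds, NExp.eval, NOp.eval, hin.rankX, hin.rankY, hin.rankZ, hsiz]
        omega
      · simp [BExp.cost, NExp.cost]
    | succ d ih =>
      intro ℓ s' hin hlev hsiz hd hN
      have hr := D.rank_eq
      have hfit : BExp.Fits W s'.nat (.nlt siz totalRank : BExp k) := by
        simp only [BExp.Fits, NExp.Fits, NExp.eval, NOp.eval, hin.rankX, hin.rankY, hin.rankZ]
        omega
      have hholds : BExp.Holds s' (.nlt siz totalRank : BExp k) ↔ 2 ^ ℓ < r := by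
        simp only [BExp.Holds, NExp.eval, NOp.eval, hin.rankX, hin.rankY, hin.rankZ, hsiz, hr]
      by_cases hlt : 2 ^ ℓ < r
      · have hℓ : ℓ < 2 ^ ℓ := Nat.lt_two_pow_self
        have hpow : 2 ^ (ℓ + 1) = 2 ^ ℓ * 2 := pow_succ 2 ℓ
        have hbody : Does procs W (.seq (setCell 2 1 (.op .mul siz (.lit 2)))
            (setCell 2 0 (.op .add lev (.lit 1)))) s' (10 + 10) fun s'' => IsInput D P e s'' ∧
              s''.nat 2 0 0 0 = ℓ + 1 + 1 ∧ s''.nat 2 1 0 0 = 2 ^ (ℓ + 1) := by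
          refine Does.seq (Does.setN ?_ (by simp [NExp.cost])
            (Does.setN ?_ (by simp [NExp.cost]) ⟨?_, ?_, ?_⟩))
          · simp only [NExp.Fits, NExp.eval, NOp.eval, hsiz]; omega
          · simp only [NExp.Fits, NExp.eval, NOp.eval, Mem.write]
            rw [if_neg (by omega), hlev]
            omega
          · refine hin.congr ?_ (fun _ _ => rfl) fun _ => rfl
            funext i j l
            simp [Mem.write]
          · simp [Mem.write, NExp.eval, NOp.eval, hlev]
          · simp [Mem.write, NExp.eval, NOp.eval, hsiz, hpow]
        obtain ⟨t₁, s₁, x₁, ht₁, hin₁, hlev₁, hsiz₁⟩ := hbody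
        obtain ⟨t₂, s₂, x₂, ht₂, h₂⟩ := ih (ℓ + 1) s₁ hin₁ hlev₁ hsiz₁ (by omega) (by omega)
        refine ⟨_, s₂, .loopStep hfit (hholds.2 hlt) x₁ x₂, ?_, h₂⟩
        simp only [BExp.cost, NExp.cost]
        omega
      · refine ⟨_, s', .loopStop hfit (mt hholds.1 hlt), ?_, hin, ℓ, hlev, hsiz, by omega, hN⟩
        simp only [BExp.cost, NExp.cost]
        omega
  refine Does.mono (Does.seq (T₁ := 5) (T₂ := 5 + (40 * r + 20)) (Does.setN ?_ (by simp [NExp.cost])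
    (Does.seq (Does.setN ?_ (by simp [NExp.cost]) (key r 0 _ ?_ ?_ ?_ (by omega) (by omega))))))
    (by omega) fun _ h => h
  · simp only [NExp.Fits]; omega
  · simp only [NExp.Fits]; omega
  · refine hs.congr ?_ (fun _ _ => rfl) fun _ => rfl
    funext i j l
    simp [Mem.write]
  · simp [Mem.write, NExp.eval]
  · simp [Mem.write, NExp.eval]

theorem QrComplex.Output.congr {N : ℕ} {p q : Q} {t : ℕ} {s s' : State k Q}
    (h : D.Output N p q t s) (h₁ : ∀ i, s'.nat 1 i t 0 = s.nat 1 i t 0)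
    (h₂ : s'.scal 1 t = s.scal 1 t) (h₃ : s'.scal 2 t = s.scal 2 t) : D.Output N p q t s' :=
  ⟨by rw [h₁, h.dim_source], by rw [h₁, h.dim_target],
    fun i j hi hj => by rw [h₂, h.matrix i j hi hj],
    fun j l y hy hl hj => by rw [h₃, h.basis j l y hy hl hj]⟩

/-- The loop invariant consists of the intact input and the outputs of all earlier relations.
Relation `t` writes its output under the index `t` only, so the earlier outputs survive. -/
theorem mainProgram_does {π : Program k} {c : ℕ} {τ : ℕ → ℕ} (hπ : MulsIn π c τ Q)
    {s : State k Q} (hs : IsInput D P e s) (h64 : 64 ≤ W) (hm : m < W) (hrW : 8 * (r + 1) < W)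
    (hc : (2 * max 1 r + 2) ^ c ≤ W) :
    ∃ ℓ, 2 ^ ℓ ≤ 2 * max 1 r ∧ Does (mainProgram π).procs W (mainProgram π).main s
      (40 * r + 64 + m * (10000 * (2 ^ ℓ) ^ 2 + 4 * invTime τ ℓ + 5 * τ (2 ^ ℓ) + 24))
      fun s' => ∃ M : MatrixRep (P.incl ⋙ D.homology), IsOutput D P e M s' := by
  obtain ⟨t₁, s₁, x₁, ht₁, hin, ℓ, hlev, hsiz, hr, hN⟩ :=
    initSize_does (procs := (mainProgram π).procs) hs (show 4 * r + 8 ≤ W by omega)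
  refine ⟨ℓ, hN, ?_⟩
  have hrank := D.rank_eq
  have hNc : (2 ^ ℓ + 2) ^ c ≤ W := (Nat.pow_le_pow_left (by omega) c).trans hc
  have hprocs : ∀ (n : ℕ) (p : Stmt k), π.procs[n]? = some p →
      (mainProgram π).procs[n]? = some (p.shift 64) := by
    intro n p hn
    have hlt : n < π.procs.length := (List.getElem?_eq_some_iff.1 hn).1
    rw [mainProgram, List.getElem?_append_left (by simpa using hlt), List.getElem?_map, hn]
    rfl
  have hinv : (mainProgram π).procs[π.procs.length]?
      = some (invProc π.main π.procs.length) := by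
    simp [mainProgram]
  have hI := invProc_does hπ hprocs hinv h64 ℓ (by omega) hNc
  have hloop := Does.forN (procs := (mainProgram π).procs) (W := W) (c := 2) (v := 2)
    (bound := cell 0 3) (body := mainBody π.main π.procs.length) (s := s₁) (n := m)
    (T := 10000 * (2 ^ ℓ) ^ 2 + 4 * invTime τ ℓ + 5 * τ (2 ^ ℓ))
    (fun i s' => IsInput D P e s' ∧ s'.nat 2 0 0 0 = ℓ + 1 ∧ s'.nat 2 1 0 0 = 2 ^ ℓ ∧
      ∀ t : Fin m, t.val < i → D.Output (2 ^ ℓ) (e t).1.1.val (e t).1.2.val t s')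
    (by omega) hm (fun i _ s' h' _ => ?_) ?_ fun i hi s' h' hI' => ?_
  · obtain ⟨t₂, s₂, x₂, ht₂, _, _, _, h₂⟩ := hloop
    refine ⟨t₁ + t₂, s₂, .seq x₁ x₂, ?_, ?_⟩
    · simp only [NExp.cost] at ht₂
      calc t₁ + t₂ ≤ (40 * r + 40) + _ := add_le_add ht₁ ht₂
        _ = _ := by ring
    · exact QrComplex.exists_isOutput (ℓ := ℓ) rfl (by omega) (by omega) P e s₂
        fun t => h₂ t t.2
  · simp only [NExp.Fits, NExp.eval, h'.1.num, and_true]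
    omega
  · refine ⟨hin.congr (State.put_nat_of_ne _ _ _ (by norm_num)) (fun _ _ => rfl) fun _ => rfl,
      ?_, ?_, fun t ht => absurd ht (by omega)⟩
    · simp [Mem.write, hlev]
    · simp [Mem.write, hsiz]
  · obtain ⟨hin', hlev', hsiz', hout⟩ := h'
    have hctx : Ctx D P e (ℓ + 1) (2 ^ ℓ) i s' := ⟨hin', hlev', hsiz', hI'⟩
    refine (mainBody_does hπ hprocs hI rfl hctx h64 (by omega) hNc (by omega)
      (hin'.source ⟨i, hi⟩) (hin'.target ⟨i, hi⟩)).mono le_rfl ?_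
    rintro s'' ⟨hst, ho⟩
    have hctx' := hctx.step hst
    refine ⟨hctx'.idx, hctx'.input.congr (State.put_nat_of_ne _ _ _ (by norm_num))
      (fun _ _ => rfl) fun _ => rfl, ?_, ?_, fun t ht => ?_⟩
    · simp [Mem.write, hctx'.lev]
    · simp [Mem.write, hctx'.siz]
    · have hput : ∀ j, (s''.put 2 2 (i + 1)).nat 1 j t 0 = s''.nat 1 j t 0 := fun j => by
        rw [State.put_nat_of_ne _ _ _ (by norm_num)]
      rcases Nat.lt_succ_iff_lt_or_eq.1 ht with hlt | heq
      · refine (hout t hlt).congr (fun j => ?_) ?_ ?_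
        · rw [hput, hst.nat_one j t 0 hlt.ne]
        · exact hst.scal 1 (by norm_num) t (Or.inr hlt.ne)
        · exact hst.scal 2 (by norm_num) t (Or.inr hlt.ne)
      · obtain rfl : t = ⟨i, hi⟩ := Fin.ext heq
        exact ho.congr hput rfl rfl

end Total

/-! ### The word bound and the total time. -/

theorem wordBound (r m c : ℕ) : 64 ≤ (r + m + 2) ^ (2 * c + 10) ∧ m < (r + m + 2) ^ (2 * c + 10) ∧
    8 * (r + 1) < (r + m + 2) ^ (2 * c + 10) ∧
    (2 * max 1 r + 2) ^ c ≤ (r + m + 2) ^ (2 * c + 10) := by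
  -- The exponent `2 * c` comes from `2 * max 1 r + 2 ≤ 2 * b ≤ b ^ 2`; the additional `10` gives a
  -- factor `2 ^ 9 * b`, enough for the three linear bounds.
  set b := r + m + 2 with hb
  have hb2 : 2 ≤ b := by omega
  have h1 : b ^ 10 ≤ b ^ (2 * c + 10) := Nat.pow_le_pow_right (by omega) (by omega)
  have h2 : (2 : ℕ) ^ 9 ≤ b ^ 9 := Nat.pow_le_pow_left hb2 9
  have h3 : 2 ^ 9 * b ≤ b ^ 10 := by
    rw [pow_succ b 9]
    exact Nat.mul_le_mul_right b h2
  refine ⟨by omega, by omega, by omega, ?_⟩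
  have h4 : 2 * max 1 r + 2 ≤ 2 * b := by omega
  have h5 : 2 * b ≤ b ^ 2 := by rw [sq]; exact Nat.mul_le_mul_right b hb2
  calc (2 * max 1 r + 2) ^ c ≤ (b ^ 2) ^ c := Nat.pow_le_pow_left (h4.trans h5) c
    _ = b ^ (2 * c) := by rw [← pow_mul]
    _ ≤ _ := Nat.pow_le_pow_right (by omega) (by omega)

/-- From `N ≤ 2 * R` follows `N ^ ω ≤ 2 ^ ω * R ^ ω`, and `N ^ 2 ≤ N ^ ω` as `2 < ω`. The constant
`128 = 40 + 64 + 24` pays for the initialization and the overhead of the loop. -/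
theorem totalTime_le {ω C₀ C₁ : ℝ} (hω : 2 < ω) (hC₀ : 0 ≤ C₀) (hC₁ : 0 ≤ C₁) {N r m T t τ : ℕ}
    (hN : N ≤ 2 * max 1 r) (hT : (T : ℝ) ≤ C₁ * (N : ℝ) ^ ω) (hτ : (τ : ℝ) ≤ C₀ * (N : ℝ) ^ ω)
    (ht : t ≤ 40 * r + 64 + m * (10000 * N ^ 2 + 4 * T + 5 * τ + 24)) :
    (t : ℝ) ≤ ((10000 + 4 * C₁ + 5 * C₀) * 2 ^ ω + 128) * (max 1 m : ℕ) *
      ((max 1 r : ℕ) : ℝ) ^ ω := by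
  set R := max 1 r with hR
  set M := max 1 m with hM
  have hR1 : (1 : ℝ) ≤ R := by exact_mod_cast le_max_left 1 r
  have hM1 : (1 : ℝ) ≤ M := by exact_mod_cast le_max_left 1 m
  have hrR : (r : ℝ) ≤ R := by exact_mod_cast le_max_right 1 r
  have hmM : (m : ℝ) ≤ M := by exact_mod_cast le_max_right 1 m
  have hRω : (R : ℝ) ≤ (R : ℝ) ^ ω := Real.self_le_rpow_of_one_le hR1 (by linarith)
  have hNω : (N : ℝ) ^ ω ≤ 2 ^ ω * (R : ℝ) ^ ω := by
    rw [← Real.mul_rpow (by norm_num) (by linarith)]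
    exact Real.rpow_le_rpow (Nat.cast_nonneg N) (by exact_mod_cast hN) (by linarith)
  have hN2 : (N : ℝ) ^ 2 ≤ (N : ℝ) ^ ω := by
    rcases Nat.eq_zero_or_pos N with rfl | hpos
    · simpa using Real.rpow_nonneg le_rfl ω
    · rw [← Real.rpow_two]
      exact Real.rpow_le_rpow_of_exponent_le (by exact_mod_cast hpos) hω.le
  have hbody : 10000 * (N : ℝ) ^ 2 + 4 * T + 5 * τ + 24 ≤
      ((10000 + 4 * C₁ + 5 * C₀) * 2 ^ ω + 24) * (R : ℝ) ^ ω := by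
    calc 10000 * (N : ℝ) ^ 2 + 4 * T + 5 * τ + 24
        ≤ (10000 + 4 * C₁ + 5 * C₀) * (N : ℝ) ^ ω + 24 * (R : ℝ) ^ ω := by linarith
      _ ≤ (10000 + 4 * C₁ + 5 * C₀) * (2 ^ ω * (R : ℝ) ^ ω) + 24 * (R : ℝ) ^ ω := by gcongr
      _ = _ := by ring
  have hMR : (R : ℝ) ^ ω ≤ M * (R : ℝ) ^ ω := le_mul_of_one_le_left (by linarith) hM1
  calc (t : ℝ) ≤ 40 * r + 64 + m * (10000 * (N : ℝ) ^ 2 + 4 * T + 5 * τ + 24) := by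
        exact_mod_cast ht
    _ ≤ 104 * (M * (R : ℝ) ^ ω) + M * (((10000 + 4 * C₁ + 5 * C₀) * 2 ^ ω + 24) * (R : ℝ) ^ ω) := by
        refine add_le_add (by linarith) ?_
        exact mul_le_mul hmM hbody (by positivity) (by positivity)
    _ = _ := by ring

end PosetComplex

theorem proposition3p19 {k : Type u} [Field k] (ω : ℝ) (hω : 2 < ω)
    (hmul : PosetComplex.IsMatMulExponent.{u, v} k ω) :
    ∃ (π : PosetComplex.Program k) (c : ℕ) (C : ℝ),
      ∀ (Q : Type v) [PartialOrder Q] (r : ℕ) (D : PosetComplex.QrComplex.{u, v, w} k Q r)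
        (P : PosetComplex.Subposet Q) (m : ℕ) (e : Fin m ≃ P.Relations)
        (s : PosetComplex.State k Q),
        PosetComplex.IsInput D P e s →
        ∃ (t : ℕ) (s' : PosetComplex.State k Q),
          π.Runs ((r + m + 2) ^ c) s t s' ∧
          (t : ℝ) ≤ C * (max 1 m : ℕ) * ((max 1 r : ℕ) : ℝ) ^ ω ∧
          ∃ M : PosetComplex.MatrixRep (P.incl ⋙ D.homology),
            PosetComplex.IsOutput D P e M s' := by
  obtain ⟨π, c, τ, C₀, hC₀, hτ, hπ⟩ := hmul.mulsIn
  obtain ⟨C₁, hC₁, hinv⟩ := PosetComplex.invTime_le hω hC₀ fun n _ => hτ n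
  refine ⟨PosetComplex.mainProgram π, 2 * c + 10, (10000 + 4 * C₁ + 5 * C₀) * 2 ^ ω + 128, ?_⟩
  intro Q _ r D P m e s hs
  obtain ⟨h64, hm, hr, hc⟩ := PosetComplex.wordBound r m c
  obtain ⟨ℓ, hN, t, s', hx, ht, hout⟩ := PosetComplex.mainProgram_does (hπ Q) hs h64 hm hr hc
  exact ⟨t, s', hx, PosetComplex.totalTime_le hω hC₀ hC₁ hN (hinv ℓ) (hτ _) ht, hout⟩
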